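/- Let $\nu:\mathbb R\to[0,\infty)$ be even and increasing on $[0,\infty)$, with $\nu(0)=1$, such that $\|(s,t)\|_\nu=|t|\,\nu(|s/t|)$ (for $t\neq 0$) defines a norm on $\mathbb R^2$; let $\beta>0$. Let $u$ be a smooth real function on a set $\Omega\subset\mathbb R^2$ (e.g. a closed domain) and put $f=\beta u$. For a regular $C^1$ curve $\gamma:[0,1]\to\Omega$ let $$L_\nu(\gamma)=\int_0^1\nu\!\left(\frac{(f\circ\gamma)'(t)}{|\gamma'(t)|}\right)|\gamma'(t)|\,dt ,$$ let the amoeba distance $d(p,q)$ be the infimum of $L_\nu(\gamma)$ over all such curves from $p$ to $q$, and let $\mathcal A_\varrho(p)=\{q\in\Omega: d(p,q)\le\varrho\}$ be the amoeba of radius $\varrho$. One step of amoeba median filtering of $u$ replaces $u(p)$ by a median $\mu_\varrho(p)$, with respect to area, of the values of $u$ on $\mathcal A_\varrho(p)$. Put $$g(s)=1-\tfrac32\,\beta s\,\tilde J_1(\beta s),\qquad \tilde J_1(s)=\int_{-\pi/2}^{\pi/2}\frac{\nu'(s\cos\vartheta)}{\nu(s\cos\vartheta)^4}\sin^2\vartheta\,d\vartheta,\qquad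 \tilde J_3(s)=\int_{-\pi/2}^{\pi/2}\frac{\nu'(s\cos\vartheta)}{\nu(s\cos\vartheta)^4}\cos^2\vartheta\,d\vartheta .$$ Then: 1. $g$ is differentiable on $(0,\infty)$, and $s\,g'(s)=-\tfrac32\,\beta s\,\tilde J_3(\beta s)$ for all $s>0$. 2. The amoeba median filter with $f=\beta u$ approximates the self-snakes equation $$u_t=|\nabla u|\,\mathrm{div}\!\left(g(|\nabla u|)\frac{\nabla u}{|\nabla u|}\right)$$ in the following sense: at every interior point $x_0$ of $\Omega$ with $\nabla u(x_0)\ne0$ the vector field $g(|\nabla u|)\nabla u/|\nabla u|$ is differentiable, a median $\mu_\varrho(x_0)$ exists for all sufficiently small $\varrho>0$, and for every choice of the medians $$\mu_\varrho(x_0)=u(x_0)+\frac{\varrho^2}{6}\,\Bigl[\,|\nabla u|\,\mathrm{div}\Bigl(g(|\nabla u|)\frac{\nabla u}{|\nabla u|}\Bigr)\Bigr](x_0)+o(\varrho^2)\qquad(\varrho\to0^+),$$ that is, one filter step is asymptotically a time step of size $\varrho^2/6$ of an explicit time discretisation. If moreover $\nu$ is $C^2$ on $[0,\infty)$ (one-sided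 at $0$), the error is $O(\varrho^3)$. 3. With $\psi(q)=q\,\nu(1/q)$ for $q>0$ and $\psi^{-1}$ its inverse function, for all $s>0$ $$g(s)=\frac{3\,I_1(\beta s)}{\beta^2s^2\,\psi\bigl(\frac1{\beta s}\bigr)^3},\qquad I_1(\beta s)=\int_0^1\xi^2\sqrt{\Bigl(\psi^{-1}\bigl(\tfrac1\xi\,\psi(\tfrac1{\beta s})\bigr)\Bigr)^2-\frac1{\beta^2s^2}}\;d\xi .$$ (If $\psi$ is not injective, any choice of preimage may be used for $\psi^{-1}$; this affects $I_1$ in at most one value of $\xi$.) -/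

import Mathlib

open Set Filter Topology MeasureTheory
open scoped ENNReal ContDiff

/-- The image plane `ℝ²` with its Euclidean norm. -/
abbrev Plane : Type := EuclideanSpace ℝ (Fin 2)

noncomputable section AmoebaFiltering

/-- The functions `ν` from which amoeba metrics are built: nonnegative, even, increasing on
`[0, ∞)`, and such that `‖(s, t)‖_ν = t ν(|s / t|)` is a norm on `ℝ²`. The formula is used for
`t > 0`; homogeneity of the norm then gives `|t| ν(|s / t|)` for `t < 0` and continuity of the norm
fixes its values for `t = 0`. No smoothness of `ν` is required, so `ν(s) = 1 + |s|` is covered. -/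
structure IsAmoebaProfile (ν : ℝ → ℝ) : Prop where
  nonneg : ∀ s, 0 ≤ ν s
  even : ∀ s, ν (-s) = ν s
  mono : MonotoneOn ν (Set.Ici 0)
  norm : ∃ N : Seminorm ℝ (ℝ × ℝ), (∀ p, N p = 0 → p = 0) ∧
    ∀ s t : ℝ, 0 < t → N (s, t) = t * ν |s / t|

/-- `γ` parametrises over `[0, 1]` (the base curve in the plane of) a regular curve on the image
graph over `Ω` from `p` to `q`. A `C¹` curve on `[0, 1]` extends to a `C¹` curve on `ℝ`; the
values outside `[0, 1]` play no role. -/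
structure IsRegularCurve (Ω : Set Plane) (p q : Plane) (γ : ℝ → Plane) : Prop where
  contDiff : ContDiff ℝ 1 γ
  regular : ∀ t ∈ Set.Icc (0 : ℝ) 1, deriv γ t ≠ 0
  mem : ∀ t ∈ Set.Icc (0 : ℝ) 1, γ t ∈ Ω
  source : γ 0 = p
  target : γ 1 = q

/-- The amoeba length of the curve `t ↦ (γ t, f (γ t))`, with the contrast scale fixed to `1`. -/
def amoebaLength (ν : ℝ → ℝ) (f : Plane → ℝ) (γ : ℝ → Plane) : ℝ :=
  ∫ t in (0 : ℝ)..1, ν (deriv (fun r => f (γ r)) t / ‖deriv γ t‖) * ‖deriv γ t‖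

/-- The amoeba distance: infimum of the amoeba lengths of the connecting curves (`∞` if there
is none). -/
def amoebaDist (ν : ℝ → ℝ) (Ω : Set Plane) (f : Plane → ℝ) (p q : Plane) : ℝ≥0∞ :=
  ⨅ (γ : ℝ → Plane) (_ : IsRegularCurve Ω p q γ), ENNReal.ofReal (amoebaLength ν f γ)

/-- The amoeba of radius `ρ` around `p` generated from `f`. -/
def amoeba (ν : ℝ → ℝ) (Ω : Set Plane) (f : Plane → ℝ) (ρ : ℝ) (p : Plane) : Set Plane :=
  {q | q ∈ Ω ∧ amoebaDist ν Ω f p q ≤ ENNReal.ofReal ρ}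

/-- `μ` is a median, with respect to area, of the values of `u` on `A`. -/
def IsMedianOn (u : Plane → ℝ) (A : Set Plane) (μ : ℝ) : Prop :=
  volume {x | x ∈ A ∧ u x < μ} ≤ volume A / 2 ∧ volume {x | x ∈ A ∧ μ < u x} ≤ volume A / 2

/-- `μ` is the result at `p` of one step, with amoeba radius `ρ`, of amoeba median filtering of
`u` governed by amoebas generated from `f`. -/
def IsAmoebaMedian (ν : ℝ → ℝ) (Ω : Set Plane) (f u : Plane → ℝ) (ρ : ℝ) (p : Plane) (μ : ℝ) :
    Prop :=
  IsMedianOn u (amoeba ν Ω f ρ p) μ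

/-- Divergence of a planar vector field. -/
def divergence (F : Plane → Plane) (x : Plane) : ℝ :=
  ∑ i, fderiv ℝ F x (EuclideanSpace.single i 1) i

/-- The vector field `g(|∇u|) ∇u / |∇u|`. -/
def snakeFlux (g : ℝ → ℝ) (u : Plane → ℝ) (x : Plane) : Plane :=
  (g ‖gradient u x‖ / ‖gradient u x‖) • gradient u x

/-- Right-hand side `|∇u| div (g(|∇u|) ∇u / |∇u|)` of the self-snakes equation. -/
def selfSnakes (g : ℝ → ℝ) (u : Plane → ℝ) (x : Plane) : ℝ :=
  ‖gradient u x‖ * divergence (snakeFlux g u) x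

/-- `J̃₁(s) = ∫_{-π/2}^{π/2} ν'(s cos ϑ) / ν(s cos ϑ)⁴ · sin² ϑ dϑ`. For the profiles considered,
`ν` is differentiable outside a countable set, so `ν'` is defined at almost every `ϑ` if
`s ≠ 0`. -/
def amoebaJ1 (ν : ℝ → ℝ) (s : ℝ) : ℝ :=
  ∫ θ in (-(Real.pi / 2))..(Real.pi / 2),
    deriv ν (s * Real.cos θ) / ν (s * Real.cos θ) ^ 4 * Real.sin θ ^ 2

/-- `J̃₃(s) = ∫_{-π/2}^{π/2} ν'(s cos ϑ) / ν(s cos ϑ)⁴ · cos² ϑ dϑ`. -/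
def amoebaJ3 (ν : ℝ → ℝ) (s : ℝ) : ℝ :=
  ∫ θ in (-(Real.pi / 2))..(Real.pi / 2),
    deriv ν (s * Real.cos θ) / ν (s * Real.cos θ) ^ 4 * Real.cos θ ^ 2

/-- The edge-stopping function `g(s) = 1 - (3/2) β s J̃₁(β s)`. -/
def edgeStop (ν : ℝ → ℝ) (β s : ℝ) : ℝ :=
  1 - 3 / 2 * β * s * amoebaJ1 ν (β * s)

/-- `ψ(q) = q ν(1/q)`, considered for `q > 0`. -/
def amoebaPsi (ν : ℝ → ℝ) (q : ℝ) : ℝ := q * ν (1 / q)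

/-- The inverse function of `ψ` on `(0, ∞)`. -/
def amoebaPsiInv (ν : ℝ → ℝ) : ℝ → ℝ := Function.invFunOn (amoebaPsi ν) (Set.Ioi 0)

/-- `I₁(s) = ∫₀¹ ξ² √(ψ⁻¹(ψ(1/s)/ξ)² - 1/s²) dξ`. -/
def amoebaI1 (ν : ℝ → ℝ) (s : ℝ) : ℝ :=
  ∫ ξ in (0 : ℝ)..1,
    ξ ^ 2 * Real.sqrt (amoebaPsiInv ν (1 / ξ * amoebaPsi ν (1 / s)) ^ 2 - 1 / s ^ 2)

end AmoebaFiltering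

/-! Asymptotics of the median. Put `a = |∇u(x₀)|` and take coordinates centred at `x₀` with first
axis along the gradient; `q₁₁, q₁₂, q₂₂` are the second derivatives of `u` there. Since `ν` is a
norm restricted to an affine line, it is convex and has a monotone odd subgradient `p`. Integrating
a tangent line inequality along an arbitrary curve bounds its amoeba length from below by data at
the end points alone (`le_amoebaLength`); a straight segment attains this bound up to a second
difference of `ν` (`mem_amoeba`). In polar coordinates the amoeba is therefore, up to small errors,
`r n(θ) + k(θ) r² ≤ ρ` with `n(θ) = ν(βa cos θ)` and `k(θ) = p(βa cos θ) · (β/2) Q(cos θ, sin θ)`,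
where `Q` is the Hessian form, so that its boundary is `r = ρ/n - kρ²/n³ + ...`. Under `v ↦ -v` the
function `n` is invariant and `k` changes sign. Hence the right and left halves of the amoeba differ
in area by `-2ρ³ ∫ k/n⁴ = -ρ³ β (q₁₁ J̃₃ + q₂₂ J̃₁)` (`exists_half_area`).

The level line `u = u(x₀) + ρ² m` is close to the parabola `a x = ρ² m - q₂₂ y²/2`. As `ν 0 = 1`,
the amoeba has height about `ρ` on either side, and the signed area between the vertical axis and
the level line is about `ρ³ (2m - q₂₂/3)/a` (`exists_strip_area`). The median level is the one for
which twice this area balances the difference of the halves, that is `6m = g(a) q₂₂ + a g'(a) q₁₁`,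
which is the self-snakes operator in gauge coordinates (`selfSnakes_eq`).

A kink of `ν` makes the second difference of first order in `ρ` instead of second. After integration
over `θ` it is still `o(ρ)`, because a monotone `p` has only countably many jumps, and it is `O(ρ²)`
if `ν` is `C²` on `[0, ∞)`. Only upper bounds for medians are proved directly; replacing `u` by `-u`
gives the lower ones. Amoebas are never shown to be measurable: they are compared with measurable
regions, and the median arguments do not need it.

Formulas for `g`. Integration by parts turns the definition into `g(s) = ½ ∫ cos θ / ν(βs cos θ)³
dθ`. Differentiating under the integral gives `J̃₃`, and Tonelli's theorem together with `σ = q tan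
θ`, `q = 1/(βs)`, gives `I₁`. -/

/-! ### Convexity of the profile -/

/-- The analytic content of an amoeba profile `ν` with `ν 0 = 1`: it is even, convex with a
monotone odd subgradient `p` bounded by `c`, at least `1`, and `t ↦ t ν(x / t)` is increasing. -/
structure ProfileSubgradient (ν p : ℝ → ℝ) (c : ℝ) : Prop where
  zero : ν 0 = 1
  one_le : ∀ x, 1 ≤ ν x
  even : ∀ x, ν (-x) = ν x
  mono : Monotone p
  odd : ∀ x, p (-x) = -p x
  sub : ∀ x y, ν x + p x * (y - x) ≤ ν y
  bound : ∀ x, |p x| ≤ c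
  mul_le : ∀ x, p x * x ≤ ν x

/-- The right derivative of the convex function `ν` is a monotone subgradient, but not odd at kinks.
Its odd part is odd everywhere, in particular zero at the origin, and remains monotone and a
subgradient because `ν` is even. -/
theorem IsAmoebaProfile.exists_subgradient {ν : ℝ → ℝ} (hν : IsAmoebaProfile ν) (h0 : ν 0 = 1) :
    ∃ p c, ProfileSubgradient ν p c := by
  obtain ⟨N, -, hN⟩ := hν.norm
  have habs : ∀ s, ν |s| = ν s := by
    intro s
    rcases abs_choice s with h | h <;> rw [h]
    exact hν.even s
  have hN' : ∀ s t : ℝ, 0 < t → N (s, t) = t * ν (s / t) := fun s t ht => by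
    rw [hN s t ht, habs]
  have hN1 : ∀ s, ν s = N (s, 1) := fun s => by rw [hN' s 1 one_pos]; simp
  have hconv : ConvexOn ℝ univ ν := by
    refine ⟨convex_univ, fun x _ y _ a b ha hb hab => ?_⟩
    have h := N.convexOn.2 (mem_univ (x, (1 : ℝ))) (mem_univ (y, (1 : ℝ))) ha hb hab
    have e : a • (x, (1 : ℝ)) + b • (y, (1 : ℝ)) = (a • x + b • y, 1) := by
      simp [hab]
    rw [e, ← hN1, ← hN1, ← hN1] at h
    exact h
  have hlip : ∀ x y, ν y - ν x ≤ N (1, 0) * |y - x| := by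
    intro x y
    have h := map_add_le_add N (x, (1 : ℝ)) ((y - x) • ((1 : ℝ), (0 : ℝ)))
    rw [map_smul_eq_mul] at h
    have e : (x, (1 : ℝ)) + (y - x) • ((1 : ℝ), (0 : ℝ)) = (y, 1) := by simp
    rw [e, ← hN1, ← hN1, Real.norm_eq_abs] at h
    linarith
  set r : ℝ → ℝ := fun x => derivWithin ν (Ioi x) x with hr
  have hrmono : Monotone r := by
    have h := hconv.monotoneOn_rightDeriv
    rw [interior_univ] at h
    exact fun x y hxy => h (mem_univ x) (mem_univ y) hxy
  have hrsub : ∀ x y, ν x + r x * (y - x) ≤ ν y := by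
    intro x y
    rcases lt_trichotomy x y with h | h | h
    · have := hconv.rightDeriv_le_slope_of_mem_interior (x := x) (y := y) (by simp) (mem_univ _) h
      rw [slope_def_field, le_div_iff₀ (by linarith)] at this
      linarith
    · simp [h]
    · have h1 := hconv.slope_le_leftDeriv_of_mem_interior (x := y) (y := x) (mem_univ _) (by simp) h
      have h2 := hconv.leftDeriv_le_rightDeriv_of_mem_interior (x := x) (by simp)
      have := h1.trans h2
      rw [slope_def_field, div_le_iff₀ (by linarith)] at this
      simp only [hr]
      linarith
  -- Average of the subgradient inequality at `x` and its mirror image at `-x`.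
  have hsub : ∀ x y, ν x + (r x - r (-x)) / 2 * (y - x) ≤ ν y := by
    intro x y
    have h1 := hrsub x y
    have h2 := hrsub (-x) (-y)
    rw [hν.even, hν.even] at h2
    linarith
  refine ⟨fun x => (r x - r (-x)) / 2, N (1, 0), h0, ?_, hν.even, ?_, ?_, hsub, ?_, ?_⟩
  · intro x
    rw [← h0, ← habs x]
    exact hν.mono (by simp) (by simp) (abs_nonneg x)
  · intro x y hxy
    have h1 := hrmono hxy
    have h2 := hrmono (neg_le_neg hxy)
    simp only
    linarith
  · intro x
    simp only [neg_neg]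
    ring
  · intro x
    rw [abs_le]
    have h1 := (hsub x (x + 1))
    have h2 := (hsub x (x - 1))
    have h3 := hlip x (x + 1)
    have h4 := hlip x (x - 1)
    simp at h1 h2 h3 h4
    constructor <;> linarith
  · intro x
    have hneg : ∀ s t : ℝ, N (s, -t) = N (s, t) := by
      intro s t
      rcases lt_trichotomy t 0 with h | h | h
      · have : N (s, t) = N (-s, -t) := by
          rw [← map_neg_eq_map N (s, t)]; simp
        rw [this, hN' _ _ (neg_pos.2 h), hN' _ _ (neg_pos.2 h), neg_div, hν.even]
      · simp [h]
      · have : N (s, -t) = N (-s, t) := by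
          rw [← map_neg_eq_map N (s, -t)]; simp
        rw [this, hN' _ _ h, hN' _ _ h, neg_div, hν.even]
    -- The norm is symmetric in its second argument, so on the segment from `(2x, -2)` to `(2x, 2)`
    -- it is at most its common value `2 ν x` at the ends; the point `(2x, 1)` lies on it. The
    -- subgradient inequality from `x` to `2x` then yields `p x * x ≤ ν x`.
    have h2 : ν (2 * x) ≤ 2 * ν x := by
      have e : ((2 * x, (1 : ℝ)) : ℝ × ℝ) = (3 / 4 : ℝ) • (2 * x, (2 : ℝ)) + (1 / 4 : ℝ) • (2 * x, (-2 : ℝ)) := by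
        ext <;> simp <;> ring
      have h := map_add_le_add N ((3 / 4 : ℝ) • (2 * x, (2 : ℝ))) ((1 / 4 : ℝ) • (2 * x, (-2 : ℝ)))
      rw [← e, map_smul_eq_mul, map_smul_eq_mul, hneg, hN' _ _ two_pos, ← hN1] at h
      norm_num at h
      linarith
    have h3 := hsub x (2 * x)
    linarith

namespace ProfileSubgradient

variable {ν p : ℝ → ℝ} {c : ℝ}

theorem c_nonneg (h : ProfileSubgradient ν p c) : 0 ≤ c := (abs_nonneg _).trans (h.bound 0)

theorem pos (h : ProfileSubgradient ν p c) (x : ℝ) : 0 < ν x := one_pos.trans_le (h.one_le x)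

theorem p_zero (h : ProfileSubgradient ν p c) : p 0 = 0 := by
  have := h.odd 0
  simp at this
  linarith

theorem abs_sub_le (h : ProfileSubgradient ν p c) (x y : ℝ) : |ν x - ν y| ≤ c * |x - y| := by
  have key : ∀ x y, ν x - ν y ≤ c * |x - y| := by
    intro x y
    have h1 := h.sub x y
    have h2 : p x * (x - y) ≤ c * |x - y| := by
      calc p x * (x - y) ≤ |p x * (x - y)| := le_abs_self _
        _ = |p x| * |x - y| := abs_mul _ _
        _ ≤ _ := by gcongr; exact h.bound x
    linarith
  rw [abs_le]
  have h1 := key x y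
  have h2 := key y x
  rw [abs_sub_comm] at h2
  constructor <;> linarith

theorem lipschitz (h : ProfileSubgradient ν p c) : LipschitzWith c.toNNReal ν := by
  refine LipschitzWith.of_dist_le_mul fun x y => ?_
  rw [Real.dist_eq, Real.dist_eq, Real.coe_toNNReal _ h.c_nonneg]
  exact h.abs_sub_le x y

theorem continuous (h : ProfileSubgradient ν p c) : Continuous ν := h.lipschitz.continuous

theorem hasDerivAt (h : ProfileSubgradient ν p c) {x : ℝ} (hx : ContinuousAt p x) :
    HasDerivAt ν (p x) x := by
  rw [hasDerivAt_iff_isLittleO, Asymptotics.isLittleO_iff]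
  intro ε hε
  filter_upwards [Metric.continuousAt_iff'.1 hx ε hε] with y hy
  have h1 := h.sub x y
  have h2 := h.sub y x
  rw [Real.dist_eq] at hy
  simp only [smul_eq_mul, Real.norm_eq_abs]
  rw [abs_of_nonneg (by linarith)]
  calc ν y - ν x - (y - x) * p x ≤ (p y - p x) * (y - x) := by linarith
    _ ≤ |(p y - p x) * (y - x)| := le_abs_self _
    _ = |p y - p x| * |y - x| := abs_mul _ _
    _ ≤ ε * |y - x| := by gcongr

theorem countable_not_continuousAt (h : ProfileSubgradient ν p c) :
    {x | ¬ ContinuousAt p x}.Countable := h.mono.countable_not_continuousAt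

/-- Along any slope, the subgradient bounds the remainder by the symmetric second difference. -/
theorem le_add_secondDiff (h : ProfileSubgradient ν p c) {x τ δ : ℝ} (hτ : |τ| ≤ δ) :
    ν (x + τ) ≤ ν x + p x * τ + (ν (x + δ) + ν (x - δ) - 2 * ν x) := by
  -- The chord inequality. The remainder `ν (x + τ) - ν x - p x * τ` is convex, nonnegative and zero
  -- at `τ = 0`, so for `|τ| ≤ δ` it is at most the sum of its values at `±δ`, which is the second
  -- difference.
  have hconv : ∀ y d, 0 ≤ d → d ≤ 1 → ν (x + d * y) ≤ ν x + d * (ν (x + y) - ν x) := by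
    intro y d h0 h1
    have a1 := h.sub (x + d * y) x
    have a2 := h.sub (x + d * y) (x + y)
    nlinarith
  have hδ : 0 ≤ δ := (abs_nonneg _).trans hτ
  have b1 := h.sub x (x + δ)
  have b2 := h.sub x (x - δ)
  rcases hδ.eq_or_lt with e | hpos
  · have : τ = 0 := by rw [← e] at hτ; exact abs_nonpos_iff.1 hτ
    simp [this, ← e]; linarith
  obtain ⟨h1, h2⟩ := abs_le.1 hτ
  rcases le_total 0 τ with ht | ht
  · have := hconv δ (τ / δ) (by positivity) ((div_le_one hpos).2 h2)
    rw [div_mul_cancel₀ _ hpos.ne'] at this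
    have hd : τ / δ ≤ 1 := (div_le_one hpos).2 h2
    have hd0 : 0 ≤ τ / δ := by positivity
    have e : p x * τ = τ / δ * (p x * δ) := by field_simp
    nlinarith
  · have := hconv (-δ) (-τ / δ) (div_nonneg (by linarith) hδ) ((div_le_one hpos).2 (by linarith))
    have e0 : -τ / δ * -δ = τ := by field_simp
    rw [e0] at this
    have hd : -τ / δ ≤ 1 := (div_le_one hpos).2 (by linarith)
    have hd0 : 0 ≤ -τ / δ := div_nonneg (by linarith) hδ
    have e : p x * τ = -τ / δ * (p x * (-δ)) := by field_simp
    rw [← sub_eq_add_neg] at this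
    nlinarith

theorem secondDiff_nonneg (h : ProfileSubgradient ν p c) (x δ : ℝ) :
    0 ≤ ν (x + δ) + ν (x - δ) - 2 * ν x := by
  have b1 := h.sub x (x + δ)
  have b2 := h.sub x (x - δ)
  linarith

theorem secondDiff_le (h : ProfileSubgradient ν p c) (x : ℝ) {δ : ℝ} (hδ : 0 ≤ δ) :
    ν (x + δ) + ν (x - δ) - 2 * ν x ≤ 2 * c * δ := by
  have h1 := (abs_le.1 (h.abs_sub_le (x + δ) x)).2
  have h2 := (abs_le.1 (h.abs_sub_le (x - δ) x)).2
  simp only [add_sub_cancel_left, sub_sub_cancel_left, abs_neg, abs_of_nonneg hδ] at h1 h2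
  linarith

end ProfileSubgradient

/-! ### Integration by parts and differentiation of the edge-stopping function -/

/-- The cosine is injective on `[0, π]` and even. This makes the kinks of `ν` negligible along `θ ↦
r cos θ`. -/
theorem countable_setOf_mul_cos {S : Set ℝ} (hS : S.Countable) {r : ℝ} (hr : r ≠ 0) :
    {θ | θ ∈ Icc (-(Real.pi / 2)) (Real.pi / 2) ∧ r * Real.cos θ ∈ S}.Countable := by
  have key : {θ | θ ∈ Icc 0 Real.pi ∧ r * Real.cos θ ∈ S}.Countable := by
    refine MapsTo.countable_of_injOn (f := fun θ => r * Real.cos θ) (fun θ h => h.2) ?_ hS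
    intro a ha b hb hab
    exact Real.injOn_cos ha.1 hb.1 (mul_left_cancel₀ hr hab)
  refine (key.union (key.image fun θ => -θ)).mono ?_
  rintro θ ⟨⟨h1, h2⟩, h3⟩
  rcases le_total 0 θ with h | h
  · exact Or.inl ⟨⟨h, by linarith [Real.pi_pos]⟩, h3⟩
  · exact Or.inr ⟨-θ, ⟨⟨by linarith, by linarith [Real.pi_pos]⟩, by rwa [Real.cos_neg]⟩, by simp⟩

namespace ProfileSubgradient

variable {ν p : ℝ → ℝ} {c : ℝ}

theorem ae_continuousAt_mul_cos (h : ProfileSubgradient ν p c) {r : ℝ} (hr : r ≠ 0) :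
    ∀ᵐ θ, θ ∈ Icc (-(Real.pi / 2)) (Real.pi / 2) → ContinuousAt p (r * Real.cos θ) := by
  have := (countable_setOf_mul_cos h.countable_not_continuousAt hr).ae_notMem volume
  filter_upwards [this] with θ hθ hm
  by_contra hc
  exact hθ ⟨hm, hc⟩

theorem abs_deriv_le (h : ProfileSubgradient ν p c) (x : ℝ) : |deriv ν x| ≤ c := by
  have := norm_deriv_le_of_lipschitz h.lipschitz (x₀ := x)
  rwa [Real.coe_toNNReal _ h.c_nonneg] at this

theorem continuous_mul_cos (h : ProfileSubgradient ν p c) (r : ℝ) :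
    Continuous fun θ => ν (r * Real.cos θ) :=
  h.continuous.comp (continuous_const.mul Real.continuous_cos)

/-- Products of a slope bounded by `c`, a power of `1 / ν` and a bounded factor are integrable. -/
theorem intervalIntegrable_slope (h : ProfileSubgradient ν p c) {q w : ℝ → ℝ} (hq : Measurable q)
    (hqc : ∀ x, |q x| ≤ c) (hw : Continuous w) (r a b : ℝ) (n : ℕ) :
    IntervalIntegrable (fun θ => q (r * Real.cos θ) / ν (r * Real.cos θ) ^ n * w θ) volume a b := by
  have h1 : IntervalIntegrable (fun θ => c * |w θ|) volume a b :=
    (continuous_const.mul hw.abs).intervalIntegrable _ _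
  refine h1.mono_fun ?_ (Eventually.of_forall fun θ => ?_)
  · refine Measurable.aestronglyMeasurable ?_
    exact ((hq.comp (by fun_prop)).div ((h.continuous_mul_cos r).measurable.pow_const n)).mul
      hw.measurable
  · simp only [norm_mul, norm_div, norm_pow, Real.norm_eq_abs, abs_abs]
    rw [abs_of_nonneg h.c_nonneg]
    gcongr
    have : 1 ≤ |ν (r * Real.cos θ)| ^ n := by
      rw [abs_of_pos (h.pos _)]
      exact one_le_pow₀ (h.one_le _)
    exact (div_le_self (abs_nonneg _) this).trans (hqc _)

theorem continuous_cos_div (h : ProfileSubgradient ν p c) (r : ℝ) :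
    Continuous fun θ => Real.cos θ / ν (r * Real.cos θ) ^ 3 :=
  Real.continuous_cos.div ((h.continuous_mul_cos r).pow 3) fun _ => (pow_pos (h.pos _) 3).ne'

/-- Integrate the derivative of `sin θ / ν(r cos θ)³`, which exists off a countable set. At `±π/2`
the argument of `ν` is `0`, so `ν 0 = 1` makes the boundary terms add up to `2`. -/
theorem mul_amoebaJ1 (h : ProfileSubgradient ν p c) {r : ℝ} (hr : r ≠ 0) :
    3 * r * amoebaJ1 ν r = 2 - ∫ θ in (-(Real.pi / 2))..(Real.pi / 2),
      Real.cos θ / ν (r * Real.cos θ) ^ 3 := by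
  have hle : -(Real.pi / 2) ≤ Real.pi / 2 := by linarith [Real.pi_pos]
  have hi1 := h.intervalIntegrable_slope (measurable_deriv ν) h.abs_deriv_le
    (w := fun θ => Real.sin θ ^ 2) (by fun_prop) r (-(Real.pi / 2)) (Real.pi / 2) 4
  have hi2 := (h.continuous_cos_div r).intervalIntegrable (μ := volume) (-(Real.pi / 2)) (Real.pi / 2)
  have key := integral_eq_of_hasDerivAt_off_countable_of_le
    (fun θ => Real.sin θ / ν (r * Real.cos θ) ^ 3)
    (fun θ => Real.cos θ / ν (r * Real.cos θ) ^ 3 +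
      3 * r * (deriv ν (r * Real.cos θ) / ν (r * Real.cos θ) ^ 4 * Real.sin θ ^ 2)) hle
    (countable_setOf_mul_cos h.countable_not_continuousAt hr)
    (Real.continuous_sin.div ((h.continuous_mul_cos r).pow 3)
      fun _ => (pow_pos (h.pos _) 3).ne').continuousOn ?_ (hi2.add (hi1.const_mul _))
  · rw [intervalIntegral.integral_add hi2 (hi1.const_mul _),
      intervalIntegral.integral_const_mul] at key
    simp only [Real.cos_neg, Real.cos_pi_div_two, mul_zero, h.zero, Real.sin_neg,
      Real.sin_pi_div_two] at key
    rw [amoebaJ1]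
    linarith
  · rintro θ ⟨⟨h1, h2⟩, h3⟩
    have hc : ContinuousAt p (r * Real.cos θ) := by
      by_contra hcon
      exact h3 ⟨⟨h1.le, h2.le⟩, hcon⟩
    have hd := h.hasDerivAt hc
    have hν := (h.pos (r * Real.cos θ)).ne'
    have hd2 := hd.comp θ ((Real.hasDerivAt_cos θ).const_mul r)
    have hd3 := (Real.hasDerivAt_sin θ).div (hd2.pow 3) (pow_ne_zero 3 hν)
    refine hd3.congr_deriv ?_
    rw [hd.deriv]
    simp only [Pi.pow_apply, Function.comp_apply]
    generalize ν (r * Real.cos θ) = y at hν ⊢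
    field_simp
    push_cast
    ring

theorem edgeStop_eq (h : ProfileSubgradient ν p c) {β s : ℝ} (hβ : 0 < β) (hs : 0 < s) :
    edgeStop ν β s = 1 / 2 * ∫ θ in (-(Real.pi / 2))..(Real.pi / 2),
      Real.cos θ / ν (β * s * Real.cos θ) ^ 3 := by
  have := h.mul_amoebaJ1 (mul_pos hβ hs).ne'
  rw [edgeStop]
  linarith

/-- Dominated differentiation with the uniform Lipschitz constant `3 c` of the integrand in `r`,
valid since `ν ≥ 1`. For `r ≠ 0` almost every `θ` avoids the kinks. -/
theorem hasDerivAt_cos_integral (h : ProfileSubgradient ν p c) {r : ℝ} (hr : r ≠ 0) :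
    HasDerivAt (fun r => ∫ θ in (-(Real.pi / 2))..(Real.pi / 2),
      Real.cos θ / ν (r * Real.cos θ) ^ 3) (-3 * amoebaJ3 ν r) r := by
  have key := (intervalIntegral.hasDerivAt_integral_of_dominated_loc_of_lip (μ := volume)
    (F := fun r θ => Real.cos θ / ν (r * Real.cos θ) ^ 3)
    (F' := fun θ => -3 * (deriv ν (r * Real.cos θ) / ν (r * Real.cos θ) ^ 4 * Real.cos θ ^ 2))
    (a := -(Real.pi / 2)) (b := Real.pi / 2)
    (s := univ) (x₀ := r) (bound := fun _ => 3 * c) univ_mem ?_ ?_ ?_ ?_ ?_ ?_).2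
  · rw [intervalIntegral.integral_const_mul] at key
    exact key
  · exact Eventually.of_forall fun r => (h.continuous_cos_div r).aestronglyMeasurable
  · exact (h.continuous_cos_div r).intervalIntegrable _ _
  · exact (intervalIntegrable_iff.1 ((h.intervalIntegrable_slope (measurable_deriv ν) h.abs_deriv_le
      (w := fun θ => Real.cos θ ^ 2) (by fun_prop) r (-(Real.pi / 2)) (Real.pi / 2)
      4).const_mul _)).aestronglyMeasurable
  · refine Eventually.of_forall fun θ _ => LipschitzOnWith.of_dist_le_mul fun x _ y _ => ?_
    rw [Real.dist_eq, Real.dist_eq, Real.coe_nnabs, abs_of_nonneg (mul_nonneg (by norm_num) h.c_nonneg)]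
    have hcos := Real.abs_cos_le_one θ
    set X := ν (x * Real.cos θ)
    set Y := ν (y * Real.cos θ)
    have hX : 1 ≤ X := h.one_le _
    have hY : 1 ≤ Y := h.one_le _
    have hXY : |Y - X| ≤ c * |x - y| := by
      have := h.abs_sub_le (y * Real.cos θ) (x * Real.cos θ)
      rw [← sub_mul, abs_mul, abs_sub_comm y x] at this
      refine this.trans ?_
      have := h.c_nonneg
      gcongr
      exact mul_le_of_le_one_right (abs_nonneg _) hcos
    have e : Real.cos θ / X ^ 3 - Real.cos θ / Y ^ 3
        = Real.cos θ * ((1 / (X * Y ^ 3) + 1 / (X ^ 2 * Y ^ 2) + 1 / (X ^ 3 * Y)) * (Y - X)) := by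
      have := (one_pos.trans_le hX).ne'
      have := (one_pos.trans_le hY).ne'
      field_simp
      ring
    rw [e, abs_mul, abs_mul]
    have hb : |1 / (X * Y ^ 3) + 1 / (X ^ 2 * Y ^ 2) + 1 / (X ^ 3 * Y)| ≤ 3 := by
      have h1 : 1 ≤ X * Y ^ 3 := one_le_mul_of_one_le_of_one_le hX (one_le_pow₀ hY)
      have h2 : 1 ≤ X ^ 2 * Y ^ 2 := one_le_mul_of_one_le_of_one_le (one_le_pow₀ hX) (one_le_pow₀ hY)
      have h3 : 1 ≤ X ^ 3 * Y := one_le_mul_of_one_le_of_one_le (one_le_pow₀ hX) hY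
      have g1 : 1 / (X * Y ^ 3) ≤ 1 := (div_le_one (by linarith)).2 h1
      have g2 : 1 / (X ^ 2 * Y ^ 2) ≤ 1 := (div_le_one (by linarith)).2 h2
      have g3 : 1 / (X ^ 3 * Y) ≤ 1 := (div_le_one (by linarith)).2 h3
      rw [abs_of_nonneg (by positivity)]
      linarith
    calc _ ≤ 1 * (3 * (c * |x - y|)) := by gcongr
      _ = _ := by ring
  · exact intervalIntegrable_const
  · filter_upwards [h.ae_continuousAt_mul_cos hr] with θ hθ hm
    rw [uIoc_of_le (by linarith [Real.pi_pos])] at hm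
    have hd := h.hasDerivAt (hθ ⟨hm.1.le, hm.2⟩)
    have hν := (h.pos (r * Real.cos θ)).ne'
    have hd2 := HasDerivAt.comp r hd ((hasDerivAt_id r).mul_const (Real.cos θ))
    have hd3 := (hasDerivAt_const r (Real.cos θ)).div (hd2.pow 3) (pow_ne_zero 3 hν)
    refine hd3.congr_deriv ?_
    rw [hd.deriv]
    simp only [Pi.pow_apply, Function.comp_apply, id]
    generalize ν (r * Real.cos θ) = y at hν ⊢
    field_simp
    push_cast
    ring

theorem hasDerivAt_edgeStop (h : ProfileSubgradient ν p c) {β s : ℝ} (hβ : 0 < β) (hs : 0 < s) :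
    HasDerivAt (edgeStop ν β) (-(3 / 2) * β * amoebaJ3 ν (β * s)) s := by
  have h1 := HasDerivAt.comp s (h.hasDerivAt_cos_integral (mul_pos hβ hs).ne')
    ((hasDerivAt_id s).const_mul β)
  have h2 : HasDerivAt (fun s => 1 / 2 * ∫ θ in (-(Real.pi / 2))..(Real.pi / 2),
      Real.cos θ / ν (β * s * Real.cos θ) ^ 3) (1 / 2 * (-3 * amoebaJ3 ν (β * s) * (β * 1))) s :=
    h1.const_mul (1 / 2)
  have h3 := h2.congr_of_eventuallyEq (f₁ := edgeStop ν β) ?_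
  · exact h3.congr_deriv (by ring)
  · filter_upwards [lt_mem_nhds hs] with x hx
    exact h.edgeStop_eq hβ hx

end ProfileSubgradient

/-! ### The second integral representation -/

theorem intervalIntegral_symm_of_even {f : ℝ → ℝ} {a : ℝ} (hf : ∀ x, f (-x) = f x)
    (hi : ∀ a b, IntervalIntegrable f volume a b) :
    ∫ x in (-a)..a, f x = 2 * ∫ x in (0 : ℝ)..a, f x := by
  rw [← intervalIntegral.integral_add_adjacent_intervals (hi (-a) 0) (hi 0 a)]
  have := intervalIntegral.integral_comp_neg (a := 0) (b := a) f
  simp only [hf, neg_zero] at this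
  rw [← this]
  ring

theorem lintegral_Ioo_sq {t : ℝ} (ht : 0 ≤ t) :
    ∫⁻ ξ in Ioo 0 t, ENNReal.ofReal (ξ ^ 2) = ENNReal.ofReal (t ^ 3 / 3) := by
  have h1 : ∫ ξ in Ioo 0 t, ξ ^ 2 = t ^ 3 / 3 := by
    rw [← integral_Ioc_eq_integral_Ioo, ← intervalIntegral.integral_of_le ht, integral_pow]
    norm_num
  rw [← h1, ofReal_integral_eq_lintegral_ofReal]
  · exact ((continuous_id.pow 2).integrableOn_Icc).mono_set Ioo_subset_Icc_self
  · exact Eventually.of_forall fun x => sq_nonneg x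

theorem image_mul_tan {q : ℝ} (hq : 0 < q) :
    (fun θ => q * Real.tan θ) '' Ioo 0 (Real.pi / 2) = Ioi 0 := by
  ext y
  constructor
  · rintro ⟨θ, hθ, rfl⟩
    exact mul_pos hq (Real.tan_pos_of_pos_of_lt_pi_div_two hθ.1 hθ.2)
  · intro hy
    refine ⟨Real.arctan (y / q), ⟨?_, Real.arctan_lt_pi_div_two _⟩, ?_⟩
    · rw [← Real.arctan_zero]
      exact Real.arctan_strictMono (div_pos hy hq)
    · simp only [Real.tan_arctan]
      field_simp

theorem abs_mul_tan_injOn {q : ℝ} (hq : 0 < q) :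
    InjOn (fun θ => q * Real.tan θ) (Ioo 0 (Real.pi / 2)) := by
  intro a ha b hb hab
  refine Real.injOn_tan ⟨by linarith [ha.1, Real.pi_pos], ha.2⟩
    ⟨by linarith [hb.1, Real.pi_pos], hb.2⟩ (mul_left_cancel₀ hq.ne' hab)

namespace ProfileSubgradient

variable {ν p : ℝ → ℝ} {c : ℝ}

/-- `ψ` is the perspective of `ν`, hence convex: the subgradient inequality for `ν`, multiplied by
`b`, is one for `ψ`. Its slope at `a` is nonnegative by `mul_le`, which makes `ψ` increasing. -/
theorem amoebaPsi_sub (h : ProfileSubgradient ν p c) {a b : ℝ} (ha : 0 < a) (hb : 0 < b) :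
    amoebaPsi ν a + (b - a) * (ν (1 / a) - p (1 / a) * (1 / a)) ≤ amoebaPsi ν b := by
  have h1 := h.sub (1 / a) (1 / b)
  rw [amoebaPsi, amoebaPsi]
  have h2 := mul_le_mul_of_nonneg_left h1 hb.le
  have e : b * (ν (1 / a) + p (1 / a) * (1 / b - 1 / a))
      = a * ν (1 / a) + (b - a) * (ν (1 / a) - p (1 / a) * (1 / a)) := by
    generalize ν (1 / a) = y
    generalize p (1 / a) = z
    field_simp
    ring
  linarith

theorem amoebaPsi_mono (h : ProfileSubgradient ν p c) {a b : ℝ} (ha : 0 < a) (hab : a ≤ b) :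
    amoebaPsi ν a ≤ amoebaPsi ν b := by
  have h1 := h.amoebaPsi_sub ha (ha.trans_le hab)
  have h2 := h.mul_le (1 / a)
  nlinarith

/-- A convex increasing function can be constant only on an initial interval. This replaces
injectivity of `ψ`. -/
theorem amoebaPsi_lt (h : ProfileSubgradient ν p c) {a b d : ℝ} (ha : 0 < a) (hab : a ≤ b)
    (hbd : b < d) (hlt : amoebaPsi ν a < amoebaPsi ν d) : amoebaPsi ν b < amoebaPsi ν d := by
  have h1 := h.amoebaPsi_sub (ha.trans_le hab) ha
  have h2 := h.amoebaPsi_sub (ha.trans_le hab) ((ha.trans_le hab).trans hbd)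
  by_contra hcon
  push Not at hcon
  nlinarith

theorem le_amoebaPsi (h : ProfileSubgradient ν p c) {a : ℝ} (ha : 0 < a) : a ≤ amoebaPsi ν a := by
  rw [amoebaPsi]
  nlinarith [h.one_le (1 / a)]

theorem continuousOn_amoebaPsi (h : ProfileSubgradient ν p c) :
    ContinuousOn (amoebaPsi ν) (Ioi 0) := by
  have h1 : ContinuousOn (fun q : ℝ => 1 / q) (Ioi 0) :=
    continuousOn_const.div continuousOn_id fun x hx => ne_of_gt hx
  exact continuousOn_id.mul (h.continuous.comp_continuousOn h1)

theorem amoebaPsiInv_spec (h : ProfileSubgradient ν p c) {a y : ℝ} (ha : 0 < a)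
    (hy : amoebaPsi ν a ≤ y) : 0 < amoebaPsiInv ν y ∧ amoebaPsi ν (amoebaPsiInv ν y) = y := by
  have hay : a ≤ y := (h.le_amoebaPsi ha).trans hy
  have hmem : y ∈ amoebaPsi ν '' Ioi 0 := by
    have h1 := intermediate_value_Icc hay
      (h.continuousOn_amoebaPsi.mono fun x hx => ha.trans_le hx.1)
    obtain ⟨x, hx, hxy⟩ := h1 ⟨hy, h.le_amoebaPsi (ha.trans_le hay)⟩
    exact ⟨x, ha.trans_le hx.1, hxy⟩
  exact ⟨Function.invFunOn_mem hmem, Function.invFunOn_eq hmem⟩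

/-- For `ξ < 1` the level `ψ(a)/ξ` exceeds `ψ(a)`, so it lies where `ψ` increases strictly and the
choice made by `amoebaPsiInv` is immaterial. -/
theorem lt_sqrt_amoebaPsiInv_iff (h : ProfileSubgradient ν p c) {a ξ σ : ℝ} (ha : 0 < a)
    (hξ : ξ ∈ Ioo (0 : ℝ) 1) (hσ : 0 ≤ σ) :
    σ < Real.sqrt (amoebaPsiInv ν (1 / ξ * amoebaPsi ν a) ^ 2 - a ^ 2) ↔
      ξ * amoebaPsi ν (Real.sqrt (σ ^ 2 + a ^ 2)) < amoebaPsi ν a := by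
  have hψ : 0 < amoebaPsi ν a := ha.trans_le (h.le_amoebaPsi ha)
  have hlt : amoebaPsi ν a < 1 / ξ * amoebaPsi ν a := by
    have : 1 < 1 / ξ := by rw [lt_div_iff₀ hξ.1]; linarith [hξ.2]
    nlinarith
  obtain ⟨h1, h2⟩ := h.amoebaPsiInv_spec ha hlt.le
  set q := amoebaPsiInv ν (1 / ξ * amoebaPsi ν a)
  have hb : a ≤ Real.sqrt (σ ^ 2 + a ^ 2) := Real.le_sqrt_of_sq_le (by nlinarith)
  have e1 : σ < Real.sqrt (q ^ 2 - a ^ 2) ↔ Real.sqrt (σ ^ 2 + a ^ 2) < q := by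
    rw [Real.lt_sqrt hσ, Real.sqrt_lt' h1, lt_sub_iff_add_lt]
  have e2 : ξ * amoebaPsi ν (Real.sqrt (σ ^ 2 + a ^ 2)) < amoebaPsi ν a ↔
      amoebaPsi ν (Real.sqrt (σ ^ 2 + a ^ 2)) < amoebaPsi ν q := by
    rw [h2, one_div, inv_mul_eq_div, lt_div_iff₀ hξ.1, mul_comm]
  rw [e1, e2]
  constructor
  · intro hlt'
    exact h.amoebaPsi_lt ha hb hlt' (by rw [h2]; exact hlt)
  · intro hlt'
    by_contra hcon
    push Not at hcon
    exact absurd (h.amoebaPsi_mono h1 hcon) (not_le.2 hlt')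

/-- Layer cake: the square root is the length of the `σ`-slice of the region `ξ ψ(√(σ² + a²)) <
ψ(a)`, `a = 1/r`. Exchanging the integrations makes the `ξ`-integral elementary, and no inverse
function is left. -/
theorem amoebaI1_eq (h : ProfileSubgradient ν p c) {r : ℝ} (hr : 0 < r) :
    amoebaI1 ν r = amoebaPsi ν (1 / r) ^ 3 * r ^ 2 / 3 *
      ∫ θ in (0 : ℝ)..(Real.pi / 2), Real.cos θ / ν (r * Real.cos θ) ^ 3 := by
  have hq0 : 0 < 1 / r := by positivity
  set a := 1 / r with ha
  set A := amoebaPsi ν a with hA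
  have hApos : 0 < A := hq0.trans_le (h.le_amoebaPsi hq0)
  set S : ℝ → ℝ := fun ξ => Real.sqrt (amoebaPsiInv ν (1 / ξ * A) ^ 2 - a ^ 2) with hS
  set Ψ : ℝ → ℝ := fun σ => amoebaPsi ν (Real.sqrt (σ ^ 2 + a ^ 2)) with hΨ
  have hsq : ∀ σ : ℝ, 0 < Real.sqrt (σ ^ 2 + a ^ 2) := fun σ => Real.sqrt_pos.2 (by positivity)
  have hΨc : Continuous Ψ :=
    h.continuousOn_amoebaPsi.comp_continuous (by fun_prop) fun σ => hsq σ
  have hΨA : ∀ σ, A ≤ Ψ σ := fun σ =>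
    h.amoebaPsi_mono hq0 (Real.le_sqrt_of_sq_le (by nlinarith [sq_nonneg σ]))
  have hiff : ∀ ξ ∈ Ioo (0 : ℝ) 1, ∀ σ, 0 ≤ σ → (σ < S ξ ↔ ξ * Ψ σ < A) := fun ξ hξ σ hσ =>
    h.lt_sqrt_amoebaPsiInv_iff hq0 hξ hσ
  -- Monotonicity supplies measurability of `S`, which is not evident from the choice of a preimage.
  have hanti : AntitoneOn S (Ioo 0 1) := by
    intro x hx y hy hxy
    refine le_of_forall_lt fun σ hσ => ?_
    rcases lt_or_ge σ 0 with hneg | hpos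
    · exact hneg.trans_le (Real.sqrt_nonneg _)
    · rw [hiff y hy σ hpos] at hσ
      rw [hiff x hx σ hpos]
      exact (mul_le_mul_of_nonneg_right hxy (hApos.le.trans (hΨA σ))).trans_lt hσ
  have hmeas : AEMeasurable (fun ξ => ξ ^ 2 * S ξ) (volume.restrict (Ioo 0 1)) :=
    (measurable_id.pow_const 2).aemeasurable.mul
      (aemeasurable_restrict_of_antitoneOn measurableSet_Ioo hanti)
  have hI : amoebaI1 ν r = (∫⁻ ξ in Ioo 0 1, ENNReal.ofReal (ξ ^ 2 * S ξ)).toReal := by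
    rw [amoebaI1, intervalIntegral.integral_of_le zero_le_one, integral_Ioc_eq_integral_Ioo,
      ← integral_eq_lintegral_of_nonneg_ae (Eventually.of_forall fun ξ => by positivity)
        hmeas.aestronglyMeasurable]
    simp only [hS, ha, one_div_pow, hA]
  set T : Set (ℝ × ℝ) := {z | z.1 * Ψ z.2 < A} with hT
  have hTm : MeasurableSet T :=
    (isOpen_lt (continuous_fst.mul (hΨc.comp continuous_snd)) continuous_const).measurableSet
  have hstep1 : ∫⁻ ξ in Ioo 0 1, ENNReal.ofReal (ξ ^ 2 * S ξ) =
      ∫⁻ ξ in Ioo (0 : ℝ) 1, ∫⁻ σ in Ioi (0 : ℝ),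
        T.indicator (fun z => ENNReal.ofReal (z.1 ^ 2)) (ξ, σ) := by
    refine setLIntegral_congr_fun measurableSet_Ioo fun ξ hξ => ?_
    have e : ∀ σ ∈ Ioi (0 : ℝ), T.indicator (fun z => ENNReal.ofReal (z.1 ^ 2)) (ξ, σ)
        = (Iio (S ξ)).indicator (fun _ => ENNReal.ofReal (ξ ^ 2)) σ := by
      intro σ hσ
      have := hiff ξ hξ σ (le_of_lt hσ)
      by_cases hc : σ < S ξ
      · rw [indicator_of_mem (by exact this.1 hc), indicator_of_mem (by exact hc)]
      · rw [indicator_of_notMem (by exact fun h' => hc (this.2 h')), indicator_of_notMem (by exact hc)]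
    rw [setLIntegral_congr_fun measurableSet_Ioi e, lintegral_indicator_const measurableSet_Iio,
      Measure.restrict_apply measurableSet_Iio, inter_comm, Ioi_inter_Iio, Real.volume_Ioo,
      ENNReal.ofReal_mul (sq_nonneg ξ), sub_zero]
  have hstep2 : ∀ σ ∈ Ioi (0 : ℝ), ∫⁻ ξ in Ioo (0 : ℝ) 1,
      T.indicator (fun z => ENNReal.ofReal (z.1 ^ 2)) (ξ, σ) =
        ENNReal.ofReal ((A / Ψ σ) ^ 3 / 3) := by
    intro σ _
    have hΨpos : 0 < Ψ σ := hApos.trans_le (hΨA σ)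
    have e : ∀ ξ, T.indicator (fun z => ENNReal.ofReal (z.1 ^ 2)) (ξ, σ)
        = (Iio (A / Ψ σ)).indicator (fun ξ => ENNReal.ofReal (ξ ^ 2)) ξ := by
      intro ξ
      have : ξ < A / Ψ σ ↔ ξ * Ψ σ < A := lt_div_iff₀ hΨpos
      by_cases hc : ξ < A / Ψ σ
      · rw [indicator_of_mem (by exact this.1 hc), indicator_of_mem (by exact hc)]
      · rw [indicator_of_notMem (by exact fun h' => hc (this.2 h')), indicator_of_notMem (by exact hc)]
    simp_rw [e]
    rw [lintegral_indicator measurableSet_Iio, Measure.restrict_restrict measurableSet_Iio,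
      inter_comm, Ioo_inter_Iio, min_eq_right ((div_le_one hΨpos).2 (hΨA σ)),
      lintegral_Ioo_sq (by positivity)]
  have hswap := lintegral_lintegral_swap (μ := volume.restrict (Ioo (0 : ℝ) 1))
    (ν := volume.restrict (Ioi (0 : ℝ)))
    (f := fun ξ σ => T.indicator (fun z => ENNReal.ofReal (z.1 ^ 2)) (ξ, σ))
    ((measurable_fst.pow_const 2).ennreal_ofReal.indicator hTm).aemeasurable
  have hderiv : ∀ θ ∈ Ioo 0 (Real.pi / 2), HasDerivWithinAt (fun θ => a * Real.tan θ)
      (a * (1 / Real.cos θ ^ 2)) (Ioo 0 (Real.pi / 2)) θ := by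
    intro θ hθ
    have hc : Real.cos θ ≠ 0 :=
      (Real.cos_pos_of_mem_Ioo ⟨by linarith [hθ.1, Real.pi_pos], hθ.2⟩).ne'
    exact ((Real.hasDerivAt_tan hc).const_mul a).hasDerivWithinAt
  have hstep3 : ∫⁻ σ in Ioi (0 : ℝ), ENNReal.ofReal ((A / Ψ σ) ^ 3 / 3) =
      ∫⁻ θ in Ioo 0 (Real.pi / 2),
        ENNReal.ofReal (A ^ 3 * r ^ 2 / 3 * (Real.cos θ / ν (r * Real.cos θ) ^ 3)) := by
    -- Substitution `σ = a tan θ`, for which `√(σ² + a²) = a / cos θ` and `ψ(a / cos θ) = (a / cos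
    -- θ) ν(r cos θ)`.
    rw [← image_mul_tan hq0, lintegral_image_eq_lintegral_abs_deriv_mul measurableSet_Ioo hderiv
      (abs_mul_tan_injOn hq0)]
    refine setLIntegral_congr_fun measurableSet_Ioo fun θ hθ => ?_
    have hc : 0 < Real.cos θ :=
      (Real.cos_pos_of_mem_Ioo ⟨by linarith [hθ.1, Real.pi_pos], hθ.2⟩)
    have e1 : Real.sqrt ((a * Real.tan θ) ^ 2 + a ^ 2) = a / Real.cos θ := by
      rw [Real.sqrt_eq_iff_mul_self_eq (by positivity) (by positivity), Real.tan_eq_sin_div_cos]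
      field_simp
      nlinarith [Real.sin_sq_add_cos_sq θ]
    simp only [hΨ]
    rw [e1, amoebaPsi, ← ENNReal.ofReal_mul (abs_nonneg _), abs_of_pos (by positivity)]
    congr 1
    have e2 : 1 / (a / Real.cos θ) = r * Real.cos θ := by
      rw [ha]; field_simp
    rw [e2, ha]
    have := h.pos (r * Real.cos θ)
    generalize ν (r * Real.cos θ) = y at this ⊢
    field_simp
  have hcont := h.continuous_cos_div r
  rw [hI, hstep1, hswap, setLIntegral_congr_fun measurableSet_Ioi hstep2, hstep3,
    intervalIntegral.integral_of_le (by positivity), integral_Ioc_eq_integral_Ioo,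
    ← integral_const_mul, integral_eq_lintegral_of_nonneg_ae]
  · refine (ae_restrict_iff' measurableSet_Ioo).2 (Eventually.of_forall fun θ hθ => ?_)
    have hc : 0 < Real.cos θ :=
      (Real.cos_pos_of_mem_Ioo ⟨by linarith [hθ.1, Real.pi_pos], hθ.2⟩)
    have := h.pos (r * Real.cos θ)
    simp only [Pi.zero_apply]
    positivity
  · exact (continuous_const.mul hcont).aestronglyMeasurable

theorem edgeStop_eq_amoebaI1 (h : ProfileSubgradient ν p c) {β s : ℝ} (hβ : 0 < β) (hs : 0 < s) :
    edgeStop ν β s =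
      3 * amoebaI1 ν (β * s) / (β ^ 2 * s ^ 2 * amoebaPsi ν (1 / (β * s)) ^ 3) := by
  have hr : 0 < β * s := mul_pos hβ hs
  have hq : 0 < 1 / (β * s) := by positivity
  have hψ : amoebaPsi ν (1 / (β * s)) ≠ 0 := (hq.trans_le (h.le_amoebaPsi hq)).ne'
  rw [h.edgeStop_eq hβ hs, h.amoebaI1_eq hr, intervalIntegral_symm_of_even
    (fun x => by rw [Real.cos_neg]) fun a b => (h.continuous_cos_div _).intervalIntegrable a b]
  generalize amoebaPsi ν (1 / (β * s)) = y at hψ ⊢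
  generalize ∫ θ in (0 : ℝ)..(Real.pi / 2), Real.cos θ / ν (β * s * Real.cos θ) ^ 3 = K
  field_simp

end ProfileSubgradient

/-! ### Integrated second differences -/

/-- The symmetric second difference of `ν` at `s cos θ`, integrated over a half circle. -/
noncomputable def secondDiffIntegral (ν : ℝ → ℝ) (s δ : ℝ) : ℝ :=
  ∫ θ in (-(Real.pi / 2))..(Real.pi / 2),
    (ν (s * Real.cos θ + δ) + ν (s * Real.cos θ - δ) - 2 * ν (s * Real.cos θ))

namespace ProfileSubgradient

variable {ν p : ℝ → ℝ} {c : ℝ}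

theorem secondDiff_le_slope (h : ProfileSubgradient ν p c) (x δ : ℝ) :
    ν (x + δ) + ν (x - δ) - 2 * ν x ≤ δ * (p (x + δ) - p (x - δ)) := by
  have h1 := h.sub (x + δ) x
  have h2 := h.sub (x - δ) x
  linarith

theorem continuous_secondDiff (h : ProfileSubgradient ν p c) (s δ : ℝ) :
    Continuous fun θ =>
      ν (s * Real.cos θ + δ) + ν (s * Real.cos θ - δ) - 2 * ν (s * Real.cos θ) := by
  have hc := h.continuous
  exact ((hc.comp (by fun_prop)).add (hc.comp (by fun_prop))).sub
    (continuous_const.mul (h.continuous_mul_cos s))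

theorem secondDiffIntegral_nonneg (h : ProfileSubgradient ν p c) (s δ : ℝ) :
    0 ≤ secondDiffIntegral ν s δ :=
  intervalIntegral.integral_nonneg (by linarith [Real.pi_pos]) fun _ _ => h.secondDiff_nonneg _ _

/-- Dominated convergence: the quotient is at most `2 c`, and it lies between `0` and `p (x + δ) - p
(x - δ)`, which tends to `0` wherever `p` is continuous. -/
theorem secondDiffIntegral_div_tendsto (h : ProfileSubgradient ν p c) {s : ℝ} (hs : s ≠ 0) :
    Tendsto (fun δ => secondDiffIntegral ν s δ / δ) (𝓝[>] 0) (𝓝 0) := by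
  have key := intervalIntegral.tendsto_integral_filter_of_dominated_convergence
    (F := fun δ θ => (ν (s * Real.cos θ + δ) + ν (s * Real.cos θ - δ) - 2 * ν (s * Real.cos θ)) / δ)
    (f := fun _ => 0) (l := 𝓝[>] (0 : ℝ)) (μ := volume)
    (a := -(Real.pi / 2)) (b := Real.pi / 2) (fun _ => 2 * c) ?_ ?_ ?_ ?_
  · simp only [intervalIntegral.integral_div, intervalIntegral.integral_zero] at key
    exact key
  · exact Eventually.of_forall fun δ =>
      ((h.continuous_secondDiff s δ).div_const δ).aestronglyMeasurable
  · filter_upwards [self_mem_nhdsWithin] with δ (hδ : 0 < δ)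
    refine Eventually.of_forall fun θ _ => ?_
    rw [Real.norm_eq_abs, abs_of_nonneg (div_nonneg (h.secondDiff_nonneg _ _) hδ.le),
      div_le_iff₀ hδ]
    exact h.secondDiff_le _ hδ.le
  · exact intervalIntegrable_const
  · filter_upwards [h.ae_continuousAt_mul_cos hs] with θ hθ hm
    rw [uIoc_of_le (by linarith [Real.pi_pos])] at hm
    have hc := hθ ⟨hm.1.le, hm.2⟩
    set x := s * Real.cos θ
    have t1 : Tendsto (fun δ => p (x + δ)) (𝓝[>] 0) (𝓝 (p x)) := by
      refine Tendsto.comp (f := fun δ => x + δ) hc (tendsto_nhdsWithin_of_tendsto_nhds ?_)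
      have : Continuous fun δ : ℝ => x + δ := by fun_prop
      simpa only [add_zero] using this.tendsto 0
    have t2 : Tendsto (fun δ => p (x - δ)) (𝓝[>] 0) (𝓝 (p x)) := by
      refine Tendsto.comp (f := fun δ => x - δ) hc (tendsto_nhdsWithin_of_tendsto_nhds ?_)
      have : Continuous fun δ : ℝ => x - δ := by fun_prop
      simpa only [sub_zero] using this.tendsto 0
    have t3 := t1.sub t2
    rw [sub_self] at t3
    refine tendsto_of_tendsto_of_tendsto_of_le_of_le' tendsto_const_nhds t3 ?_ ?_
    · filter_upwards [self_mem_nhdsWithin] with δ (hδ : 0 < δ)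
      exact div_nonneg (h.secondDiff_nonneg _ _) hδ.le
    · filter_upwards [self_mem_nhdsWithin] with δ (hδ : 0 < δ)
      rw [div_le_iff₀ hδ, mul_comm _ δ]
      exact h.secondDiff_le_slope _ _

theorem eq_of_hasDerivAt (h : ProfileSubgradient ν p c) {x d : ℝ} (hd : HasDerivAt ν d x) :
    p x = d := by
  have h1 : IsLocalMin (fun y => ν y - p x * y) x :=
    Eventually.of_forall fun y => by
      have := h.sub x y
      simp only
      linarith
  have h2 := h1.hasDerivAt_eq_zero (hd.sub ((hasDerivAt_id x).const_mul (p x)))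
  linarith

/-- On `(0, ∞)` the subgradient is the derivative, which is `C¹` up to the end point `0`. A kink at
`0` is allowed, hence the restriction to `0 < x`. -/
theorem exists_slope_lipschitz (h : ProfileSubgradient ν p c) (hC : ContDiffOn ℝ 2 ν (Ici 0))
    (R : ℝ) : ∃ B, 0 ≤ B ∧ ∀ x y, 0 < x → x ≤ y → y ≤ R → p y - p x ≤ B * (y - x) := by
  have h1 : ContDiffOn ℝ 1 (derivWithin ν (Ici 0)) (Ici 0) :=
    hC.derivWithin (uniqueDiffOn_Ici 0) (by norm_num)
  obtain ⟨K, hK⟩ := (h1.mono (show Icc 0 R ⊆ Ici 0 from fun x hx => hx.1)).exists_lipschitzOnWith one_ne_zero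
    (convex_Icc 0 R) isCompact_Icc
  have hp : ∀ x, 0 < x → p x = derivWithin ν (Ici 0) x := by
    intro x hx
    have hd : DifferentiableAt ℝ ν x :=
      ((hC.differentiableOn (by norm_num)) x hx.le).differentiableAt (Ici_mem_nhds hx)
    rw [h.eq_of_hasDerivAt hd.hasDerivAt, derivWithin_of_mem_nhds (Ici_mem_nhds hx)]
  refine ⟨K, K.2, fun x y hx hxy hy => ?_⟩
  have := hK.dist_le_mul y ⟨hx.le.trans hxy, hy⟩ x ⟨hx.le, hxy.trans hy⟩
  rw [Real.dist_eq, Real.dist_eq, abs_of_nonneg (by linarith : 0 ≤ y - x)] at this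
  rw [hp x hx, hp y (hx.trans_le hxy)]
  exact (le_abs_self _).trans this

theorem exists_secondDiffIntegral_le (h : ProfileSubgradient ν p c)
    (hC : ContDiffOn ℝ 2 ν (Ici 0)) {s : ℝ} (hs : 0 < s) :
    ∃ C, ∀ δ, 0 < δ → δ ≤ s → secondDiffIntegral ν s δ ≤ C * δ ^ 2 := by
  obtain ⟨B, hB0, hB⟩ := h.exists_slope_lipschitz hC (2 * s)
  have hpi := Real.pi_pos
  refine ⟨2 * (Real.pi / 2 * (2 * B) + Real.pi * c / s), fun δ hδ hδs => ?_⟩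
  have hcont := h.continuous_secondDiff s δ
  rw [secondDiffIntegral, intervalIntegral_symm_of_even (fun x => by rw [Real.cos_neg])
    fun a b => hcont.intervalIntegrable a b]
  -- For `θ < b` the bound `cos θ ≥ 1 - 2θ/π` keeps `s cos θ - δ` positive, away from the possible
  -- kink at `0`, and the second difference is at most `2 B δ²`. The remaining interval has length
  -- `πδ/(2s)`, where the Lipschitz bound `2 c δ` suffices.
  set b := Real.pi / 2 * (1 - δ / s) with hb
  have hds : δ / s ≤ 1 := (div_le_one hs).2 hδs
  have hds0 : 0 < δ / s := by positivity
  have hb0 : 0 ≤ b := mul_nonneg (by positivity) (by linarith)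
  have hb1 : b ≤ Real.pi / 2 := by rw [hb]; nlinarith
  rw [← intervalIntegral.integral_add_adjacent_intervals (hcont.intervalIntegrable 0 b)
    (hcont.intervalIntegrable b (Real.pi / 2))]
  have i1 : ∫ θ in (0 : ℝ)..b, (ν (s * Real.cos θ + δ) + ν (s * Real.cos θ - δ)
      - 2 * ν (s * Real.cos θ)) ≤ ∫ θ in (0 : ℝ)..b, 2 * B * δ ^ 2 := by
    refine intervalIntegral.integral_mono_on_of_le_Ioo hb0 (hcont.intervalIntegrable _ _)
      intervalIntegrable_const fun θ hθ => ?_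
    have hcos := Real.one_sub_mul_le_cos hθ.1.le (hθ.2.le.trans hb1)
    have hcos1 := Real.cos_le_one θ
    have hx : δ < s * Real.cos θ := by
      have : δ / s < Real.cos θ := by
        refine lt_of_lt_of_le ?_ hcos
        have : 2 / Real.pi * θ < 2 / Real.pi * b := by
          have := hθ.2
          gcongr
        have e : 2 / Real.pi * b = 1 - δ / s := by rw [hb]; field_simp
        linarith
      rwa [div_lt_iff₀ hs, mul_comm] at this
    have h1 := h.secondDiff_le_slope (s * Real.cos θ) δ
    have h2 := hB (s * Real.cos θ - δ) (s * Real.cos θ + δ) (by linarith) (by linarith)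
      (by nlinarith)
    nlinarith
  have i2 : ∫ θ in b..(Real.pi / 2), (ν (s * Real.cos θ + δ) + ν (s * Real.cos θ - δ)
      - 2 * ν (s * Real.cos θ)) ≤ ∫ θ in b..(Real.pi / 2), 2 * c * δ :=
    intervalIntegral.integral_mono_on hb1 (hcont.intervalIntegrable _ _)
      intervalIntegrable_const fun θ _ => h.secondDiff_le _ hδ.le
  rw [intervalIntegral.integral_const, smul_eq_mul] at i1 i2
  have e2 : (Real.pi / 2 - b) * (2 * c * δ) = Real.pi * c / s * δ ^ 2 := by
    rw [hb]; field_simp; ring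
  rw [e2] at i2
  have e1 : (b - 0) * (2 * B * δ ^ 2) ≤ Real.pi / 2 * (2 * B * δ ^ 2) := by
    rw [sub_zero]; gcongr
  linarith

end ProfileSubgradient

/-! ### Lower and upper bounds for the amoeba distance -/

theorem IsRegularCurve.contDiffOn_comp {Ω : Set Plane} {f : Plane → ℝ} {a b : Plane} {γ : ℝ → Plane}
    (hγ : IsRegularCurve Ω a b γ) (hf : ContDiffOn ℝ 1 f Ω) :
    ContDiffOn ℝ 1 (fun r => f (γ r)) (Icc 0 1) :=
  hf.comp hγ.contDiff.contDiffOn hγ.mem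

theorem IsRegularCurve.norm_sub_le {Ω : Set Plane} {a b : Plane} {γ : ℝ → Plane}
    (hγ : IsRegularCurve Ω a b γ) : ‖b - a‖ ≤ ∫ t in (0 : ℝ)..1, ‖deriv γ t‖ := by
  have hc : Continuous (deriv γ) := hγ.contDiff.continuous_deriv_one
  have h1 : ∫ t in (0 : ℝ)..1, deriv γ t = γ 1 - γ 0 :=
    intervalIntegral.integral_deriv_eq_sub
      (fun t _ => (hγ.contDiff.differentiable one_ne_zero) t) (hc.intervalIntegrable _ _)
  rw [← hγ.source, ← hγ.target, ← h1]
  exact intervalIntegral.norm_integral_le_integral_norm zero_le_one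

section UnitIntervalFTC

variable {φ : ℝ → ℝ}

theorem hasDerivAt_of_contDiffOn_unit (hφ : ContDiffOn ℝ 1 φ (Icc 0 1)) {t : ℝ}
    (ht : t ∈ Ioo (0 : ℝ) 1) : HasDerivAt φ (derivWithin φ (Icc 0 1) t) t :=
  ((hφ.differentiableOn one_ne_zero) t (Ioo_subset_Icc_self ht)).hasDerivWithinAt.hasDerivAt
    (Icc_mem_nhds ht.1 ht.2)

theorem continuousOn_derivWithin_unit (hφ : ContDiffOn ℝ 1 φ (Icc 0 1)) :
    ContinuousOn (derivWithin φ (Icc 0 1)) (Icc 0 1) :=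
  hφ.continuousOn_derivWithin (uniqueDiffOn_Icc zero_lt_one) le_rfl

theorem integral_derivWithin_unit (hφ : ContDiffOn ℝ 1 φ (Icc 0 1)) :
    ∫ t in (0 : ℝ)..1, derivWithin φ (Icc 0 1) t = φ 1 - φ 0 :=
  intervalIntegral.integral_eq_sub_of_hasDerivAt_of_le zero_le_one hφ.continuousOn
    (fun _ ht => hasDerivAt_of_contDiffOn_unit hφ ht)
    ((continuousOn_derivWithin_unit hφ).intervalIntegrable_of_Icc zero_le_one)

end UnitIntervalFTC

namespace ProfileSubgradient

variable {ν p : ℝ → ℝ} {c : ℝ}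

/-- `f` is controlled only on `Ω`, which the curve may leave outside `[0, 1]`. The derivative within
`[0, 1]` is continuous there and differs from `deriv` at most at the end points. -/
theorem amoebaLength_eq {Ω : Set Plane} {f : Plane → ℝ} {a b : Plane} {γ : ℝ → Plane}
    (hγ : IsRegularCurve Ω a b γ) (hf : ContDiffOn ℝ 1 f Ω) :
    amoebaLength ν f γ = ∫ t in (0 : ℝ)..1,
      ν (derivWithin (fun r => f (γ r)) (Icc 0 1) t / ‖deriv γ t‖) * ‖deriv γ t‖ := by
  rw [amoebaLength, intervalIntegral.integral_of_le zero_le_one,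
    intervalIntegral.integral_of_le zero_le_one, integral_Ioc_eq_integral_Ioo,
    integral_Ioc_eq_integral_Ioo]
  refine setIntegral_congr_fun measurableSet_Ioo fun t ht => ?_
  rw [(hasDerivAt_of_contDiffOn_unit (hγ.contDiffOn_comp hf) ht).deriv]

/-- Jensen's inequality with a free slope `x`: the tangent of `ν` at `x` is integrated against the
Euclidean length element. The length of the curve enters with factor `ν x - p x * x ≥ 0`, so it may
be replaced by the distance of the end points. -/
theorem le_amoebaLength (h : ProfileSubgradient ν p c) {Ω : Set Plane} {f : Plane → ℝ}
    {a b : Plane} {γ : ℝ → Plane} (hγ : IsRegularCurve Ω a b γ) (hf : ContDiffOn ℝ 1 f Ω) (x : ℝ) :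
    ‖b - a‖ * ν x + p x * (f b - f a - x * ‖b - a‖) ≤ amoebaLength ν f γ := by
  have hφ := hγ.contDiffOn_comp hf
  set D := derivWithin (fun r => f (γ r)) (Icc 0 1) with hD
  have hDc : ContinuousOn D (Icc 0 1) := continuousOn_derivWithin_unit hφ
  have hn : Continuous fun t => ‖deriv γ t‖ := hγ.contDiff.continuous_deriv_one.norm
  have hpos : ∀ t ∈ Icc (0 : ℝ) 1, 0 < ‖deriv γ t‖ := fun t ht => norm_pos_iff.2 (hγ.regular t ht)
  have hint : ContinuousOn (fun t => ν (D t / ‖deriv γ t‖) * ‖deriv γ t‖) (Icc 0 1) :=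
    (h.continuous.comp_continuousOn (hDc.div hn.continuousOn fun t ht => (hpos t ht).ne')).mul
      hn.continuousOn
  rw [amoebaLength_eq hγ hf]
  have e : ∫ t in (0 : ℝ)..1, ((ν x - p x * x) * ‖deriv γ t‖ + p x * D t) =
      (ν x - p x * x) * (∫ t in (0 : ℝ)..1, ‖deriv γ t‖) + p x * (f b - f a) := by
    have i1 : IntervalIntegrable (fun t => (ν x - p x * x) * ‖deriv γ t‖) volume 0 1 :=
      (continuous_const.mul hn).intervalIntegrable _ _
    have i2 : IntervalIntegrable (fun t => p x * D t) volume 0 1 :=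
      (continuousOn_const.mul hDc).intervalIntegrable_of_Icc zero_le_one
    rw [intervalIntegral.integral_add i1 i2,
      intervalIntegral.integral_const_mul, intervalIntegral.integral_const_mul, hD,
      integral_derivWithin_unit hφ, hγ.source, hγ.target]
  have h1 : ∫ t in (0 : ℝ)..1, ((ν x - p x * x) * ‖deriv γ t‖ + p x * D t) ≤
      ∫ t in (0 : ℝ)..1, ν (D t / ‖deriv γ t‖) * ‖deriv γ t‖ := by
    refine intervalIntegral.integral_mono_on zero_le_one
      (((continuous_const.mul hn).continuousOn.add
        (continuousOn_const.mul hDc)).intervalIntegrable_of_Icc zero_le_one)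
      (hint.intervalIntegrable_of_Icc zero_le_one) fun t ht => ?_
    have h2 := mul_le_mul_of_nonneg_right (h.sub x (D t / ‖deriv γ t‖)) (hpos t ht).le
    have h3 := (hpos t ht).ne'
    have e : (ν x + p x * (D t / ‖deriv γ t‖ - x)) * ‖deriv γ t‖
        = (ν x - p x * x) * ‖deriv γ t‖ + p x * D t := by
      field_simp
      ring
    linarith
  have h2 := h.mul_le x
  have h3 := mul_le_mul_of_nonneg_left hγ.norm_sub_le (by linarith : 0 ≤ ν x - p x * x)
  linarith

theorem amoeba_le (h : ProfileSubgradient ν p c) {Ω : Set Plane} {f : Plane → ℝ}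
    (hf : ContDiffOn ℝ 1 f Ω) {ρ : ℝ} (hρ : 0 ≤ ρ) {a b : Plane} (hb : b ∈ amoeba ν Ω f ρ a) (x : ℝ) :
    ‖b - a‖ * ν x + p x * (f b - f a - x * ‖b - a‖) ≤ ρ := by
  rw [← ENNReal.ofReal_le_ofReal_iff hρ]
  refine le_trans ?_ hb.2
  exact le_iInf₂ fun γ hγ => ENNReal.ofReal_le_ofReal (h.le_amoebaLength hγ hf x)

theorem norm_sub_le_of_mem_amoeba (h : ProfileSubgradient ν p c) {Ω : Set Plane} {f : Plane → ℝ}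
    (hf : ContDiffOn ℝ 1 f Ω) {ρ : ℝ} (hρ : 0 ≤ ρ) {a b : Plane} (hb : b ∈ amoeba ν Ω f ρ a) :
    ‖b - a‖ ≤ ρ := by
  simpa [h.p_zero, h.zero] using h.amoeba_le hf hρ hb 0

theorem isRegularCurve_segment {Ω : Set Plane} {a v : Plane} (hv : v ≠ 0)
    (hΩ : ∀ t ∈ Icc (0 : ℝ) 1, a + t • v ∈ Ω) :
    IsRegularCurve Ω a (a + v) (fun t => a + t • v) where
  contDiff := by fun_prop
  regular t _ := by
    have : HasDerivAt (fun t : ℝ => a + t • v) ((1 : ℝ) • v) t :=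
      ((hasDerivAt_id t).smul_const v).const_add a
    rw [this.deriv, one_smul]
    exact hv
  mem := hΩ
  source := by simp
  target := by simp

/-- The points that can be reached on a segment along which `f` has almost constant slope. -/
theorem mem_amoeba (h : ProfileSubgradient ν p c) {Ω : Set Plane} {f : Plane → ℝ}
    (hf : ContDiffOn ℝ 1 f Ω) {ρ δ x : ℝ} {a v : Plane} (hv : v ≠ 0)
    (hΩ : ∀ t ∈ Icc (0 : ℝ) 1, a + t • v ∈ Ω)
    (hδ : ∀ t ∈ Ioo (0 : ℝ) 1, |deriv (fun t : ℝ => f (a + t • v)) t / ‖v‖ - x| ≤ δ)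
    (hρ : ‖v‖ * (ν x + (ν (x + δ) + ν (x - δ) - 2 * ν x)) +
      p x * (f (a + v) - f a - x * ‖v‖) ≤ ρ) :
    a + v ∈ amoeba ν Ω f ρ a := by
  have hγ := isRegularCurve_segment hv hΩ
  have hγ' : ∀ t : ℝ, deriv (fun t : ℝ => a + t • v) t = v := fun t => by
    have : HasDerivAt (fun t : ℝ => a + t • v) ((1 : ℝ) • v) t :=
      ((hasDerivAt_id t).smul_const v).const_add a
    rw [this.deriv, one_smul]
  refine ⟨by simpa using hΩ 1 (by simp), (iInf₂_le _ hγ).trans (ENNReal.ofReal_le_ofReal ?_)⟩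
  refine le_trans ?_ hρ
  have hφ := hγ.contDiffOn_comp hf
  have hn : 0 < ‖v‖ := norm_pos_iff.2 hv
  rw [amoebaLength_eq hγ hf]
  simp only [hγ']
  -- The linear term of `le_add_secondDiff` integrates exactly to the increment of `f`; only the
  -- second difference `E` is lost.
  set D := derivWithin (fun r : ℝ => f (a + r • v)) (Icc 0 1) with hD
  have hDc : ContinuousOn D (Icc 0 1) := continuousOn_derivWithin_unit hφ
  set E := ν (x + δ) + ν (x - δ) - 2 * ν x
  have e : ∫ t in (0 : ℝ)..1, (‖v‖ * (ν x + E - p x * x) + p x * D t) =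
      ‖v‖ * (ν x + E) + p x * (f (a + v) - f a - x * ‖v‖) := by
    have i2 : IntervalIntegrable (fun t => p x * D t) volume 0 1 :=
      (continuousOn_const.mul hDc).intervalIntegrable_of_Icc zero_le_one
    rw [intervalIntegral.integral_add intervalIntegrable_const i2,
      intervalIntegral.integral_const_mul (p x), hD, integral_derivWithin_unit hφ]
    simp
    ring
  rw [← e]
  refine intervalIntegral.integral_mono_on_of_le_Ioo zero_le_one ?_
    ((continuousOn_const.add (continuousOn_const.mul hDc)).intervalIntegrable_of_Icc zero_le_one)
    fun t ht => ?_
  · exact ((h.continuous.comp_continuousOn (hDc.div continuousOn_const fun _ _ => hn.ne')).mul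
      continuousOn_const).intervalIntegrable_of_Icc zero_le_one
  · have h1 := hδ t ht
    rw [(hasDerivAt_of_contDiffOn_unit hφ ht).deriv] at h1
    have h2 := mul_le_mul_of_nonneg_right (h.le_add_secondDiff (x := x) h1) hn.le
    rw [add_sub_cancel] at h2
    refine h2.trans (le_of_eq ?_)
    change (ν x + p x * (D t / ‖v‖ - x) + E) * ‖v‖ = _
    field_simp
    ring

end ProfileSubgradient

/-! ### Areas of polar regions and strips -/

/-- Euclidean norm on `ℝ × ℝ`. -/
noncomputable def radius (v : ℝ × ℝ) : ℝ := Real.sqrt (v.1 ^ 2 + v.2 ^ 2)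

theorem radius_nonneg (v : ℝ × ℝ) : 0 ≤ radius v := Real.sqrt_nonneg _

theorem radius_neg (v : ℝ × ℝ) : radius (-v) = radius v := by simp [radius]

theorem abs_fst_le_radius (v : ℝ × ℝ) : |v.1| ≤ radius v :=
  Real.abs_le_sqrt (by nlinarith [sq_nonneg v.2])

theorem abs_snd_le_radius (v : ℝ × ℝ) : |v.2| ≤ radius v :=
  Real.abs_le_sqrt (by nlinarith [sq_nonneg v.1])

theorem radius_le (v : ℝ × ℝ) : radius v ≤ |v.1| + |v.2| := by
  refine Real.sqrt_le_iff.2 ⟨by positivity, ?_⟩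
  nlinarith [sq_abs v.1, sq_abs v.2, abs_nonneg v.1, abs_nonneg v.2]

theorem continuous_radius : Continuous radius := by
  unfold radius
  fun_prop

/-- The part of the right half plane below the graph of `R` in polar coordinates. -/
def polarRegion (R : ℝ → ℝ) : Set (ℝ × ℝ) :=
  {v | 0 < v.1 ∧ radius v ≤ R (Real.arctan (v.2 / v.1))}

theorem measurableSet_polarRegion {R : ℝ → ℝ} (hR : Measurable R) :
    MeasurableSet (polarRegion R) :=
  (measurableSet_lt measurable_const measurable_fst).inter
    (measurableSet_le continuous_radius.measurable
      (hR.comp (Real.continuous_arctan.measurable.comp (measurable_snd.div measurable_fst))))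

theorem polar_of_fst_pos {v : ℝ × ℝ} (hv : 0 < v.1) :
    v.1 = radius v * Real.cos (Real.arctan (v.2 / v.1)) ∧
      v.2 = radius v * Real.sin (Real.arctan (v.2 / v.1)) := by
  have e : Real.sqrt (1 + (v.2 / v.1) ^ 2) = radius v / v.1 := by
    rw [radius, Real.sqrt_eq_iff_mul_self_eq (by positivity) (by positivity), div_mul_div_comm,
      Real.mul_self_sqrt (by positivity)]
    field_simp
  have hr : 0 < radius v := hv.trans_le ((le_abs_self _).trans (abs_fst_le_radius v))
  rw [Real.cos_arctan, Real.sin_arctan, e]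
  constructor <;> field_simp

theorem radius_polar {r θ : ℝ} (hr : 0 ≤ r) : radius (r * Real.cos θ, r * Real.sin θ) = r := by
  rw [radius, Real.sqrt_eq_iff_mul_self_eq (by positivity) hr]
  nlinarith [Real.sin_sq_add_cos_sq θ]

theorem lintegral_Ioi_indicator_Iic {R : ℝ} (hR : 0 ≤ R) :
    ∫⁻ r in Ioi (0 : ℝ), (Iic R).indicator ENNReal.ofReal r = ENNReal.ofReal (R ^ 2 / 2) := by
  rw [lintegral_indicator measurableSet_Iic, Measure.restrict_restrict measurableSet_Iic,
    inter_comm, Ioi_inter_Iic]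
  have h1 : ∫ r in Ioc 0 R, r = R ^ 2 / 2 := by
    rw [← intervalIntegral.integral_of_le hR, integral_id]
    ring
  rw [← h1, ofReal_integral_eq_lintegral_ofReal]
  · exact (continuous_id.integrableOn_Icc).mono_set Ioc_subset_Icc_self
  · exact (ae_restrict_iff' measurableSet_Ioc).2 (Eventually.of_forall fun x hx => hx.1.le)

theorem volume_polarRegion {R : ℝ → ℝ} (hR : Measurable R) (h0 : ∀ θ, 0 ≤ R θ) :
    volume (polarRegion R) =
      ∫⁻ θ in Ioo (-(Real.pi / 2)) (Real.pi / 2), ENNReal.ofReal (R θ ^ 2 / 2) := by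
  have hm := measurableSet_polarRegion hR
  have hpi := Real.pi_pos
  set I := Ioo (-(Real.pi / 2)) (Real.pi / 2) with hI
  set G : ℝ × ℝ → ℝ≥0∞ := fun z =>
    I.indicator (fun θ => (Iic (R θ)).indicator ENNReal.ofReal z.1) z.2 with hG
  have hGm : Measurable G := by
    have : G = ((univ ×ˢ I) ∩ {z : ℝ × ℝ | z.1 ≤ R z.2}).indicator fun z => ENNReal.ofReal z.1 := by
      funext z
      by_cases h1 : z.2 ∈ I <;> by_cases h2 : z.1 ≤ R z.2 <;> simp [hG, indicator, h1, h2]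
    rw [this]
    exact (measurable_fst.ennreal_ofReal).indicator
      ((MeasurableSet.univ.prod measurableSet_Ioo).inter
        (measurableSet_le measurable_fst (hR.comp measurable_snd)))
  rw [← lintegral_indicator_one hm, ← lintegral_comp_polarCoord_symm]
  have e1 : ∫⁻ z in polarCoord.target, ENNReal.ofReal z.1 •
      (polarRegion R).indicator 1 (polarCoord.symm z) = ∫⁻ z in polarCoord.target, G z := by
    refine setLIntegral_congr_fun polarCoord.open_target.measurableSet fun z hz => ?_
    obtain ⟨hz1, hz2⟩ := hz
    have hz1' : 0 < z.1 := hz1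
    rw [polarCoord_symm_apply]
    have hmem : (z.1 * Real.cos z.2, z.1 * Real.sin z.2) ∈ polarRegion R ↔
        z.2 ∈ I ∧ z.1 ≤ R z.2 := by
      -- Polar angles range over `(-π, π)`; the sign of the cosine singles out the right half plane.
      have hcos : 0 < z.1 * Real.cos z.2 ↔ z.2 ∈ I := by
        rw [mul_pos_iff_of_pos_left hz1']
        constructor
        · intro hc
          by_contra hcon
          rw [hI, mem_Ioo, not_and_or, not_lt, not_lt] at hcon
          rcases hcon with hcon | hcon
          · have := Real.cos_nonpos_of_pi_div_two_le_of_le (x := -z.2) (by linarith)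
              (by linarith [hz2.1])
            rw [Real.cos_neg] at this
            linarith
          · have := Real.cos_nonpos_of_pi_div_two_le_of_le (x := z.2) hcon (by linarith [hz2.2])
            linarith
        · exact Real.cos_pos_of_mem_Ioo
      rw [polarRegion, mem_ofPred_eq, hcos, radius_polar hz1'.le]
      refine and_congr_right fun hθ => ?_
      rw [mul_div_mul_left _ _ hz1'.ne', ← Real.tan_eq_sin_div_cos, Real.arctan_tan hθ.1 hθ.2]
    by_cases h1 : z.2 ∈ I <;> by_cases h2 : z.1 ≤ R z.2 <;>
      simp [hG, indicator, h1, h2, hmem]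
  rw [e1, polarCoord_target, Measure.volume_eq_prod, ← Measure.prod_restrict,
    lintegral_prod_symm _ hGm.aemeasurable]
  have e2 : ∀ θ, ∫⁻ r in Ioi (0 : ℝ), G (r, θ) =
      I.indicator (fun θ => ENNReal.ofReal (R θ ^ 2 / 2)) θ := by
    intro θ
    by_cases h1 : θ ∈ I
    · simp only [hG, indicator_of_mem h1]
      exact lintegral_Ioi_indicator_Iic (h0 θ)
    · simp [hG, indicator_of_notMem h1]
  simp_rw [e2]
  rw [lintegral_indicator measurableSet_Ioo, Measure.restrict_restrict measurableSet_Ioo,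
    inter_eq_left.2 (Ioo_subset_Ioo (by linarith) (by linarith))]

theorem volume_real_polarRegion {R : ℝ → ℝ} (hR : Measurable R) (h0 : ∀ θ, 0 ≤ R θ) {B : ℝ}
    (hB : ∀ θ, R θ ≤ B) :
    volume (polarRegion R) ≠ ⊤ ∧ volume.real (polarRegion R) =
      ∫ θ in (-(Real.pi / 2))..(Real.pi / 2), R θ ^ 2 / 2 := by
  have hpi := Real.pi_pos
  have hint : IntegrableOn (fun θ => R θ ^ 2 / 2) (Ioo (-(Real.pi / 2)) (Real.pi / 2)) := by
    refine Measure.integrableOn_of_bounded (M := B ^ 2 / 2) (by simp)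
      ((hR.pow_const 2).div_const 2).aestronglyMeasurable (Eventually.of_forall fun θ => ?_)
    rw [Real.norm_eq_abs, abs_of_nonneg (by positivity)]
    have := h0 θ
    have := hB θ
    gcongr
  rw [Measure.real, volume_polarRegion hR h0, ← ofReal_integral_eq_lintegral_ofReal hint
    (Eventually.of_forall fun θ => by positivity)]
  refine ⟨ENNReal.ofReal_ne_top, ?_⟩
  rw [ENNReal.toReal_ofReal (integral_nonneg fun θ => by positivity),
    intervalIntegral.integral_of_le (by linarith), integral_Ioc_eq_integral_Ioo]

/-- The region to the right of the vertical axis, at heights at most `b`, left of the graph of `g`. -/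
def rightStrip (b : ℝ) (g : ℝ → ℝ) : Set (ℝ × ℝ) :=
  {v | v.2 ∈ Icc (-b) b ∧ v.1 ∈ Ioc 0 (g v.2)}

/-- The region to the left of the vertical axis, at heights at most `b`, right of the graph of
`-g`. -/
def leftStrip (b : ℝ) (g : ℝ → ℝ) : Set (ℝ × ℝ) :=
  {v | v.2 ∈ Icc (-b) b ∧ v.1 ∈ Icc (-g v.2) 0}

theorem measurableSet_rightStrip {b : ℝ} {g : ℝ → ℝ} (hg : Continuous g) :
    MeasurableSet (rightStrip b g) :=
  (measurable_snd measurableSet_Icc).inter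
    ((measurableSet_lt measurable_const measurable_fst).inter
      (measurableSet_le measurable_fst (hg.measurable.comp measurable_snd)))

theorem measurableSet_leftStrip {b : ℝ} {g : ℝ → ℝ} (hg : Continuous g) :
    MeasurableSet (leftStrip b g) :=
  (measurable_snd measurableSet_Icc).inter
    ((measurableSet_le (hg.measurable.comp measurable_snd).neg measurable_fst).inter
      (measurableSet_le measurable_fst measurable_const))

theorem volume_real_of_slices {S : Set (ℝ × ℝ)} (hS : MeasurableSet S) {b : ℝ} (hb : 0 ≤ b)
    {g : ℝ → ℝ} (hg : Continuous g)
    (hs : ∀ y, volume ((fun x => (x, y)) ⁻¹' S) =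
      (Icc (-b) b).indicator (fun y => ENNReal.ofReal (g y)) y) :
    volume S ≠ ⊤ ∧ volume.real S = ∫ y in (-b)..b, max (g y) 0 := by
  have hint : IntegrableOn (fun y => max (g y) 0) (Icc (-b) b) :=
    (hg.max continuous_const).integrableOn_Icc
  have e : volume S = ENNReal.ofReal (∫ y in Icc (-b) b, max (g y) 0) := by
    rw [Measure.volume_eq_prod, Measure.prod_apply_symm hS]
    simp_rw [hs]
    rw [lintegral_indicator measurableSet_Icc, ofReal_integral_eq_lintegral_ofReal hint
      (Eventually.of_forall fun y => le_max_right _ _)]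
    refine lintegral_congr fun y => ?_
    rw [ENNReal.ofReal_max, ENNReal.ofReal_zero, max_eq_left (zero_le)]
  rw [Measure.real, e]
  refine ⟨ENNReal.ofReal_ne_top, ?_⟩
  have h0 : 0 ≤ ∫ y in Icc (-b) b, max (g y) 0 := integral_nonneg fun y => le_max_right _ _
  rw [ENNReal.toReal_ofReal h0,
    intervalIntegral.integral_of_le (by linarith), integral_Icc_eq_integral_Ioc]

theorem volume_real_rightStrip {b : ℝ} (hb : 0 ≤ b) {g : ℝ → ℝ} (hg : Continuous g) :
    volume (rightStrip b g) ≠ ⊤ ∧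
      volume.real (rightStrip b g) = ∫ y in (-b)..b, max (g y) 0 := by
  refine volume_real_of_slices (measurableSet_rightStrip hg) hb hg fun y => ?_
  by_cases hy : y ∈ Icc (-b) b
  · have : (fun x => (x, y)) ⁻¹' rightStrip b g = Ioc 0 (g y) := by
      ext x
      exact ⟨fun h => h.2, fun h => ⟨hy, h⟩⟩
    rw [this, indicator_of_mem hy, Real.volume_Ioc, sub_zero]
  · have : (fun x => (x, y)) ⁻¹' rightStrip b g = ∅ := by
      ext x
      exact ⟨fun h => hy h.1, fun h => h.elim⟩
    rw [this, indicator_of_notMem hy, measure_empty]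

theorem volume_real_leftStrip {b : ℝ} (hb : 0 ≤ b) {g : ℝ → ℝ} (hg : Continuous g) :
    volume (leftStrip b g) ≠ ⊤ ∧
      volume.real (leftStrip b g) = ∫ y in (-b)..b, max (g y) 0 := by
  refine volume_real_of_slices (measurableSet_leftStrip hg) hb hg fun y => ?_
  by_cases hy : y ∈ Icc (-b) b
  · have : (fun x => (x, y)) ⁻¹' leftStrip b g = Icc (-g y) 0 := by
      ext x
      exact ⟨fun h => h.2, fun h => ⟨hy, h⟩⟩
    rw [this, indicator_of_mem hy, Real.volume_Icc, zero_sub, neg_neg]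
  · have : (fun x => (x, y)) ⁻¹' leftStrip b g = ∅ := by
      ext x
      exact ⟨fun h => hy h.1, fun h => h.elim⟩
    rw [this, indicator_of_notMem hy, measure_empty]

/-! ### Solving the radial inequality -/

/-- Upper bound for the solutions of a perturbed linear inequality. -/
theorem radial_le {n k k₀ C r ρ : ℝ} (hn : 1 ≤ n) (hk : |k| ≤ k₀) (hC : 0 ≤ C) (hr : 0 ≤ r)
    (hrρ : r ≤ ρ) (hρ : k₀ * ρ ≤ 1 / 6) (h : r * n + k * r ^ 2 - C * r ^ 3 ≤ ρ) :
    r ≤ ρ / n - k * ρ ^ 2 / n ^ 3 + 2 * (C + 3 * k₀ ^ 2) * ρ ^ 3 := by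
  have hn0 : 0 < n := by linarith
  have hρ0 : 0 ≤ ρ := hr.trans hrρ
  have hk0 : 0 ≤ k₀ := (abs_nonneg k).trans hk
  obtain ⟨hk1, hk2⟩ := abs_le.1 hk
  set y := ρ / n with hy
  have hyρ : y ≤ ρ := div_le_self hρ0 hn
  have hy0 : 0 ≤ y := by positivity
  have hyn : y * n = ρ := by rw [hy]; field_simp
  have e0 : k * ρ ^ 2 / n ^ 3 = k * y ^ 2 / n := by rw [hy]; field_simp
  rw [e0]
  set w := k * y ^ 2 / n with hw
  have hwn : w * n = k * y ^ 2 := by rw [hw]; field_simp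
  have hkr : |k * (r + y)| ≤ 1 / 2 := by
    rw [abs_mul, abs_of_nonneg (by linarith : 0 ≤ r + y)]
    have : |k| * (r + y) ≤ k₀ * (2 * ρ) := by gcongr; linarith
    linarith
  obtain ⟨h1, h2⟩ := abs_le.1 hkr
  have hwk : w * (k * (r + y)) ≤ 2 * k₀ ^ 2 * ρ ^ 3 := by
    have : w * (k * (r + y)) = k ^ 2 * (y ^ 2 / n) * (r + y) := by rw [hw]; ring
    rw [this]
    have a1 : k ^ 2 ≤ k₀ ^ 2 := sq_le_sq' hk1 hk2
    have a2 : y ^ 2 / n ≤ ρ ^ 2 := (div_le_self (by positivity) hn).trans (by gcongr)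
    calc k ^ 2 * (y ^ 2 / n) * (r + y) ≤ k₀ ^ 2 * ρ ^ 2 * (2 * ρ) := by gcongr; linarith
      _ = _ := by ring
  have hr3 : C * r ^ 3 ≤ C * ρ ^ 3 := by gcongr
  by_contra hcon
  push Not at hcon
  have hE : 0 ≤ 2 * (C + 3 * k₀ ^ 2) * ρ ^ 3 := by positivity
  have hk3 : 0 ≤ k₀ ^ 2 * ρ ^ 3 := by positivity
  -- The difference quotient of `r n + k r²` between `y` and `r` is `n + k (r + y) ≥ 1/2`; this is
  -- where the factor `2` in the error term comes from.
  have h3 : 0 < (r - (y - w + 2 * (C + 3 * k₀ ^ 2) * ρ ^ 3)) * (n + k * (r + y)) :=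
    mul_pos (by linarith) (by linarith)
  have h4 : 2 * (C + 3 * k₀ ^ 2) * ρ ^ 3 * (1 / 2) ≤
      2 * (C + 3 * k₀ ^ 2) * ρ ^ 3 * (n + k * (r + y)) := by gcongr; linarith
  nlinarith

/-- Lower bound for the solution set of a perturbed linear inequality. -/
theorem radial_mem {n k k₀ C D r ρ : ℝ} (hn : 1 ≤ n) (hk : |k| ≤ k₀) (hC : 0 ≤ C) (hD : 0 ≤ D)
    (hρ0 : 0 ≤ ρ) (hr : 0 ≤ r) (hρ : k₀ * ρ ≤ 1 / 6)
    (h : r ≤ ρ / n - k * ρ ^ 2 / n ^ 3 - (16 * C * ρ ^ 3 + 4 * ρ * D)) :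
    r ≤ 2 * ρ ∧ r * n + k * r ^ 2 + C * r ^ 3 + r * D ≤ ρ := by
  have hn0 : 0 < n := by linarith
  have hk0 : 0 ≤ k₀ := (abs_nonneg k).trans hk
  obtain ⟨hk1, hk2⟩ := abs_le.1 hk
  set y := ρ / n with hy
  have hyρ : y ≤ ρ := div_le_self hρ0 hn
  have hy0 : 0 ≤ y := by positivity
  have hyn : y * n = ρ := by rw [hy]; field_simp
  have e0 : k * ρ ^ 2 / n ^ 3 = k * y ^ 2 / n := by rw [hy]; field_simp
  rw [e0] at h
  set w := k * y ^ 2 / n with hw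
  have hwn : w * n = k * y ^ 2 := by rw [hw]; field_simp
  have hE : 0 ≤ 16 * C * ρ ^ 3 + 4 * ρ * D := by positivity
  have hwρ : -w ≤ ρ := by
    have : -w = -k * (y ^ 2 / n) := by rw [hw]; ring
    rw [this]
    have a2 : y ^ 2 / n ≤ ρ ^ 2 := (div_le_self (by positivity) hn).trans (by gcongr)
    calc -k * (y ^ 2 / n) ≤ k₀ * ρ ^ 2 := by
          gcongr; linarith
      _ = (k₀ * ρ) * ρ := by ring
      _ ≤ 1 / 6 * ρ := by gcongr
      _ ≤ ρ := by linarith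
  have hr2 : r ≤ 2 * ρ := by linarith
  refine ⟨hr2, ?_⟩
  have hkr : |k * (r + y)| ≤ 1 / 2 := by
    rw [abs_mul, abs_of_nonneg (by linarith : 0 ≤ r + y)]
    have : |k| * (r + y) ≤ k₀ * (3 * ρ) := by gcongr; linarith
    linarith
  obtain ⟨h1, h2⟩ := abs_le.1 hkr
  have hwk : 0 ≤ w * (k * (r + y)) := by
    have : w * (k * (r + y)) = k ^ 2 * (y ^ 2 / n) * (r + y) := by rw [hw]; ring
    rw [this]
    positivity
  have hr3 : C * r ^ 3 ≤ C * (2 * ρ) ^ 3 := by gcongr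
  have hrD : r * D ≤ 2 * ρ * D := by gcongr
  -- The errors are at most `8 C ρ³` and `2 ρ D` because `r ≤ 2ρ`; dividing by the difference
  -- quotient, at least `1/2`, doubles them. The term `w k (r + y) ≥ 0` has the favourable sign
  -- here.
  have h3 : 0 ≤ (y - w - (16 * C * ρ ^ 3 + 4 * ρ * D) - r) * (n + k * (r + y)) :=
    mul_nonneg (by linarith) (by linarith)
  have h4 : (16 * C * ρ ^ 3 + 4 * ρ * D) * (1 / 2) ≤
      (16 * C * ρ ^ 3 + 4 * ρ * D) * (n + k * (r + y)) := by gcongr; linarith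
  nlinarith

/-! ### The amoeba in gauge coordinates -/

/-- The quadratic form with coefficients `q₁₁`, `q₁₂`, `q₂₂`. -/
def quadForm (q₁₁ q₁₂ q₂₂ : ℝ) (v : ℝ × ℝ) : ℝ :=
  q₁₁ * v.1 ^ 2 + 2 * q₁₂ * (v.1 * v.2) + q₂₂ * v.2 ^ 2

/-- `A` is an amoeba of radius `ρ` around the origin and `U` the difference of image values, in
coordinates for which the first axis points along the gradient, of length `a`. -/
structure LocalAmoeba (ν p : ℝ → ℝ) (a β q₁₁ q₁₂ q₂₂ K Λ ρ : ℝ) (A : Set (ℝ × ℝ))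
    (U : ℝ × ℝ → ℝ) : Prop where
  outer : ∀ v ∈ A, ∀ x, radius v * ν x + p x * (β * U v - x * radius v) ≤ ρ
  inner : ∀ v, v ≠ 0 → radius v ≤ 2 * ρ → ∀ x, x * radius v = β * a * v.1 →
    radius v * (ν x + (ν (x + Λ * ρ) + ν (x - Λ * ρ) - 2 * ν x)) +
      p x * (β * U v - x * radius v) ≤ ρ → v ∈ A
  taylor : ∀ v, radius v ≤ 2 * ρ →
    |U v - (a * v.1 + quadForm q₁₁ q₁₂ q₂₂ v / 2)| ≤ K * radius v ^ 3

theorem abs_quadForm_le (q₁₁ q₁₂ q₂₂ : ℝ) (v : ℝ × ℝ) :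
    |quadForm q₁₁ q₁₂ q₂₂ v| ≤ (|q₁₁| + 2 * |q₁₂| + |q₂₂|) * radius v ^ 2 := by
  have h1 := abs_fst_le_radius v
  have h2 := abs_snd_le_radius v
  calc |quadForm q₁₁ q₁₂ q₂₂ v|
      ≤ |q₁₁ * v.1 ^ 2| + |2 * q₁₂ * (v.1 * v.2)| + |q₂₂ * v.2 ^ 2| := abs_add_three _ _ _
    _ = |q₁₁| * |v.1| ^ 2 + 2 * |q₁₂| * (|v.1| * |v.2|) + |q₂₂| * |v.2| ^ 2 := by
      simp only [abs_mul, abs_pow, abs_two]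
    _ ≤ |q₁₁| * radius v ^ 2 + 2 * |q₁₂| * (radius v * radius v) + |q₂₂| * radius v ^ 2 := by
      gcongr
      exact radius_nonneg v
    _ = _ := by ring

theorem quadForm_neg (q₁₁ q₁₂ q₂₂ : ℝ) (v : ℝ × ℝ) :
    quadForm q₁₁ q₁₂ q₂₂ (-v) = quadForm q₁₁ q₁₂ q₂₂ v := by
  simp [quadForm]

theorem quadForm_polar (q₁₁ q₁₂ q₂₂ r θ : ℝ) :
    quadForm q₁₁ q₁₂ q₂₂ (r * Real.cos θ, r * Real.sin θ) =
      r ^ 2 * quadForm q₁₁ q₁₂ q₂₂ (Real.cos θ, Real.sin θ) := by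
  simp only [quadForm]
  ring

/-- First order slope, in direction `θ`, of the perturbed norm. -/
noncomputable def radialSlope (p : ℝ → ℝ) (a β q₁₁ q₁₂ q₂₂ θ : ℝ) : ℝ :=
  p (β * a * Real.cos θ) * (β / 2 * quadForm q₁₁ q₁₂ q₂₂ (Real.cos θ, Real.sin θ))

/-- Radial function of a region containing the right half of the amoeba. -/
noncomputable def outerRadius (ν p : ℝ → ℝ) (a β q₁₁ q₁₂ q₂₂ E ρ θ : ℝ) : ℝ :=
  ρ / ν (β * a * Real.cos θ) - radialSlope p a β q₁₁ q₁₂ q₂₂ θ * ρ ^ 2 /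
    ν (β * a * Real.cos θ) ^ 3 + E * ρ ^ 3

/-- Radial function of a region contained in the reflection of the left half of the amoeba. -/
noncomputable def innerRadius (ν p : ℝ → ℝ) (a β q₁₁ q₁₂ q₂₂ E Λ ρ θ : ℝ) : ℝ :=
  ρ / ν (β * a * Real.cos θ) + radialSlope p a β q₁₁ q₁₂ q₂₂ θ * ρ ^ 2 /
    ν (β * a * Real.cos θ) ^ 3 - (E * ρ ^ 3 + 4 * ρ * (ν (β * a * Real.cos θ + Λ * ρ) +
      ν (β * a * Real.cos θ - Λ * ρ) - 2 * ν (β * a * Real.cos θ)))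

namespace ProfileSubgradient

variable {ν p : ℝ → ℝ} {c a β q₁₁ q₁₂ q₂₂ K Λ ρ : ℝ} {A : Set (ℝ × ℝ)} {U : ℝ × ℝ → ℝ}

theorem abs_radialSlope_le (h : ProfileSubgradient ν p c) (hβ : 0 < β) (θ : ℝ) :
    |radialSlope p a β q₁₁ q₁₂ q₂₂ θ| ≤ c * (β / 2 * (|q₁₁| + 2 * |q₁₂| + |q₂₂|)) := by
  rw [radialSlope, abs_mul, abs_mul, abs_of_pos (by positivity : 0 < β / 2)]
  have h1 := abs_quadForm_le q₁₁ q₁₂ q₂₂ (Real.cos θ, Real.sin θ)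
  have h2 : radius (Real.cos θ, Real.sin θ) = 1 := by
    simpa using radius_polar (r := 1) (θ := θ) zero_le_one
  rw [h2, one_pow, mul_one] at h1
  have := h.c_nonneg
  have := h.bound (β * a * Real.cos θ)
  gcongr

theorem measurable_radialSlope (h : ProfileSubgradient ν p c) :
    Measurable (radialSlope p a β q₁₁ q₁₂ q₂₂) := by
  unfold radialSlope quadForm
  exact (h.mono.measurable.comp (by fun_prop)).mul (by fun_prop)

theorem measurable_outerRadius (h : ProfileSubgradient ν p c) (E : ℝ) :
    Measurable (outerRadius ν p a β q₁₁ q₁₂ q₂₂ E ρ) := by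
  have h1 := (h.continuous_mul_cos (β * a)).measurable
  exact ((h1.const_div ρ).sub ((h.measurable_radialSlope.mul_const _).div
    (h1.pow_const 3))).add_const _

theorem measurable_innerRadius (h : ProfileSubgradient ν p c) (E : ℝ) :
    Measurable (innerRadius ν p a β q₁₁ q₁₂ q₂₂ E Λ ρ) := by
  have h1 := (h.continuous_mul_cos (β * a)).measurable
  exact ((h1.const_div ρ).add ((h.measurable_radialSlope.mul_const _).div
    (h1.pow_const 3))).sub
      (((h.continuous_secondDiff (β * a) (Λ * ρ)).measurable.const_mul _).const_add _)

theorem radius_le_of_mem (h : ProfileSubgradient ν p c)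
    (hA : LocalAmoeba ν p a β q₁₁ q₁₂ q₂₂ K Λ ρ A U) {v : ℝ × ℝ} (hv : v ∈ A) : radius v ≤ ρ := by
  simpa [h.zero, h.p_zero] using hA.outer v hv 0

theorem mem_polarRegion_outerRadius (h : ProfileSubgradient ν p c) (hβ : 0 < β) (hK : 0 ≤ K)
    (hρ : c * (β / 2 * (|q₁₁| + 2 * |q₁₂| + |q₂₂|)) * ρ ≤ 1 / 6)
    (hA : LocalAmoeba ν p a β q₁₁ q₁₂ q₂₂ K Λ ρ A U) {v : ℝ × ℝ} (hv : v ∈ A) (hv0 : 0 < v.1) :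
    v ∈ polarRegion (outerRadius ν p a β q₁₁ q₁₂ q₂₂
      (2 * (c * β * K + 3 * (c * (β / 2 * (|q₁₁| + 2 * |q₁₂| + |q₂₂|))) ^ 2)) ρ) := by
  refine ⟨hv0, ?_⟩
  have hr0 := radius_nonneg v
  have hrρ := h.radius_le_of_mem hA hv
  obtain ⟨e1, e2⟩ := polar_of_fst_pos hv0
  set θ := Real.arctan (v.2 / v.1)
  set r := radius v with hr
  have hc := h.c_nonneg
  refine radial_le (h.one_le _) (h.abs_radialSlope_le hβ θ) (by positivity) hr0 hrρ hρ ?_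
  -- The slope of the linear part of `β U` in direction `θ`. With this choice the linear terms
  -- cancel and only `k r²` and the Taylor remainder, at most `c β K r³`, are left.
  have h1 := hA.outer v hv (β * a * Real.cos θ)
  have h2 := hA.taylor v (by linarith)
  have e3 : quadForm q₁₁ q₁₂ q₂₂ v = r ^ 2 * quadForm q₁₁ q₁₂ q₂₂ (Real.cos θ, Real.sin θ) := by
    rw [← quadForm_polar, ← e1, ← e2]
  have h3 : |p (β * a * Real.cos θ) * (β * (U v - (a * v.1 + quadForm q₁₁ q₁₂ q₂₂ v / 2)))| ≤
      c * (β * (K * r ^ 3)) := by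
    rw [abs_mul, abs_mul, abs_of_pos hβ]
    have := h.bound (β * a * Real.cos θ)
    gcongr
  have h4 := (abs_le.1 h3).1
  have e4 : p (β * a * Real.cos θ) * (β * U v - β * a * Real.cos θ * r) =
      radialSlope p a β q₁₁ q₁₂ q₂₂ θ * r ^ 2 +
      p (β * a * Real.cos θ) * (β * (U v - (a * v.1 + quadForm q₁₁ q₁₂ q₂₂ v / 2))) := by
    rw [e3, radialSlope]
    linear_combination p (β * a * Real.cos θ) * β * a * e1
  rw [e4] at h1
  linarith

theorem neg_mem_of_mem_polarRegion_innerRadius (h : ProfileSubgradient ν p c) (hβ : 0 < β)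
    (hK : 0 ≤ K) (hρ0 : 0 ≤ ρ) (hρ : c * (β / 2 * (|q₁₁| + 2 * |q₁₂| + |q₂₂|)) * ρ ≤ 1 / 6)
    (hA : LocalAmoeba ν p a β q₁₁ q₁₂ q₂₂ K Λ ρ A U) {v : ℝ × ℝ}
    (hv : v ∈ polarRegion (innerRadius ν p a β q₁₁ q₁₂ q₂₂ (16 * (c * β * K)) Λ ρ)) :
    -v ∈ A := by
  obtain ⟨hv0, hvr⟩ := hv
  have hr0 := radius_nonneg v
  obtain ⟨e1, e2⟩ := polar_of_fst_pos hv0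
  set θ := Real.arctan (v.2 / v.1)
  set r := radius v with hr
  have hc := h.c_nonneg
  set D := ν (β * a * Real.cos θ + Λ * ρ) + ν (β * a * Real.cos θ - Λ * ρ) -
    2 * ν (β * a * Real.cos θ) with hD
  -- At `-v` the slope is `-βa cos θ`; `p` is odd and the quadratic form even, so `k` changes sign
  -- while `ν` and its second difference do not.
  obtain ⟨h1, h2⟩ := radial_mem (k := -radialSlope p a β q₁₁ q₁₂ q₂₂ θ) (C := c * β * K) (D := D)
    (h.one_le (β * a * Real.cos θ)) ((abs_neg _).trans_le (h.abs_radialSlope_le hβ θ))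
    (by positivity) (h.secondDiff_nonneg _ _) hρ0 hr0 hρ (by
      refine hvr.trans (le_of_eq ?_)
      rw [innerRadius, ← hD]
      ring)
  refine hA.inner (-v) (fun h0 => ?_) (by rw [radius_neg]; exact h1) (-(β * a * Real.cos θ)) ?_ ?_
  · have : v.1 = 0 := by rw [neg_eq_zero.1 h0]; rfl
    linarith
  · rw [radius_neg, Prod.fst_neg]
    linear_combination β * a * e1
  · have h3 := hA.taylor (-v) (by rw [radius_neg]; exact h1)
    rw [quadForm_neg, radius_neg, Prod.fst_neg] at h3
    have e3 : quadForm q₁₁ q₁₂ q₂₂ v = r ^ 2 * quadForm q₁₁ q₁₂ q₂₂ (Real.cos θ, Real.sin θ) := by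
      rw [← quadForm_polar, ← e1, ← e2]
    have h4 : |p (β * a * Real.cos θ) *
        (β * (U (-v) - (a * -v.1 + quadForm q₁₁ q₁₂ q₂₂ v / 2)))| ≤ c * (β * (K * r ^ 3)) := by
      rw [abs_mul, abs_mul, abs_of_pos hβ]
      have := h.bound (β * a * Real.cos θ)
      gcongr
    have h5 := (abs_le.1 h4).1
    have e5 : -(β * a * Real.cos θ) + Λ * ρ = -(β * a * Real.cos θ - Λ * ρ) := by ring
    have e6 : -(β * a * Real.cos θ) - Λ * ρ = -(β * a * Real.cos θ + Λ * ρ) := by ring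
    rw [radius_neg, e5, e6, h.even, h.even, h.even, h.odd]
    have e4 : -p (β * a * Real.cos θ) * (β * U (-v) - -(β * a * Real.cos θ) * r) =
        -radialSlope p a β q₁₁ q₁₂ q₂₂ θ * r ^ 2 - p (β * a * Real.cos θ) *
          (β * (U (-v) - (a * -v.1 + quadForm q₁₁ q₁₂ q₂₂ v / 2))) := by
      rw [e3, radialSlope]
      linear_combination p (β * a * Real.cos θ) * β * a * e1
    rw [e4]
    have e7 : ν (β * a * Real.cos θ - Λ * ρ) + ν (β * a * Real.cos θ + Λ * ρ) -
        2 * ν (β * a * Real.cos θ) = D := by rw [hD]; ring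
    rw [e7, ← hr]
    linarith

/-- The mixed term is odd in `θ` and drops out; `p` equals `deriv ν` at almost every argument. -/
theorem integral_radialSlope (h : ProfileSubgradient ν p c) (ha : 0 < a) (hβ : 0 < β) :
    IntervalIntegrable (fun θ => radialSlope p a β q₁₁ q₁₂ q₂₂ θ / ν (β * a * Real.cos θ) ^ 4)
      volume (-(Real.pi / 2)) (Real.pi / 2) ∧
    ∫ θ in (-(Real.pi / 2))..(Real.pi / 2),
      radialSlope p a β q₁₁ q₁₂ q₂₂ θ / ν (β * a * Real.cos θ) ^ 4 =
      β / 2 * (q₁₁ * amoebaJ3 ν (β * a) + q₂₂ * amoebaJ1 ν (β * a)) := by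
  have hs : β * a ≠ 0 := (mul_pos hβ ha).ne'
  have hle : -(Real.pi / 2) ≤ Real.pi / 2 := by linarith [Real.pi_pos]
  have hcongr : ∀ w : ℝ → ℝ, ∫ θ in (-(Real.pi / 2))..(Real.pi / 2),
      deriv ν (β * a * Real.cos θ) / ν (β * a * Real.cos θ) ^ 4 * w θ =
      ∫ θ in (-(Real.pi / 2))..(Real.pi / 2),
        p (β * a * Real.cos θ) / ν (β * a * Real.cos θ) ^ 4 * w θ := by
    intro w
    refine intervalIntegral.integral_congr_ae ?_
    filter_upwards [h.ae_continuousAt_mul_cos hs] with θ hθ hm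
    rw [uIoc_of_le hle] at hm
    rw [(h.hasDerivAt (hθ ⟨hm.1.le, hm.2⟩)).deriv]
  have i1 := h.intervalIntegrable_slope h.mono.measurable h.bound
    (w := fun θ => Real.cos θ ^ 2) (by fun_prop) (β * a) (-(Real.pi / 2)) (Real.pi / 2) 4
  have i2 := h.intervalIntegrable_slope h.mono.measurable h.bound
    (w := fun θ => Real.cos θ * Real.sin θ) (by fun_prop) (β * a) (-(Real.pi / 2)) (Real.pi / 2) 4
  have i3 := h.intervalIntegrable_slope h.mono.measurable h.bound
    (w := fun θ => Real.sin θ ^ 2) (by fun_prop) (β * a) (-(Real.pi / 2)) (Real.pi / 2) 4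
  have hodd : ∫ θ in (-(Real.pi / 2))..(Real.pi / 2),
      p (β * a * Real.cos θ) / ν (β * a * Real.cos θ) ^ 4 * (Real.cos θ * Real.sin θ) = 0 := by
    have := intervalIntegral.integral_comp_neg (a := -(Real.pi / 2)) (b := Real.pi / 2) fun θ =>
      p (β * a * Real.cos θ) / ν (β * a * Real.cos θ) ^ 4 * (Real.cos θ * Real.sin θ)
    simp only [Real.cos_neg, Real.sin_neg, mul_neg, neg_neg, intervalIntegral.integral_neg] at this
    linarith
  have e : ∀ θ, radialSlope p a β q₁₁ q₁₂ q₂₂ θ / ν (β * a * Real.cos θ) ^ 4 =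
      β / 2 * q₁₁ * (p (β * a * Real.cos θ) / ν (β * a * Real.cos θ) ^ 4 * Real.cos θ ^ 2) +
      β * q₁₂ * (p (β * a * Real.cos θ) / ν (β * a * Real.cos θ) ^ 4 *
        (Real.cos θ * Real.sin θ)) +
      β / 2 * q₂₂ * (p (β * a * Real.cos θ) / ν (β * a * Real.cos θ) ^ 4 * Real.sin θ ^ 2) := by
    intro θ
    rw [radialSlope, quadForm]
    ring
  simp_rw [e]
  refine ⟨((i1.const_mul _).add (i2.const_mul _)).add (i3.const_mul _), ?_⟩
  rw [intervalIntegral.integral_add ((i1.const_mul _).add (i2.const_mul _)) (i3.const_mul _),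
    intervalIntegral.integral_add (i1.const_mul _) (i2.const_mul _),
    intervalIntegral.integral_const_mul, intervalIntegral.integral_const_mul,
    intervalIntegral.integral_const_mul, hodd, amoebaJ3, amoebaJ1, hcongr, hcongr]
  ring

end ProfileSubgradient

/-! ### Comparison of areas on both sides of a level line -/

/-- Difference of the area densities `R²/2` of the outer right and inner left radial functions: the
terms `ρ²/n²` cancel, and the cross terms give `-2ρ³ k/n⁴`. -/
theorem half_sq_sub_half_sq_le {n k k₀ D E E' ρ : ℝ} (hn : 1 ≤ n) (hk : |k| ≤ k₀) (hD : 0 ≤ D)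
    (hE : 0 ≤ E) (hE' : 0 ≤ E') (hρ0 : 0 ≤ ρ) (hρ1 : ρ ≤ 1) (hρ : k₀ * ρ ≤ 1 / 6) :
    (ρ / n - k * ρ ^ 2 / n ^ 3 + E * ρ ^ 3) ^ 2 / 2 -
      (ρ / n + k * ρ ^ 2 / n ^ 3 - (E' * ρ ^ 3 + 4 * ρ * D)) ^ 2 / 2 ≤
      -2 * ρ ^ 3 * (k / n ^ 4) + ((2 * E + 2 * E' + E ^ 2 / 2) * ρ ^ 4 + 8 * ρ ^ 2 * D) := by
  have hn0 : 0 < n := by linarith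
  set y := ρ / n with hy
  have hyρ : y ≤ ρ := div_le_self hρ0 hn
  have hy0 : 0 ≤ y := by positivity
  set w := k * ρ ^ 2 / n ^ 3 with hw
  have hwy : w * y = ρ ^ 3 * (k / n ^ 4) := by rw [hw, hy]; field_simp
  have hwρ : |w| ≤ ρ := by
    have e : w = k * (ρ ^ 2 / n ^ 3) := by rw [hw]; ring
    rw [e, abs_mul, abs_of_nonneg (by positivity : 0 ≤ ρ ^ 2 / n ^ 3)]
    have hk0 := (abs_nonneg k).trans hk
    calc |k| * (ρ ^ 2 / n ^ 3) ≤ k₀ * ρ ^ 2 := by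
          gcongr
          exact div_le_self (by positivity) (one_le_pow₀ hn)
      _ = (k₀ * ρ) * ρ := by ring
      _ ≤ 1 / 6 * ρ := by gcongr
      _ ≤ ρ := by linarith
  obtain ⟨hw1, hw2⟩ := abs_le.1 hwρ
  set e := E * ρ ^ 3 with he
  set G := E' * ρ ^ 3 + 4 * ρ * D with hG
  have he0 : 0 ≤ e := by positivity
  have hG0 : 0 ≤ G := by positivity
  have h1 : -w * (e - G) ≤ ρ * (e + G) := by nlinarith
  have h2 : (e + G) * y ≤ (e + G) * ρ := by gcongr
  have h3 : e ^ 2 ≤ E ^ 2 * ρ ^ 4 := by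
    have : e ^ 2 = E ^ 2 * ρ ^ 4 * ρ ^ 2 := by rw [he]; ring
    rw [this]
    exact mul_le_of_le_one_right (by positivity) (pow_le_one₀ hρ0 hρ1)
  have h4 : 2 * ρ * (e + G) = (2 * E + 2 * E') * ρ ^ 4 + 8 * ρ ^ 2 * D := by
    rw [he, hG]; ring
  nlinarith [sq_nonneg G]

theorem eventually_mul_le (B : ℝ) {ε : ℝ} (hε : 0 < ε) : ∀ᶠ ρ in 𝓝[>] (0 : ℝ), B * ρ ≤ ε := by
  have h : Tendsto (fun ρ : ℝ => B * ρ) (𝓝[>] 0) (𝓝 0) := by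
    have : Continuous fun ρ : ℝ => B * ρ := by fun_prop
    simpa only [mul_zero] using (this.tendsto 0).mono_left nhdsWithin_le_nhds
  filter_upwards [h.eventually (gt_mem_nhds hε)] with ρ hρ using hρ.le

/-- Areas of the strips that separate the level line from the vertical axis. -/
theorem exists_strip_area {a : ℝ} (ha : 0 < a) (q M C₁ : ℝ) (hC₁ : 0 ≤ C₁) :
    ∃ C, ∀ᶠ ρ in 𝓝[>] (0 : ℝ), ∀ m, |m| ≤ M →
      ρ ^ 3 * ((2 * m - q / 3) / a) - C * ρ ^ 4 ≤
        volume.real (rightStrip (ρ - C₁ * ρ ^ 2)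
          fun y => (ρ ^ 2 * m - q * y ^ 2 / 2) / a - C₁ * ρ ^ 3) -
        volume.real (leftStrip ρ fun y => C₁ * ρ ^ 3 - (ρ ^ 2 * m - q * y ^ 2 / 2) / a) := by
  refine ⟨2 * C₁ * ((M + |q|) / a) + 2 * C₁, ?_⟩
  filter_upwards [self_mem_nhdsWithin, eventually_mul_le C₁ one_pos] with ρ (hρ : 0 < ρ) hρ1 m hm
  set b := ρ - C₁ * ρ ^ 2 with hb
  have hb0 : 0 ≤ b := by rw [hb]; nlinarith
  have hbρ : b ≤ ρ := by rw [hb]; nlinarith [mul_nonneg hC₁ (sq_nonneg ρ)]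
  set g : ℝ → ℝ := fun y => (ρ ^ 2 * m - q * y ^ 2 / 2) / a - C₁ * ρ ^ 3 with hg
  have hgc : Continuous g := by rw [hg]; fun_prop
  have hneg : (fun y => C₁ * ρ ^ 3 - (ρ ^ 2 * m - q * y ^ 2 / 2) / a) = fun y => -g y := by
    funext y; simp [hg]
  have hgc' : Continuous fun y => -g y := hgc.neg
  rw [hneg, (volume_real_rightStrip hb0 hgc).2, (volume_real_leftStrip hρ.le hgc').2]
  have hmc : Continuous fun y => max (g y) 0 := hgc.max continuous_const
  have hmc' : Continuous fun y => max (-g y) 0 := hgc'.max continuous_const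
  have hM : 0 ≤ M := (abs_nonneg m).trans hm
  have hgb : ∀ y ∈ Icc (-ρ) ρ, max (g y) 0 ≤ (M + |q|) / a * ρ ^ 2 := by
    intro y hy
    refine max_le ?_ (by positivity)
    have h1 : y ^ 2 ≤ ρ ^ 2 := sq_le_sq' hy.1 hy.2
    have h2 : ρ ^ 2 * m - q * y ^ 2 / 2 ≤ (M + |q|) * ρ ^ 2 := by
      have h3 : ρ ^ 2 * m ≤ ρ ^ 2 * M := by gcongr; exact (le_abs_self m).trans hm
      have h4 : -q * y ^ 2 ≤ |q| * ρ ^ 2 := by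
        gcongr
        exact neg_le_abs q
      have : 0 ≤ |q| * ρ ^ 2 := by positivity
      linarith
    have h3 : (ρ ^ 2 * m - q * y ^ 2 / 2) / a ≤ (M + |q|) * ρ ^ 2 / a := by gcongr
    have h4 : 0 ≤ C₁ * ρ ^ 3 := by positivity
    simp only [hg]
    have h5 : (M + |q|) / a * ρ ^ 2 = (M + |q|) * ρ ^ 2 / a := by ring
    linarith
  -- Shortening the right strip to heights at most `b` loses two pieces of width `C₁ ρ²` and
  -- thickness `O(ρ²)`, which is `O(ρ⁴)`.
  have hsplit : ∫ y in (-ρ)..ρ, max (g y) 0 = (∫ y in (-ρ)..(-b), max (g y) 0) +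
      (∫ y in (-b)..b, max (g y) 0) + ∫ y in b..ρ, max (g y) 0 := by
    rw [intervalIntegral.integral_add_adjacent_intervals (hmc.intervalIntegrable _ _)
      (hmc.intervalIntegrable _ _), intervalIntegral.integral_add_adjacent_intervals
      (hmc.intervalIntegrable _ _) (hmc.intervalIntegrable _ _)]
  have t1 : ∫ y in (-ρ)..(-b), max (g y) 0 ≤ (ρ - b) * ((M + |q|) / a * ρ ^ 2) := by
    have := intervalIntegral.integral_mono_on (by linarith : -ρ ≤ -b)
      (hmc.intervalIntegrable (μ := volume) _ _) (intervalIntegrable_const (c := (M + |q|) / a * ρ ^ 2))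
      fun y hy => hgb y ⟨hy.1, by linarith [hy.2]⟩
    rw [intervalIntegral.integral_const, smul_eq_mul] at this
    linarith
  have t2 : ∫ y in b..ρ, max (g y) 0 ≤ (ρ - b) * ((M + |q|) / a * ρ ^ 2) := by
    have := intervalIntegral.integral_mono_on hbρ
      (hmc.intervalIntegrable (μ := volume) _ _) (intervalIntegrable_const (c := (M + |q|) / a * ρ ^ 2))
      fun y hy => hgb y ⟨by linarith [hy.1], hy.2⟩
    rwa [intervalIntegral.integral_const, smul_eq_mul] at this
  -- The level line may cross the axis; the areas of positive and negative part combine to the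
  -- signed integral of `g`.
  have hdiff : (∫ y in (-ρ)..ρ, max (g y) 0) - ∫ y in (-ρ)..ρ, max (-g y) 0 =
      ∫ y in (-ρ)..ρ, g y := by
    rw [← intervalIntegral.integral_sub (hmc.intervalIntegrable _ _)
      (hmc'.intervalIntegrable _ _)]
    refine intervalIntegral.integral_congr fun y _ => ?_
    rcases le_total (g y) 0 with h | h
    · rw [max_eq_right h, max_eq_left (by linarith)]; ring
    · rw [max_eq_left h, max_eq_right (by linarith)]; ring
  have hint : ∫ y in (-ρ)..ρ, g y = ρ ^ 3 * ((2 * m - q / 3) / a) - 2 * C₁ * ρ ^ 4 := by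
    have e : ∀ y, g y = (ρ ^ 2 * m / a - C₁ * ρ ^ 3) + -(q / (2 * a)) * y ^ 2 := by
      intro y; simp only [hg]; field_simp; ring
    simp_rw [e]
    have hi : IntervalIntegrable (fun y : ℝ => -(q / (2 * a)) * y ^ 2) volume (-ρ) ρ :=
      Continuous.intervalIntegrable (by fun_prop) _ _
    rw [intervalIntegral.integral_add intervalIntegrable_const hi,
      intervalIntegral.integral_const, intervalIntegral.integral_const_mul, integral_pow, smul_eq_mul]
    field_simp
    ring
  have hρb : ρ - b = C₁ * ρ ^ 2 := by rw [hb]; ring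
  rw [hρb] at t1 t2
  nlinarith

namespace ProfileSubgradient

variable {ν p : ℝ → ℝ} {c a β q₁₁ q₁₂ q₂₂ K Λ : ℝ}

/-- Areas of the halves of the amoeba on either side of the vertical axis. -/
theorem exists_half_area (h : ProfileSubgradient ν p c) (ha : 0 < a) (hβ : 0 < β)
    (hΛ : 0 ≤ Λ) {E E' : ℝ} (hE : 0 ≤ E) (hE' : 0 ≤ E') :
    ∃ C, ∀ᶠ ρ in 𝓝[>] (0 : ℝ),
      volume (polarRegion (outerRadius ν p a β q₁₁ q₁₂ q₂₂ E ρ)) ≠ ⊤ ∧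
      volume (polarRegion (innerRadius ν p a β q₁₁ q₁₂ q₂₂ E' Λ ρ)) ≠ ⊤ ∧
      volume.real (polarRegion (outerRadius ν p a β q₁₁ q₁₂ q₂₂ E ρ)) -
        volume.real (polarRegion (innerRadius ν p a β q₁₁ q₁₂ q₂₂ E' Λ ρ)) ≤
        -ρ ^ 3 * (β * (q₁₁ * amoebaJ3 ν (β * a) + q₂₂ * amoebaJ1 ν (β * a))) +
          C * (ρ ^ 4 + ρ ^ 2 * secondDiffIntegral ν (β * a) (Λ * ρ)) := by
  have hc := h.c_nonneg
  have hpi := Real.pi_pos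
  have hle : -(Real.pi / 2) ≤ Real.pi / 2 := by linarith
  set k₀ := c * (β / 2 * (|q₁₁| + 2 * |q₁₂| + |q₂₂|)) with hk₀
  have hk₀0 : 0 ≤ k₀ := by positivity
  have hνb : ∀ θ, ν (β * a * Real.cos θ) ≤ 1 + c * (β * a) := by
    intro θ
    have h1 := (abs_le.1 (h.abs_sub_le (β * a * Real.cos θ) 0)).2
    rw [h.zero, sub_zero, abs_mul, abs_of_pos (mul_pos hβ ha)] at h1
    have : c * (β * a * |Real.cos θ|) ≤ c * (β * a) := by
      exact mul_le_mul_of_nonneg_left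
        (mul_le_of_le_one_right (by positivity) (Real.abs_cos_le_one θ)) hc
    linarith
  set n₁ := 1 + c * (β * a) with hn₁
  have hn₁0 : 0 < n₁ := by positivity
  refine ⟨Real.pi * (2 * E + 2 * E' + E ^ 2 / 2) + 8, ?_⟩
  filter_upwards [self_mem_nhdsWithin, eventually_mul_le 1 one_pos,
    eventually_mul_le k₀ (by norm_num : (0 : ℝ) < 1 / 6),
    eventually_mul_le (k₀ + E' + 8 * c * Λ) (by positivity : 0 < 1 / n₁)]
    with ρ (hρ : 0 < ρ) hρ1 hρ2 hρ3
  rw [one_mul] at hρ1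
  set k := radialSlope p a β q₁₁ q₁₂ q₂₂
  set D : ℝ → ℝ := fun θ => ν (β * a * Real.cos θ + Λ * ρ) + ν (β * a * Real.cos θ - Λ * ρ) -
    2 * ν (β * a * Real.cos θ) with hD
  have hD0 : ∀ θ, 0 ≤ D θ := fun θ => h.secondDiff_nonneg _ _
  have hD1 : ∀ θ, D θ ≤ 2 * c * (Λ * ρ) := fun θ => h.secondDiff_le _ (by positivity)
  have hk : ∀ θ, |k θ * ρ ^ 2 / ν (β * a * Real.cos θ) ^ 3| ≤ k₀ * ρ ^ 2 := by
    intro θ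
    have h1 : |k θ| ≤ k₀ := h.abs_radialSlope_le hβ θ
    have hp : 1 ≤ ν (β * a * Real.cos θ) ^ 3 := one_le_pow₀ (h.one_le _)
    rw [abs_div, abs_mul, abs_of_nonneg (sq_nonneg ρ),
      abs_of_pos (one_pos.trans_le hp)]
    exact (div_le_self (by positivity) hp).trans (by gcongr)
  have hy : ∀ θ, ρ / n₁ ≤ ρ / ν (β * a * Real.cos θ) := fun θ =>
    div_le_div_of_nonneg_left hρ.le (h.pos _) (hνb θ)
  have hy' : ∀ θ, ρ / ν (β * a * Real.cos θ) ≤ ρ := fun θ => div_le_self hρ.le (h.one_le _)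
  -- All subtracted corrections together stay below the leading term `ρ/n ≥ ρ/n₁`, so both radial
  -- functions are nonnegative.
  have hsmall : (k₀ + E' + 8 * c * Λ) * ρ * ρ ≤ 1 / n₁ * ρ := by gcongr
  have hρ32 : E' * ρ ^ 3 ≤ E' * ρ ^ 2 := by
    have : ρ ^ 3 ≤ ρ ^ 2 := pow_le_pow_of_le_one hρ.le hρ1 (by norm_num)
    gcongr
  have hE3 : 0 ≤ E * ρ ^ 3 := by positivity
  have hE3' : 0 ≤ E' * ρ ^ 3 := by positivity
  have hdiv : 1 / n₁ * ρ = ρ / n₁ := by ring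
  have hcΛ : 0 ≤ c * Λ * ρ ^ 2 := by positivity
  have hout0 : ∀ θ, 0 ≤ outerRadius ν p a β q₁₁ q₁₂ q₂₂ E ρ θ := by
    intro θ
    have h1 := (abs_le.1 (hk θ)).2
    have h2 := hy θ
    have h3 : 0 ≤ E' * ρ ^ 2 := by positivity
    rw [outerRadius]
    nlinarith
  have hin0 : ∀ θ, 0 ≤ innerRadius ν p a β q₁₁ q₁₂ q₂₂ E' Λ ρ θ := by
    intro θ
    have h1 := (abs_le.1 (hk θ)).1
    have h2 := hy θ
    have h3 : 4 * ρ * D θ ≤ 4 * ρ * (2 * c * (Λ * ρ)) := by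
      have := hD1 θ
      gcongr
    rw [innerRadius]
    change 0 ≤ _ + k θ * ρ ^ 2 / _ - (_ + 4 * ρ * D θ)
    nlinarith
  have hout := volume_real_polarRegion (h.measurable_outerRadius E) hout0
    (B := ρ + k₀ * ρ ^ 2 + E * ρ ^ 3) fun θ => by
      have h1 := (abs_le.1 (hk θ)).1
      have h2 := hy' θ
      rw [outerRadius]
      linarith
  have hin := volume_real_polarRegion (h.measurable_innerRadius E') hin0
    (B := ρ + k₀ * ρ ^ 2) fun θ => by
      have h1 := (abs_le.1 (hk θ)).2
      have h2 := hy' θ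
      have h3 : 0 ≤ 4 * ρ * D θ := mul_nonneg (by positivity) (hD0 θ)
      rw [innerRadius]
      change _ + k θ * ρ ^ 2 / _ - (_ + 4 * ρ * D θ) ≤ _
      linarith
  refine ⟨hout.1, hin.1, ?_⟩
  rw [hout.2, hin.2]
  have hi : ∀ {R : ℝ → ℝ}, Measurable R → (∀ θ, 0 ≤ R θ) → (∀ θ, R θ ≤ 2 * ρ + E * ρ ^ 3) →
      IntervalIntegrable (fun θ => R θ ^ 2 / 2) volume (-(Real.pi / 2)) (Real.pi / 2) := by
    intro R hR h0 hB
    refine (intervalIntegrable_const (c := (2 * ρ + E * ρ ^ 3) ^ 2 / 2)).mono_fun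
      ((hR.pow_const 2).div_const 2).aestronglyMeasurable (Eventually.of_forall fun θ => ?_)
    simp only [Real.norm_eq_abs]
    rw [abs_of_nonneg (by positivity : 0 ≤ R θ ^ 2 / 2),
      abs_of_nonneg (by positivity : 0 ≤ (2 * ρ + E * ρ ^ 3) ^ 2 / 2)]
    have := h0 θ
    have := hB θ
    gcongr
  have hkρ : k₀ * ρ ^ 2 ≤ ρ := by nlinarith
  have hi1 := hi (h.measurable_outerRadius (a := a) (β := β) (q₁₁ := q₁₁) (q₁₂ := q₁₂)
    (q₂₂ := q₂₂) (ρ := ρ) E) hout0 fun θ => by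
      have h1 := (abs_le.1 (hk θ)).1
      have h2 := hy' θ
      rw [outerRadius]
      linarith
  have hi2 := hi (h.measurable_innerRadius (a := a) (β := β) (q₁₁ := q₁₁) (q₁₂ := q₁₂)
    (q₂₂ := q₂₂) (ρ := ρ) (Λ := Λ) E') hin0 fun θ => by
      have h1 := (abs_le.1 (hk θ)).2
      have h2 := hy' θ
      have h3 : 0 ≤ 4 * ρ * D θ := mul_nonneg (by positivity) (hD0 θ)
      rw [innerRadius]
      change _ + k θ * ρ ^ 2 / _ - (_ + 4 * ρ * D θ) ≤ _
      linarith
  obtain ⟨hi3, hval⟩ := h.integral_radialSlope (q₁₁ := q₁₁) (q₁₂ := q₁₂) (q₂₂ := q₂₂) ha hβ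
  have hi4 := (h.continuous_secondDiff (β * a) (Λ * ρ)).intervalIntegrable (μ := volume)
    (-(Real.pi / 2)) (Real.pi / 2)
  rw [← intervalIntegral.integral_sub hi1 hi2]
  set C₀ := 2 * E + 2 * E' + E ^ 2 / 2
  have hmono := intervalIntegral.integral_mono_on hle (hi1.sub hi2)
    ((hi3.const_mul (-2 * ρ ^ 3)).add ((intervalIntegrable_const (c := C₀ * ρ ^ 4)).add
      (hi4.const_mul (8 * ρ ^ 2)))) fun θ _ =>
    half_sq_sub_half_sq_le (h.one_le (β * a * Real.cos θ)) (h.abs_radialSlope_le hβ θ) (hD0 θ)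
      hE hE' hρ.le hρ1 hρ2
  refine hmono.trans ?_
  rw [intervalIntegral.integral_add (hi3.const_mul _)
    ((intervalIntegrable_const (c := C₀ * ρ ^ 4)).add (hi4.const_mul (8 * ρ ^ 2))),
    intervalIntegral.integral_add intervalIntegrable_const (hi4.const_mul (8 * ρ ^ 2)),
    intervalIntegral.integral_const_mul (-2 * ρ ^ 3),
    intervalIntegral.integral_const_mul (8 * ρ ^ 2), hval,
    intervalIntegral.integral_const, smul_eq_mul]
  change _ + (_ + 8 * ρ ^ 2 * secondDiffIntegral ν (β * a) (Λ * ρ)) ≤ _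
  have hS := h.secondDiffIntegral_nonneg (β * a) (Λ * ρ)
  have hC₀ : 0 ≤ C₀ := by positivity
  have : 0 ≤ Real.pi * C₀ * (ρ ^ 2 * secondDiffIntegral ν (β * a) (Λ * ρ)) := by positivity
  have : 0 ≤ ρ ^ 4 := by positivity
  nlinarith

end ProfileSubgradient

/-- Near the level line `v.1` is of order `ρ²`, so only the tangential term of the quadratic form is
of order `ρ²`. -/
theorem abs_quadForm_sub_le {q₁₁ q₁₂ q₂₂ B ρ : ℝ} {v : ℝ × ℝ} (hρ0 : 0 ≤ ρ) (hρ1 : ρ ≤ 1)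
    (hB : 0 ≤ B) (h1 : |v.1| ≤ B * ρ ^ 2) (h2 : |v.2| ≤ ρ) :
    |quadForm q₁₁ q₁₂ q₂₂ v - q₂₂ * v.2 ^ 2| ≤
      (|q₁₁| + 2 * |q₁₂| + |q₂₂|) * (B ^ 2 + B) * ρ ^ 3 := by
  have e : quadForm q₁₁ q₁₂ q₂₂ v - q₂₂ * v.2 ^ 2 = q₁₁ * v.1 ^ 2 + 2 * q₁₂ * (v.1 * v.2) := by
    rw [quadForm]; ring
  have a1 : |v.1| ^ 2 ≤ (B ^ 2 + B) * ρ ^ 3 := by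
    calc |v.1| ^ 2 ≤ (B * ρ ^ 2) ^ 2 := by gcongr
      _ = B ^ 2 * ρ ^ 3 * ρ := by ring
      _ ≤ B ^ 2 * ρ ^ 3 * 1 := by gcongr
      _ ≤ _ := by nlinarith [pow_nonneg hρ0 3, mul_nonneg hB (pow_nonneg hρ0 3)]
  have a2 : |v.1| * |v.2| ≤ (B ^ 2 + B) * ρ ^ 3 := by
    calc |v.1| * |v.2| ≤ (B * ρ ^ 2) * ρ := by gcongr
      _ = B * ρ ^ 3 := by ring
      _ ≤ _ := by nlinarith [pow_nonneg hρ0 3, mul_nonneg (sq_nonneg B) (pow_nonneg hρ0 3)]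
  rw [e]
  calc |q₁₁ * v.1 ^ 2 + 2 * q₁₂ * (v.1 * v.2)| ≤ |q₁₁ * v.1 ^ 2| + |2 * q₁₂ * (v.1 * v.2)| :=
        abs_add_le _ _
    _ = |q₁₁| * |v.1| ^ 2 + 2 * |q₁₂| * (|v.1| * |v.2|) := by
      simp only [abs_mul, abs_pow, abs_two]
    _ ≤ |q₁₁| * ((B ^ 2 + B) * ρ ^ 3) + 2 * |q₁₂| * ((B ^ 2 + B) * ρ ^ 3) +
        |q₂₂| * ((B ^ 2 + B) * ρ ^ 3) := by
      have : 0 ≤ |q₂₂| * ((B ^ 2 + B) * ρ ^ 3) := by positivity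
      have : |q₁₁| * |v.1| ^ 2 ≤ |q₁₁| * ((B ^ 2 + B) * ρ ^ 3) := by gcongr
      have : 2 * |q₁₂| * (|v.1| * |v.2|) ≤ 2 * |q₁₂| * ((B ^ 2 + B) * ρ ^ 3) := by gcongr
      linarith
    _ = _ := by ring

namespace ProfileSubgradient

variable {ν p : ℝ → ℝ} {c a β q₁₁ q₁₂ q₂₂ K Λ ρ : ℝ} {A : Set (ℝ × ℝ)} {U : ℝ × ℝ → ℝ}

/-- Here `v` is almost tangential to the level line: the slope is small, and `v` is reached with
amoeba length `|v.2| + O(ρ²)`. The bound `C₁` absorbs this `O(ρ²)` through the reduced height `ρ -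
C₁ρ²`, and the cubic errors of the level line through the shift by `C₁ρ³`. -/
theorem mem_and_le_of_mem_rightStrip (h : ProfileSubgradient ν p c) (ha : 0 < a) (hβ : 0 < β)
    (hK : 0 ≤ K) (hΛ : 0 ≤ Λ) {m M B C₁ : ℝ} (hm : |m| ≤ M)
    (hB : (M + (|q₁₁| + 2 * |q₁₂| + |q₂₂|) + K) / a = B)
    (hC₁ : B + c * β * a * B + 2 * c * Λ + c * β * (|q₁₁| + 2 * |q₁₂| + |q₂₂| + K) ≤ C₁)
    (hC₁' : (|q₁₁| + 2 * |q₁₂| + |q₂₂|) * (B ^ 2 + B) + K ≤ a * C₁)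
    (hρ0 : 0 < ρ) (hρ1 : ρ ≤ 1) (hA : LocalAmoeba ν p a β q₁₁ q₁₂ q₂₂ K Λ ρ A U) {v : ℝ × ℝ}
    (hv : v ∈ rightStrip (ρ - C₁ * ρ ^ 2)
      fun y => (ρ ^ 2 * m - q₂₂ * y ^ 2 / 2) / a - C₁ * ρ ^ 3) :
    v ∈ A ∧ U v ≤ ρ ^ 2 * m := by
  obtain ⟨⟨hb1, hb2⟩, hv1, hv2⟩ := hv
  set Q := |q₁₁| + 2 * |q₁₂| + |q₂₂| with hQ
  have hc := h.c_nonneg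
  have hQ0 : 0 ≤ Q := by positivity
  have hM : 0 ≤ M := (abs_nonneg m).trans hm
  have hB0 : 0 ≤ B := by rw [← hB]; positivity
  have hBa : B * a = M + Q + K := by rw [← hB]; field_simp
  have hC₁B : B ≤ C₁ := by
    have : 0 ≤ c * β * a * B + 2 * c * Λ + c * β * (Q + K) := by positivity
    linarith
  have hC₁0 : 0 ≤ C₁ := hB0.trans hC₁B
  have hy : |v.2| ≤ ρ - C₁ * ρ ^ 2 := abs_le.2 ⟨hb1, hb2⟩
  have hyρ : |v.2| ≤ ρ := hy.trans (by nlinarith [mul_nonneg hC₁0 (sq_nonneg ρ)])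
  have hq₂ : |q₂₂| ≤ Q := by rw [hQ]; linarith [abs_nonneg q₁₁, abs_nonneg q₁₂]
  have hav : a * v.1 ≤ ρ ^ 2 * m - q₂₂ * v.2 ^ 2 / 2 - a * C₁ * ρ ^ 3 := by
    have := mul_le_mul_of_nonneg_left hv2 ha.le
    have e : a * ((ρ ^ 2 * m - q₂₂ * v.2 ^ 2 / 2) / a - C₁ * ρ ^ 3) =
      ρ ^ 2 * m - q₂₂ * v.2 ^ 2 / 2 - a * C₁ * ρ ^ 3 := by field_simp
    linarith
  have hv1B : v.1 ≤ B * ρ ^ 2 := by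
    have h1 : ρ ^ 2 * m ≤ ρ ^ 2 * M := by gcongr; exact (le_abs_self m).trans hm
    have h2 : -q₂₂ * v.2 ^ 2 ≤ Q * ρ ^ 2 := by
      have : v.2 ^ 2 ≤ ρ ^ 2 := by rw [← sq_abs]; gcongr
      have : -q₂₂ ≤ Q := (neg_le_abs _).trans hq₂
      gcongr
    have h3 : 0 ≤ a * C₁ * ρ ^ 3 := by positivity
    have h4 : a * v.1 ≤ a * (B * ρ ^ 2) := by
      have : a * (B * ρ ^ 2) = (M + Q + K) * ρ ^ 2 := by rw [← hBa]; ring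
      rw [this]
      nlinarith [mul_nonneg hK (sq_nonneg ρ), mul_nonneg hQ0 (sq_nonneg ρ)]
    exact le_of_mul_le_mul_left h4 ha
  have habs1 : |v.1| ≤ B * ρ ^ 2 := by rwa [abs_of_pos hv1]
  have hr1 : radius v ≤ ρ + B * ρ ^ 2 - C₁ * ρ ^ 2 := by linarith [radius_le v]
  have hrρ : radius v ≤ ρ := hr1.trans (by nlinarith [sq_nonneg ρ])
  have hr0 : 0 < radius v := hv1.trans_le ((le_abs_self _).trans (abs_fst_le_radius v))
  have ht := hA.taylor v (by linarith)
  have hr3 : radius v ^ 3 ≤ ρ ^ 3 := by gcongr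
  have hr2 : radius v ^ 2 ≤ ρ ^ 2 := by gcongr
  have hρ32 : ρ ^ 3 ≤ ρ ^ 2 := pow_le_pow_of_le_one hρ0.le hρ1 (by norm_num)
  constructor
  · set x := β * a * v.1 / radius v with hx
    have hxr : x * radius v = β * a * v.1 := by rw [hx]; field_simp
    refine hA.inner v (fun h0 => ?_) (by linarith) x hxr ?_
    · rw [h0] at hv1
      exact lt_irrefl _ hv1
    have hx0 : 0 ≤ x := by positivity
    have b1 : radius v * ν x ≤ radius v + c * (β * a * v.1) := by
      have h1 := (abs_le.1 (h.abs_sub_le x 0)).2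
      rw [h.zero, sub_zero, abs_of_nonneg hx0] at h1
      have h2 := mul_le_mul_of_nonneg_left h1 hr0.le
      have : radius v * (c * x) = c * (β * a * v.1) := by rw [← hxr]; ring
      linarith
    have b2 : radius v * (ν (x + Λ * ρ) + ν (x - Λ * ρ) - 2 * ν x) ≤ ρ * (2 * c * (Λ * ρ)) := by
      have := h.secondDiff_le x (by positivity : 0 ≤ Λ * ρ)
      have := h.secondDiff_nonneg x (Λ * ρ)
      gcongr
    have b3 : |β * U v - x * radius v| ≤ β * ((Q + K) * ρ ^ 2) := by
      have e : β * U v - x * radius v = β * (U v - (a * v.1 + quadForm q₁₁ q₁₂ q₂₂ v / 2) +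
        quadForm q₁₁ q₁₂ q₂₂ v / 2) := by rw [hxr]; ring
      rw [e, abs_mul, abs_of_pos hβ]
      have hq := abs_quadForm_le q₁₁ q₁₂ q₂₂ v
      have h1 : |quadForm q₁₁ q₁₂ q₂₂ v / 2| ≤ Q * ρ ^ 2 := by
        rw [abs_div, abs_two]
        have : Q * radius v ^ 2 ≤ Q * ρ ^ 2 := by gcongr
        have := abs_nonneg (quadForm q₁₁ q₁₂ q₂₂ v)
        linarith
      have h2 : K * radius v ^ 3 ≤ K * ρ ^ 2 := by gcongr; exact hr3.trans hρ32
      have h3 := abs_add_le (U v - (a * v.1 + quadForm q₁₁ q₁₂ q₂₂ v / 2))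
        (quadForm q₁₁ q₁₂ q₂₂ v / 2)
      gcongr
      linarith
    have b4 : p x * (β * U v - x * radius v) ≤ c * (β * ((Q + K) * ρ ^ 2)) := by
      refine (le_abs_self _).trans ?_
      rw [abs_mul]
      have := h.bound x
      gcongr
    have b5 : c * (β * a * v.1) ≤ c * (β * a * (B * ρ ^ 2)) := by gcongr
    have b6 := mul_le_mul_of_nonneg_right hC₁ (sq_nonneg ρ)
    rw [mul_add]
    linarith
  · have hq := (abs_le.1 (abs_quadForm_sub_le (q₁₁ := q₁₁) (q₁₂ := q₁₂) (q₂₂ := q₂₂)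
      hρ0.le hρ1 hB0 habs1 hyρ)).2
    have h2 : K * radius v ^ 3 ≤ K * ρ ^ 3 := by gcongr
    have h3 := (abs_le.1 ht).2
    have h4 := mul_le_mul_of_nonneg_right hC₁' (pow_pos hρ0 3).le
    have h5 : 0 ≤ Q * (B ^ 2 + B) * ρ ^ 3 := by positivity
    rw [← hQ] at hq
    linarith

/-- The Taylor expansion is used twice: a crude estimate first gives `|v.1| ≤ B ρ²`, with which the
mixed and normal quadratic terms become cubic errors. -/
theorem mem_leftStrip (h : ProfileSubgradient ν p c) (ha : 0 < a)
    (hK : 0 ≤ K) {m M B C₁ : ℝ} (hm : |m| ≤ M)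
    (hB : (M + (|q₁₁| + 2 * |q₁₂| + |q₂₂|) + K) / a = B)
    (hC₁' : (|q₁₁| + 2 * |q₁₂| + |q₂₂|) * (B ^ 2 + B) + K ≤ a * C₁)
    (hρ0 : 0 < ρ) (hρ1 : ρ ≤ 1) (hA : LocalAmoeba ν p a β q₁₁ q₁₂ q₂₂ K Λ ρ A U) {v : ℝ × ℝ}
    (hv : v ∈ A) (hv0 : v.1 ≤ 0) (hU : ρ ^ 2 * m < U v) :
    v ∈ leftStrip ρ fun y => C₁ * ρ ^ 3 - (ρ ^ 2 * m - q₂₂ * y ^ 2 / 2) / a := by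
  set Q := |q₁₁| + 2 * |q₁₂| + |q₂₂| with hQ
  have hQ0 : 0 ≤ Q := by positivity
  have hM : 0 ≤ M := (abs_nonneg m).trans hm
  have hB0 : 0 ≤ B := by rw [← hB]; positivity
  have hBa : B * a = M + Q + K := by rw [← hB]; field_simp
  have hrρ := h.radius_le_of_mem hA hv
  have hr0 := radius_nonneg v
  have hy : |v.2| ≤ ρ := (abs_snd_le_radius v).trans hrρ
  have ht := (abs_le.1 (hA.taylor v (by linarith))).2
  have hr3 : radius v ^ 3 ≤ ρ ^ 3 := by gcongr
  have hr2 : radius v ^ 2 ≤ ρ ^ 2 := by gcongr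
  have hρ32 : ρ ^ 3 ≤ ρ ^ 2 := pow_le_pow_of_le_one hρ0.le hρ1 (by norm_num)
  have hK3 : K * radius v ^ 3 ≤ K * ρ ^ 3 := by gcongr
  have hK2 : K * ρ ^ 3 ≤ K * ρ ^ 2 := by gcongr
  have hq := (abs_le.1 (abs_quadForm_le q₁₁ q₁₂ q₂₂ v)).2
  rw [← hQ] at hq
  have hQ2 : Q * radius v ^ 2 ≤ Q * ρ ^ 2 := by gcongr
  have hav : -(a * v.1) ≤ a * (B * ρ ^ 2) := by
    have e : a * (B * ρ ^ 2) = (M + Q + K) * ρ ^ 2 := by rw [← hBa]; ring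
    have h1 : -M * ρ ^ 2 ≤ m * ρ ^ 2 := by gcongr; exact (abs_le.1 hm).1
    have h2 : 0 ≤ Q * ρ ^ 2 := by positivity
    rw [e]
    linarith
  have habs1 : |v.1| ≤ B * ρ ^ 2 := by
    rw [abs_of_nonpos hv0]
    exact le_of_mul_le_mul_left (by linarith) ha
  have hq2 := (abs_le.1 (abs_quadForm_sub_le (q₁₁ := q₁₁) (q₁₂ := q₁₂) (q₂₂ := q₂₂)
    hρ0.le hρ1 hB0 habs1 hy)).2
  rw [← hQ] at hq2
  have h4 := mul_le_mul_of_nonneg_right hC₁' (pow_pos hρ0 3).le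
  have h5 : 0 ≤ Q * (B ^ 2 + B) * ρ ^ 3 := by positivity
  refine ⟨abs_le.1 hy, ?_, hv0⟩
  refine le_of_mul_le_mul_left ?_ ha
  have e : a * -(C₁ * ρ ^ 3 - (ρ ^ 2 * m - q₂₂ * v.2 ^ 2 / 2) / a) =
      ρ ^ 2 * m - q₂₂ * v.2 ^ 2 / 2 - a * C₁ * ρ ^ 3 := by field_simp; ring
  rw [e]
  linarith

/-- If `m` exceeds the expected value of the median of `U / ρ²`, less than half of the area of the
amoeba lies above the level `ρ² m`. -/
theorem exists_volume_lt (h : ProfileSubgradient ν p c) (ha : 0 < a) (hβ : 0 < β) (hK : 0 ≤ K)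
    (hΛ : 0 ≤ Λ) {M : ℝ} (hM : 0 ≤ M) :
    ∃ C, ∀ᶠ ρ in 𝓝[>] (0 : ℝ), ∀ A U, LocalAmoeba ν p a β q₁₁ q₁₂ q₂₂ K Λ ρ A U →
      ∀ m, |m| ≤ M → C * (ρ ^ 4 + ρ ^ 2 * secondDiffIntegral ν (β * a) (Λ * ρ)) <
        ρ ^ 3 * (2 * ((2 * m - q₂₂ / 3) / a) +
          β * (q₁₁ * amoebaJ3 ν (β * a) + q₂₂ * amoebaJ1 ν (β * a))) →
      volume (A ∩ {v | ρ ^ 2 * m < U v}) < volume (A ∩ {v | U v ≤ ρ ^ 2 * m}) := by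
  have hc := h.c_nonneg
  set Q := |q₁₁| + 2 * |q₁₂| + |q₂₂| with hQ
  have hQ0 : 0 ≤ Q := by positivity
  obtain ⟨B, hB⟩ : ∃ B, (M + Q + K) / a = B := ⟨_, rfl⟩
  have hB0 : 0 ≤ B := by rw [← hB]; positivity
  set X := B + c * β * a * B + 2 * c * Λ + c * β * (Q + K) with hX
  set Y := Q * (B ^ 2 + B) + K with hY
  have hX0 : 0 ≤ X := by positivity
  have hY0 : 0 ≤ Y := by positivity
  obtain ⟨C₁, hC₁⟩ : ∃ C₁, X + Y / a = C₁ := ⟨_, rfl⟩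
  have hC₁0 : 0 ≤ C₁ := by rw [← hC₁]; positivity
  have hXC : X ≤ C₁ := by rw [← hC₁]; linarith [div_nonneg hY0 ha.le]
  have hYC : Y ≤ a * C₁ := by
    rw [← hC₁, mul_add, mul_div_cancel₀ _ ha.ne']
    nlinarith
  obtain ⟨Cs, hs⟩ := exists_strip_area ha q₂₂ M C₁ hC₁0
  obtain ⟨Ch, hh⟩ := h.exists_half_area (q₁₁ := q₁₁) (q₁₂ := q₁₂) (q₂₂ := q₂₂) ha hβ hΛ
    (E := 2 * (c * β * K + 3 * (c * (β / 2 * Q)) ^ 2)) (E' := 16 * (c * β * K))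
    (by positivity) (by positivity)
  refine ⟨Ch + 2 * |Cs|, ?_⟩
  filter_upwards [self_mem_nhdsWithin, eventually_mul_le 1 one_pos,
    eventually_mul_le (c * (β / 2 * Q)) (by norm_num : (0 : ℝ) < 1 / 6),
    eventually_mul_le C₁ one_pos, hs, hh]
    with ρ (hρ : 0 < ρ) hρ1 hρ2 hρ3 hs hh A U hA m hm hlt
  rw [one_mul] at hρ1
  specialize hs m hm
  obtain ⟨hP, hL, hPL⟩ := hh
  set P := polarRegion (outerRadius ν p a β q₁₁ q₁₂ q₂₂
    (2 * (c * β * K + 3 * (c * (β / 2 * Q)) ^ 2)) ρ) with hPdef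
  set L := polarRegion (innerRadius ν p a β q₁₁ q₁₂ q₂₂ (16 * (c * β * K)) Λ ρ) with hLdef
  have hg1 : Continuous fun y => (ρ ^ 2 * m - q₂₂ * y ^ 2 / 2) / a - C₁ * ρ ^ 3 := by fun_prop
  have hg2 : Continuous fun y => C₁ * ρ ^ 3 - (ρ ^ 2 * m - q₂₂ * y ^ 2 / 2) / a := by fun_prop
  set S₁ := rightStrip (ρ - C₁ * ρ ^ 2)
    fun y => (ρ ^ 2 * m - q₂₂ * y ^ 2 / 2) / a - C₁ * ρ ^ 3 with hS₁
  set S₂ := leftStrip ρ fun y => C₁ * ρ ^ 3 - (ρ ^ 2 * m - q₂₂ * y ^ 2 / 2) / a with hS₂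
  have hb : 0 ≤ ρ - C₁ * ρ ^ 2 := by nlinarith
  have hS₁f : volume S₁ ≠ ⊤ := (volume_real_rightStrip hb hg1).1
  have hS₂f : volume S₂ ≠ ⊤ := (volume_real_leftStrip hρ.le hg2).1
  have hS₁m : MeasurableSet S₁ := measurableSet_rightStrip hg1
  have hS₁A : ∀ v ∈ S₁, v ∈ A ∧ U v ≤ ρ ^ 2 * m := fun v hv =>
    h.mem_and_le_of_mem_rightStrip ha hβ hK hΛ hm hB hXC hYC hρ hρ1 hA hv
  have hS₂A : ∀ v ∈ A, v.1 ≤ 0 → ρ ^ 2 * m < U v → v ∈ S₂ := fun v hv hv0 hU =>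
    h.mem_leftStrip ha hK hm hB hYC hρ hρ1 hA hv hv0 hU
  have hPA : ∀ v ∈ A, 0 < v.1 → v ∈ P := fun v hv hv0 =>
    h.mem_polarRegion_outerRadius hβ hK hρ2 hA hv hv0
  have hLA : ∀ v ∈ L, -v ∈ A := fun v hv =>
    h.neg_mem_of_mem_polarRegion_innerRadius hβ hK hρ.le hρ2 hA hv
  set N : Set (ℝ × ℝ) := Neg.neg ⁻¹' L with hN
  have hNvol : volume N = volume L := (Measure.measurePreserving_neg volume).measure_preimage
    (measurableSet_polarRegion (h.measurable_innerRadius _)).nullMeasurableSet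
  have hNr : volume.real N = volume.real L := by rw [Measure.real, hNvol, Measure.real]
  -- With `N` the inner left half, the two inclusions bound the area above the level by `|P| - |S₁|
  -- + |S₂|` and the area below it from below by `|N| - |S₂| + |S₁|`. It remains to compare `|P| -
  -- |N|` with `2(|S₁| - |S₂|)`; measurability of `A` plays no role.
  have hsub1 : A ∩ {v | ρ ^ 2 * m < U v} ⊆ (P \ S₁) ∪ S₂ := by
    rintro v ⟨hv, hU⟩
    rcases lt_or_ge 0 v.1 with h0 | h0
    · exact Or.inl ⟨hPA v hv h0, fun hS => not_lt.2 (hS₁A v hS).2 hU⟩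
    · exact Or.inr (hS₂A v hv h0 hU)
  have hsub2 : (N \ S₂) ∪ S₁ ⊆ A ∩ {v | U v ≤ ρ ^ 2 * m} := by
    rintro v (⟨hv, hvS⟩ | hv)
    · have hvA : v ∈ A := by simpa using hLA (-v) hv
      have hv0 : v.1 ≤ 0 := by
        have : 0 < (-v).1 := hv.1
        rw [Prod.fst_neg] at this
        linarith
      refine ⟨hvA, ?_⟩
      by_contra hU
      exact hvS (hS₂A v hvA hv0 (not_le.1 hU))
    · exact hS₁A v hv
  have hS₁P : S₁ ⊆ P := fun v hv => hPA v (hS₁A v hv).1 hv.2.1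
  have hdisj : Disjoint (N \ S₂) S₁ := by
    rw [Set.disjoint_left]
    rintro v ⟨hv, -⟩ hvS
    have h1 : 0 < (-v).1 := hv.1
    have h2 : 0 < v.1 := hvS.2.1
    rw [Prod.fst_neg] at h1
    linarith
  have hNf : volume N ≠ ⊤ := by rwa [hNvol]
  have hf1 : volume ((P \ S₁) ∪ S₂) ≠ ⊤ :=
    measure_union_ne_top (measure_ne_top_of_subset sdiff_subset hP) hS₂f
  have hf2 : volume ((N \ S₂) ∪ S₁) ≠ ⊤ :=
    measure_union_ne_top (measure_ne_top_of_subset sdiff_subset hNf) hS₁f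
  have hr1 : volume.real ((P \ S₁) ∪ S₂) ≤ volume.real P - volume.real S₁ + volume.real S₂ := by
    refine (measureReal_union_le _ _).trans ?_
    rw [measureReal_sdiff hS₁P hS₁m hP]
  have hr2 : volume.real N - volume.real S₂ + volume.real S₁ ≤ volume.real ((N \ S₂) ∪ S₁) := by
    rw [measureReal_union hdisj hS₁m (measure_ne_top_of_subset sdiff_subset hNf) hS₁f]
    have := le_measureReal_sdiff (μ := volume) (s₁ := N) (s₂ := S₂) hS₂f
    linarith
  refine (measure_mono hsub1).trans_lt (lt_of_lt_of_le ?_ (measure_mono hsub2))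
  rw [← ENNReal.toReal_lt_toReal hf1 hf2]
  refine hr1.trans_lt (lt_of_lt_of_le ?_ hr2)
  rw [hNr]
  have hS := h.secondDiffIntegral_nonneg (β * a) (Λ * ρ)
  have hCs : Cs * ρ ^ 4 ≤ |Cs| * (ρ ^ 4 + ρ ^ 2 * secondDiffIntegral ν (β * a) (Λ * ρ)) := by
    have h1 : Cs * ρ ^ 4 ≤ |Cs| * ρ ^ 4 := by gcongr; exact le_abs_self Cs
    have h2 : 0 ≤ |Cs| * (ρ ^ 2 * secondDiffIntegral ν (β * a) (Λ * ρ)) := by positivity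
    linarith
  nlinarith

end ProfileSubgradient

/-! ### Taylor expansion, gauge coordinates and the self-snakes operator -/

theorem inner_gradient_eq {u : Plane → ℝ} {x v : Plane} :
    inner ℝ (gradient u x) v = fderiv ℝ u x v := by
  rw [gradient, InnerProductSpace.toDual_symm_apply]

theorem contDiffAt_gradient {u : Plane → ℝ} {x : Plane} (hu : ContDiffAt ℝ 3 u x) :
    ContDiffAt ℝ 2 (gradient u) x := by
  rw [contDiffAt_euclidean]
  intro i
  have h1 : ContDiffAt ℝ 2 (fderiv ℝ u) x := hu.fderiv_right (by norm_num)
  have h2 : (fun y => gradient u y i) =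
      fun y => fderiv ℝ u y (EuclideanSpace.single i (1 : ℝ)) := by
    funext y
    rw [← inner_gradient_eq, EuclideanSpace.inner_single_right]
    simp
  rw [h2]
  exact h1.clm_apply contDiffAt_const

/-- Second order expansion of an image along segments. -/
theorem exists_taylor {u : Plane → ℝ} {x₀ : Plane} (hu : ContDiffAt ℝ 3 u x₀) :
    ∃ K δ : ℝ, 0 ≤ K ∧ 0 < δ ∧ ∀ v : Plane, ‖v‖ < δ →
      (∀ t ∈ Icc (0 : ℝ) 1,
        |deriv (fun t : ℝ => u (x₀ + t • v)) t - inner ℝ (gradient u x₀) v| ≤ K * ‖v‖ ^ 2) ∧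
      |u (x₀ + v) - u x₀ - (inner ℝ (gradient u x₀) v +
        inner ℝ (fderiv ℝ (gradient u) x₀ v) v / 2)| ≤ K * ‖v‖ ^ 3 := by
  set G := gradient u with hG
  set H := fderiv ℝ G x₀ with hH
  have hGc : ContDiffAt ℝ 2 G x₀ := contDiffAt_gradient hu
  have hHc : ContDiffAt ℝ 1 (fderiv ℝ G) x₀ := hGc.fderiv_right (by norm_num)
  obtain ⟨K₀, s, hs, hK₀⟩ := hHc.exists_lipschitzOnWith
  have hdu : ∀ᶠ y in 𝓝 x₀, DifferentiableAt ℝ u y := by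
    filter_upwards [hu.eventually (by simp)] with y hy
    exact hy.differentiableAt (by norm_num)
  have hdG : ∀ᶠ y in 𝓝 x₀, DifferentiableAt ℝ G y := by
    filter_upwards [hGc.eventually (by simp)] with y hy
    exact hy.differentiableAt (by norm_num)
  obtain ⟨δ, hδ, hball⟩ := Metric.eventually_nhds_iff_ball.1
    ((hdu.and hdG).and (Filter.eventually_mem_set.2 hs))
  have hx₀s : x₀ ∈ s := mem_of_mem_nhds hs
  have hstep : ∀ v : Plane, ‖v‖ < δ → ‖G (x₀ + v) - G x₀ - H v‖ ≤ K₀ * ‖v‖ ^ 2 := by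
    intro v hv
    have hsub : Metric.closedBall x₀ ‖v‖ ⊆ Metric.ball x₀ δ := Metric.closedBall_subset_ball hv
    have key := (convex_closedBall x₀ ‖v‖).norm_image_sub_le_of_norm_hasFDerivWithin_le'
      (f := G) (f' := fderiv ℝ G) (φ := H) (C := K₀ * ‖v‖) (x := x₀) (y := x₀ + v)
      (fun y hy => (hball y (hsub hy)).1.2.hasFDerivAt.hasFDerivWithinAt)
      (fun y hy => by
        have h1 := hK₀.dist_le_mul y (hball y (hsub hy)).2 x₀ hx₀s
        rw [dist_eq_norm] at h1
        exact h1.trans (mul_le_mul_of_nonneg_left (Metric.mem_closedBall.1 hy) K₀.2))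
      (Metric.mem_closedBall_self (norm_nonneg v)) (by simp)
    rw [add_sub_cancel_left] at key
    refine key.trans (le_of_eq (by ring))
  have hline : ∀ v : Plane, ‖v‖ < δ → ∀ t ∈ Icc (0 : ℝ) 1,
      ‖t • v‖ < δ ∧ HasDerivAt (fun t : ℝ => u (x₀ + t • v)) (inner ℝ (G (x₀ + t • v)) v) t := by
    intro v hv t ht
    have h1 : ‖t • v‖ < δ := by
      rw [norm_smul, Real.norm_eq_abs, abs_of_nonneg ht.1]
      exact (mul_le_of_le_one_left (norm_nonneg v) ht.2).trans_lt hv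
    refine ⟨h1, ?_⟩
    have h2 : DifferentiableAt ℝ u (x₀ + t • v) := (hball _ (by simpa using h1)).1.1
    have h3 : HasDerivAt (fun t : ℝ => x₀ + t • v) ((1 : ℝ) • v) t :=
      ((hasDerivAt_id t).smul_const v).const_add x₀
    rw [one_smul] at h3
    have h4 := h2.hasFDerivAt.comp_hasDerivAt t h3
    rwa [← inner_gradient_eq] at h4
  refine ⟨K₀ * δ + ‖H‖ + K₀, δ, by positivity, hδ, fun v hv => ⟨fun t ht => ?_, ?_⟩⟩
  · obtain ⟨h1, h2⟩ := hline v hv t ht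
    rw [h2.deriv, ← inner_sub_left]
    have h3 := hstep _ h1
    have htv : ‖t • v‖ ≤ ‖v‖ := by
      rw [norm_smul, Real.norm_eq_abs, abs_of_nonneg ht.1]
      exact mul_le_of_le_one_left (norm_nonneg v) ht.2
    have h4 : ‖G (x₀ + t • v) - G x₀‖ ≤ (K₀ * δ + ‖H‖) * ‖v‖ := by
      have e : G (x₀ + t • v) - G x₀ = (G (x₀ + t • v) - G x₀ - H (t • v)) + H (t • v) := by abel
      rw [e]
      refine (norm_add_le _ _).trans ?_
      have h5 : ‖H (t • v)‖ ≤ ‖H‖ * ‖v‖ := (H.le_opNorm _).trans (by gcongr)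
      have h6 : (K₀ : ℝ) * ‖t • v‖ ^ 2 ≤ K₀ * δ * ‖v‖ := by
        rw [sq, ← mul_assoc]
        gcongr
      linarith
    calc |inner ℝ (G (x₀ + t • v) - G x₀) v| ≤ ‖G (x₀ + t • v) - G x₀‖ * ‖v‖ :=
          abs_real_inner_le_norm _ _
      _ ≤ (K₀ * δ + ‖H‖) * ‖v‖ * ‖v‖ := by gcongr
      _ ≤ _ := by nlinarith [mul_nonneg K₀.2 (sq_nonneg ‖v‖)]
  · have key := (convex_Icc (0 : ℝ) 1).norm_image_sub_le_of_norm_hasDerivWithin_le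
      (f := fun t : ℝ => u (x₀ + t • v) - (t * inner ℝ (G x₀) v + t ^ 2 / 2 * inner ℝ (H v) v))
      (f' := fun t => inner ℝ (G (x₀ + t • v)) v - (inner ℝ (G x₀) v + t * inner ℝ (H v) v))
      (C := K₀ * ‖v‖ ^ 3) (x := 0) (y := 1) (fun t ht => ?_) (fun t ht => ?_) (by simp) (by simp)
    · simp only [one_smul, zero_smul, add_zero, one_mul, zero_mul, one_pow, Real.norm_eq_abs,
        sub_zero, abs_one, mul_one] at key
      have e : u (x₀ + v) - (inner ℝ (G x₀) v + 1 / 2 * inner ℝ (H v) v) -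
          (u x₀ - (0 ^ 2 / 2 * inner ℝ (H v) v)) =
          u (x₀ + v) - u x₀ - (inner ℝ (G x₀) v + inner ℝ (H v) v / 2) := by ring
      rw [zero_add, e] at key
      refine key.trans ?_
      have : 0 ≤ K₀ * δ + ‖H‖ := by positivity
      gcongr
      linarith
    · have h2 := (hline v hv t ht).2
      have h3 : HasDerivAt (fun t : ℝ => t * inner ℝ (G x₀) v + t ^ 2 / 2 * inner ℝ (H v) v)
          (inner ℝ (G x₀) v + t * inner ℝ (H v) v) t := by
        have := ((hasDerivAt_id t).mul_const (inner ℝ (G x₀) v)).add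
          (((hasDerivAt_pow 2 t).div_const 2).mul_const (inner ℝ (H v) v))
        refine this.congr_deriv ?_
        simp
      exact (h2.sub h3).hasDerivWithinAt
    · have h3 := hstep _ (hline v hv t ht).1
      have e : inner ℝ (G (x₀ + t • v)) v - (inner ℝ (G x₀) v + t * inner ℝ (H v) v) =
          inner ℝ (G (x₀ + t • v) - G x₀ - H (t • v)) v := by
        rw [map_smul, inner_sub_left, inner_sub_left, real_inner_smul_left]
        ring
      rw [e, Real.norm_eq_abs]
      have htv : ‖t • v‖ ≤ ‖v‖ := by
        rw [norm_smul, Real.norm_eq_abs, abs_of_nonneg ht.1]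
        exact mul_le_of_le_one_left (norm_nonneg v) ht.2
      calc |inner ℝ (G (x₀ + t • v) - G x₀ - H (t • v)) v|
          ≤ ‖G (x₀ + t • v) - G x₀ - H (t • v)‖ * ‖v‖ := abs_real_inner_le_norm _ _
        _ ≤ K₀ * ‖v‖ ^ 2 * ‖v‖ := by
          gcongr
          exact h3.trans (by gcongr)
        _ = _ := by ring

theorem exists_orthonormalBasis_fst {w : Plane} (hw : w ≠ 0) :
    ∃ b : OrthonormalBasis (Fin 2) ℝ Plane, w = ‖w‖ • b 0 := by
  have hn : ‖w‖ ≠ 0 := norm_ne_zero_iff.2 hw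
  obtain ⟨b, hb⟩ := Orthonormal.exists_orthonormalBasis_extension_of_card_eq (𝕜 := ℝ) (E := Plane)
    (ι := Fin 2) (by simp) (v := fun _ => ‖w‖⁻¹ • w) (s := {0}) (by
      rw [orthonormal_iff_ite]
      rintro ⟨i, rfl⟩ ⟨j, rfl⟩
      simp only [if_true, Set.domRestrict_apply]
      rw [real_inner_self_eq_norm_sq, norm_smul, norm_inv, norm_norm, inv_mul_cancel₀ hn, one_pow])
  refine ⟨b, ?_⟩
  rw [hb 0 rfl, smul_smul, mul_inv_cancel₀ hn, one_smul]

theorem exists_measurePreserving_coordinates (b : OrthonormalBasis (Fin 2) ℝ Plane) (x₀ : Plane) :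
    ∃ Φ : (ℝ × ℝ) ≃ᵐ Plane, MeasurePreserving Φ volume volume ∧
      ∀ v, Φ v = x₀ + (v.1 • b 0 + v.2 • b 1) := by
  let e1 : (ℝ × ℝ) ≃ᵐ (Fin 2 → ℝ) := MeasurableEquiv.finTwoArrow.symm
  let e2 : (Fin 2 → ℝ) ≃ᵐ Plane := MeasurableEquiv.toLp 2 (Fin 2 → ℝ)
  let e3 : Plane ≃ᵐ Plane := b.repr.symm.toHomeomorph.toMeasurableEquiv
  let e4 : Plane ≃ᵐ Plane := MeasurableEquiv.addLeft x₀
  have h1 : MeasurePreserving e1 volume volume := (volume_preserving_finTwoArrow ℝ).symm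
  have h2 : MeasurePreserving e2 volume volume :=
    (EuclideanSpace.volume_preserving_symm_measurableEquiv_toLp (Fin 2)).symm
  have h3 : MeasurePreserving e3 volume volume := b.repr.symm.measurePreserving
  have h4 : MeasurePreserving e4 volume volume := measurePreserving_add_left volume x₀
  refine ⟨((e1.trans e2).trans e3).trans e4, h4.comp (h3.comp (h2.comp h1)), fun v => ?_⟩
  change x₀ + b.repr.symm (WithLp.toLp 2 ![v.1, v.2]) = _
  rw [← b.sum_repr (b.repr.symm _)]
  simp

theorem norm_coordinates (b : OrthonormalBasis (Fin 2) ℝ Plane) (v : ℝ × ℝ) :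
    ‖v.1 • b 0 + v.2 • b 1‖ = radius v := by
  have h00 : inner ℝ (b 0) (b 0) = 1 := by rw [real_inner_self_eq_norm_sq]; simp
  have h11 : inner ℝ (b 1) (b 1) = 1 := by rw [real_inner_self_eq_norm_sq]; simp
  have h01 : inner ℝ (b 0) (b 1) = 0 := b.orthonormal.2 (by simp)
  have h10 : inner ℝ (b 1) (b 0) = 0 := b.orthonormal.2 (by simp)
  rw [radius, eq_comm, Real.sqrt_eq_iff_mul_self_eq (by positivity) (norm_nonneg _),
    ← real_inner_self_eq_norm_mul_norm]
  simp only [inner_add_left, inner_add_right, real_inner_smul_left, real_inner_smul_right, h00,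
    h11, h01, h10]
  ring

theorem inner_coordinates (b : OrthonormalBasis (Fin 2) ℝ Plane) (H : Plane →L[ℝ] Plane)
    (v : ℝ × ℝ) :
    inner ℝ (H (v.1 • b 0 + v.2 • b 1)) (v.1 • b 0 + v.2 • b 1) =
      quadForm (inner ℝ (b 0) (H (b 0)))
        ((inner ℝ (b 0) (H (b 1)) + inner ℝ (b 1) (H (b 0))) / 2) (inner ℝ (b 1) (H (b 1))) v := by
  rw [quadForm]
  simp only [map_add, map_smul, inner_add_left, inner_add_right, real_inner_smul_left,
    real_inner_smul_right]
  rw [real_inner_comm (b 0) (H (b 0)), real_inner_comm (b 1) (H (b 0)),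
    real_inner_comm (b 0) (H (b 1)), real_inner_comm (b 1) (H (b 1))]
  ring

theorem divergence_eq_sum_inner (F : Plane → Plane) (x : Plane)
    (b : OrthonormalBasis (Fin 2) ℝ Plane) :
    divergence F x = inner ℝ (b 0) (fderiv ℝ F x (b 0)) + inner ℝ (b 1) (fderiv ℝ F x (b 1)) := by
  have h1 := LinearMap.trace_eq_sum_inner (fderiv ℝ F x : Plane →ₗ[ℝ] Plane) b
  have h2 := LinearMap.trace_eq_sum_inner (fderiv ℝ F x : Plane →ₗ[ℝ] Plane)
    (EuclideanSpace.basisFun (Fin 2) ℝ)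
  rw [h1, Fin.sum_univ_two] at h2
  rw [divergence]
  refine Eq.trans ?_ h2.symm
  refine Finset.sum_congr rfl fun i _ => ?_
  rw [EuclideanSpace.basisFun_apply, EuclideanSpace.inner_single_left]
  simp

/-- The self-snakes operator in gauge coordinates. -/
theorem selfSnakes_eq {g : ℝ → ℝ} {g' : ℝ} {u : Plane → ℝ} {x₀ : Plane}
    (hu : ContDiffAt ℝ 3 u x₀) (hw : gradient u x₀ ≠ 0) (hg : HasDerivAt g g' ‖gradient u x₀‖)
    (b : OrthonormalBasis (Fin 2) ℝ Plane) (hb : gradient u x₀ = ‖gradient u x₀‖ • b 0) :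
    DifferentiableAt ℝ (snakeFlux g u) x₀ ∧ selfSnakes g u x₀ =
      g ‖gradient u x₀‖ * inner ℝ (b 1) (fderiv ℝ (gradient u) x₀ (b 1)) +
      ‖gradient u x₀‖ * g' * inner ℝ (b 0) (fderiv ℝ (gradient u) x₀ (b 0)) := by
  set G := gradient u with hG
  have hGd : HasFDerivAt G (fderiv ℝ G x₀) x₀ :=
    ((contDiffAt_gradient hu).differentiableAt (by norm_num)).hasFDerivAt
  set H := fderiv ℝ G x₀ with hH
  set a := ‖G x₀‖ with ha
  have ha0 : a ≠ 0 := norm_ne_zero_iff.2 hw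
  have hN : HasFDerivAt (fun x => ‖G x‖) (fderiv ℝ (fun x => ‖G x‖) x₀) x₀ :=
    (hGd.differentiableAt.norm ℝ hw).hasFDerivAt
  set N := fderiv ℝ (fun x => ‖G x‖) x₀ with hNdef
  -- Compare two derivatives of `‖G‖²`; this avoids the derivative of the square root.
  have hNv : ∀ v, N v = inner ℝ (b 0) (H v) := by
    intro v
    have h1 := hN.mul hN
    have h2 := hGd.norm_sq
    have h3 : (fun x => ‖G x‖) * (fun x => ‖G x‖) = fun x => ‖G x‖ ^ 2 := by
      funext x; simp [sq]
    rw [h3] at h1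
    have h4 := congrArg (fun L : Plane →L[ℝ] ℝ => L v) (h1.unique h2)
    simp only [← ha, add_apply, smul_apply, ContinuousLinearMap.comp_apply, innerSL_apply_apply,
      smul_eq_mul] at h4
    rw [hb, real_inner_smul_left] at h4
    simp only [nsmul_eq_mul, Nat.cast_ofNat] at h4
    have h5 : a * N v = a * inner ℝ (b 0) (H v) := by linarith
    exact mul_left_cancel₀ ha0 h5
  -- With `φ(r) = g(r)/r` the normal second derivative gets the factor `a φ' + φ = g'`, the
  -- tangential one `φ = g/a`.
  have hφ1 : HasDerivAt (fun r => g r / r) ((g' * a - g a * 1) / a ^ 2) a :=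
    hg.div (hasDerivAt_id a) ha0
  have hφ := hφ1.comp_hasFDerivAt x₀ hN
  have hF := hφ.smul hGd
  have hF' : HasFDerivAt (snakeFlux g u) _ x₀ := hF
  refine ⟨hF'.differentiableAt, ?_⟩
  have hb0 : inner ℝ (b 0) (G x₀) = a := by
    rw [hb, real_inner_smul_right, real_inner_self_eq_norm_sq]; simp
  have hb1 : inner ℝ (b 1) (G x₀) = 0 := by
    rw [hb, real_inner_smul_right, b.orthonormal.2 (by simp), mul_zero]
  rw [selfSnakes, divergence_eq_sum_inner _ _ b, hF'.fderiv]
  simp only [add_apply, smul_apply, ContinuousLinearMap.smulRight_apply, inner_add_right,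
    real_inner_smul_right, hb0, hb1, hNv, Function.comp_apply, smul_eq_mul, ← ha, ← hG]
  field_simp
  ring

/-! ### Existence and comparison of medians -/

/-- The median is the infimum of the levels exceeded on at most half of the area; both inequalities
pass to the infimum by continuity of the measure along increasing unions. -/
theorem exists_isMedianOn {u : Plane → ℝ} {B A : Set Plane} (hB : IsCompact B)
    (hu : ContinuousOn u B) (hA : A ⊆ B) : ∃ μ, IsMedianOn u A μ := by
  have hVf : volume A ≠ ⊤ := measure_ne_top_of_subset hA hB.measure_lt_top.ne
  rcases eq_or_ne (volume A) 0 with h0 | h0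
  · refine ⟨0, ?_, ?_⟩ <;>
    · rw [h0, ENNReal.zero_div, nonpos_iff_eq_zero]
      exact measure_mono_null (fun x hx => hx.1) h0
  obtain ⟨R, hR⟩ := hB.exists_bound_of_continuousOn hu
  set T : Set ℝ := {t | volume {x | x ∈ A ∧ t < u x} ≤ volume A / 2} with hT
  have hRT : R ∈ T := by
    have : {x | x ∈ A ∧ R < u x} = ∅ := by
      ext x
      refine ⟨fun hx => ?_, fun hx => hx.elim⟩
      exact absurd hx.2 (not_lt.2 ((le_abs_self _).trans (hR x (hA hx.1))))
    change volume {x | x ∈ A ∧ R < u x} ≤ _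
    rw [this, measure_empty]
    exact zero_le
  have hbdd : BddBelow T := by
    refine ⟨-R, fun t ht => ?_⟩
    by_contra hlt
    push Not at hlt
    have : {x | x ∈ A ∧ t < u x} = A := by
      ext x
      refine ⟨fun hx => hx.1, fun hx => ⟨hx, ?_⟩⟩
      have := (abs_le.1 (hR x (hA hx))).1
      linarith
    change volume {x | x ∈ A ∧ t < u x} ≤ _ at ht
    rw [this] at ht
    exact absurd (ENNReal.half_lt_self h0 hVf) (not_lt.2 ht)
  refine ⟨sInf T, ?_, ?_⟩
  · have e : {x | x ∈ A ∧ u x < sInf T} =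
        ⋃ n : ℕ, {x | x ∈ A ∧ u x ≤ sInf T - 1 / ((n : ℝ) + 1)} := by
      ext x
      rw [mem_iUnion]
      constructor
      · rintro ⟨hx, hlt⟩
        obtain ⟨n, hn⟩ := exists_nat_one_div_lt (sub_pos.2 hlt)
        exact ⟨n, hx, by linarith⟩
      · rintro ⟨n, hx, hle⟩
        have : 0 < 1 / ((n : ℝ) + 1) := by positivity
        exact ⟨hx, by linarith⟩
    have hmono : Monotone fun n : ℕ => {x | x ∈ A ∧ u x ≤ sInf T - 1 / ((n : ℝ) + 1)} := by
      intro i j hij x hx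
      have : 1 / ((j : ℝ) + 1) ≤ 1 / ((i : ℝ) + 1) := by gcongr
      exact ⟨hx.1, by linarith [hx.2]⟩
    rw [e, hmono.measure_iUnion]
    refine iSup_le fun n => ?_
    set t := sInf T - 1 / ((n : ℝ) + 1) with ht
    have htT : t ∉ T := by
      intro hmem
      have : 0 < 1 / ((n : ℝ) + 1) := by positivity
      have := csInf_le hbdd hmem
      linarith
    -- `A` may be non-measurable; it is split by a measurable sublevel set of `u` in the compact set
    -- `B`.
    have hD : MeasurableSet (B ∩ u ⁻¹' Iic t) :=
      (hu.preimage_isClosed_of_isClosed hB.isClosed isClosed_Iic).measurableSet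
    have hsum := measure_inter_add_sdiff (μ := volume) A hD
    have e1 : A ∩ (B ∩ u ⁻¹' Iic t) = {x | x ∈ A ∧ u x ≤ t} := by
      ext x
      exact ⟨fun hx => ⟨hx.1, hx.2.2⟩, fun hx => ⟨hx.1, hA hx.1, hx.2⟩⟩
    have e2 : A \ (B ∩ u ⁻¹' Iic t) = {x | x ∈ A ∧ t < u x} := by
      ext x
      exact ⟨fun hx => ⟨hx.1, not_le.1 fun hle => hx.2 ⟨hA hx.1, hle⟩⟩,
        fun hx => ⟨hx.1, fun hh => not_lt.2 hh.2 hx.2⟩⟩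
    rw [e1, e2] at hsum
    have hgt : volume A / 2 < volume {x | x ∈ A ∧ t < u x} := not_le.1 htT
    by_contra hcon
    have := ENNReal.add_lt_add (not_le.1 hcon) hgt
    rw [hsum, ENNReal.add_halves] at this
    exact lt_irrefl _ this
  · have e : {x | x ∈ A ∧ sInf T < u x} =
        ⋃ n : ℕ, {x | x ∈ A ∧ sInf T + 1 / ((n : ℝ) + 1) < u x} := by
      ext x
      rw [mem_iUnion]
      constructor
      · rintro ⟨hx, hlt⟩
        obtain ⟨n, hn⟩ := exists_nat_one_div_lt (sub_pos.2 hlt)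
        exact ⟨n, hx, by linarith⟩
      · rintro ⟨n, hx, hle⟩
        have : 0 < 1 / ((n : ℝ) + 1) := by positivity
        exact ⟨hx, by linarith⟩
    have hmono : Monotone fun n : ℕ => {x | x ∈ A ∧ sInf T + 1 / ((n : ℝ) + 1) < u x} := by
      intro i j hij x hx
      have : 1 / ((j : ℝ) + 1) ≤ 1 / ((i : ℝ) + 1) := by gcongr
      exact ⟨hx.1, by linarith [hx.2]⟩
    rw [e, hmono.measure_iUnion]
    refine iSup_le fun n => ?_
    obtain ⟨t, ht, hlt⟩ := exists_lt_of_csInf_lt ⟨R, hRT⟩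
      (lt_add_of_pos_right (sInf T) (by positivity : 0 < 1 / ((n : ℝ) + 1)))
    refine (measure_mono (t := {x | x ∈ A ∧ t < u x}) fun x hx => ?_).trans ht
    exact ⟨hx.1, hlt.trans hx.2⟩

/-- If `μ > t`, the part of `A` where `u ≤ t` has at most half of the area, and by subadditivity the
part above has at least as much, contrary to the assumption. -/
theorem IsMedianOn.le_of_volume_lt {u : Plane → ℝ} {A : Set Plane} {μ t : ℝ}
    (hμ : IsMedianOn u A μ) (hA : volume A ≠ ⊤)
    (h : volume {x | x ∈ A ∧ t < u x} < volume {x | x ∈ A ∧ u x ≤ t}) : μ ≤ t := by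
  by_contra hlt
  push Not at hlt
  set X := volume {x | x ∈ A ∧ u x ≤ t}
  set Y := volume {x | x ∈ A ∧ t < u x}
  have hX : X ≠ ⊤ := measure_ne_top_of_subset (fun x hx => hx.1) hA
  have h1 : X ≤ volume A / 2 := by
    refine (measure_mono (t := {x | x ∈ A ∧ u x < μ}) fun x hx => ?_).trans hμ.1
    exact ⟨hx.1, hx.2.trans_lt hlt⟩
  have h2 : volume A ≤ X + Y := by
    refine (measure_mono fun x hx => ?_).trans (measure_union_le _ _)
    rcases le_or_gt (u x) t with h | h
    · exact Or.inl ⟨hx, h⟩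
    · exact Or.inr ⟨hx, h⟩
  have h3 : X + X ≤ volume A := by
    rw [← ENNReal.add_halves (volume A)]
    exact add_le_add h1 h1
  have h4 : X + Y < X + X := by rwa [ENNReal.add_lt_add_iff_left hX]
  exact lt_irrefl _ ((h3.trans h2).trans_lt h4)

/-! ### Symmetry under a change of sign of the image -/

section Negation

theorem gradient_neg (u : Plane → ℝ) (x : Plane) :
    gradient (fun y => -u y) x = -gradient u x := by
  rw [gradient, gradient, fderiv_fun_neg, map_neg]

theorem snakeFlux_neg (g : ℝ → ℝ) (u : Plane → ℝ) :
    snakeFlux g (fun y => -u y) = fun x => -snakeFlux g u x := by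
  funext x
  rw [snakeFlux, snakeFlux, gradient_neg, norm_neg, smul_neg]

theorem selfSnakes_neg (g : ℝ → ℝ) (u : Plane → ℝ) (x : Plane) :
    selfSnakes g (fun y => -u y) x = -selfSnakes g u x := by
  rw [selfSnakes, selfSnakes, snakeFlux_neg, gradient_neg, norm_neg, divergence, divergence,
    fderiv_fun_neg]
  simp only [neg_apply, PiLp.neg_apply, Finset.sum_neg_distrib, mul_neg]

theorem amoebaLength_neg {ν : ℝ → ℝ} (hν : ∀ x, ν (-x) = ν x) (f : Plane → ℝ) (γ : ℝ → Plane) :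
    amoebaLength ν (fun x => -f x) γ = amoebaLength ν f γ := by
  rw [amoebaLength, amoebaLength]
  refine intervalIntegral.integral_congr fun t _ => ?_
  rw [deriv.fun_neg, neg_div, hν]

theorem amoeba_neg {ν : ℝ → ℝ} (hν : ∀ x, ν (-x) = ν x) (Ω : Set Plane) (f : Plane → ℝ) (ρ : ℝ)
    (x : Plane) : amoeba ν Ω (fun x => -f x) ρ x = amoeba ν Ω f ρ x := by
  simp only [amoeba, amoebaDist, amoebaLength_neg hν]

theorem IsAmoebaMedian.neg {ν : ℝ → ℝ} (hν : ∀ x, ν (-x) = ν x) {Ω : Set Plane} {u : Plane → ℝ}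
    {β ρ μ : ℝ} {x : Plane} (h : IsAmoebaMedian ν Ω (fun x => β * u x) u ρ x μ) :
    IsAmoebaMedian ν Ω (fun x => β * -u x) (fun x => -u x) ρ x (-μ) := by
  have e : amoeba ν Ω (fun x => β * -u x) ρ x = amoeba ν Ω (fun x => β * u x) ρ x := by
    simp only [mul_neg]
    exact amoeba_neg hν Ω (fun x => β * u x) ρ x
  rw [IsAmoebaMedian, e]
  refine ⟨?_, ?_⟩
  · simp only [neg_lt_neg_iff]
    exact h.2
  · simp only [neg_lt_neg_iff]
    exact h.1

end Negation

/-! ### Asymptotics of the median -/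

namespace ProfileSubgradient

variable {ν p : ℝ → ℝ} {c : ℝ}

theorem secondDiffIntegral_scaled_tendsto (h : ProfileSubgradient ν p c) {s Λ : ℝ} (hs : s ≠ 0)
    (hΛ : 0 < Λ) : Tendsto (fun ρ => secondDiffIntegral ν s (Λ * ρ) / ρ) (𝓝[>] 0) (𝓝 0) := by
  have h1 : Tendsto (fun ρ : ℝ => Λ * ρ) (𝓝[>] 0) (𝓝[>] 0) := by
    refine tendsto_nhdsWithin_iff.2 ⟨?_, ?_⟩
    · have : Continuous fun ρ : ℝ => Λ * ρ := by fun_prop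
      simpa only [mul_zero] using (this.tendsto 0).mono_left nhdsWithin_le_nhds
    · filter_upwards [self_mem_nhdsWithin] with ρ (hρ : 0 < ρ)
      exact mul_pos hΛ hρ
  have h2 := ((h.secondDiffIntegral_div_tendsto hs).comp h1).const_mul Λ
  rw [mul_zero] at h2
  refine h2.congr' ?_
  filter_upwards [self_mem_nhdsWithin] with ρ (hρ : 0 < ρ)
  simp only [Function.comp_apply]
  field_simp

/-- One-sided asymptotic bound for amoeba medians. -/
theorem exists_amoebaMedian_le (h : ProfileSubgradient ν p c) {β : ℝ} (hβ : 0 < β)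
    {Ω : Set Plane} {u : Plane → ℝ} (hu : ContDiffOn ℝ ∞ u Ω) {x₀ : Plane}
    (hx₀ : x₀ ∈ interior Ω) (hw : gradient u x₀ ≠ 0) :
    ∃ C Λ, 0 < Λ ∧ ∀ᶠ ρ in 𝓝[>] (0 : ℝ), ∀ μ,
      IsAmoebaMedian ν Ω (fun x => β * u x) u ρ x₀ μ →
      μ - (u x₀ + ρ ^ 2 / 6 * selfSnakes (edgeStop ν β) u x₀) ≤
        C * (ρ + secondDiffIntegral ν (β * ‖gradient u x₀‖) (Λ * ρ) / ρ) * ρ ^ 2 := by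
  have hΩ : Ω ∈ 𝓝 x₀ := mem_interior_iff_mem_nhds.1 hx₀
  have hu3 : ContDiffAt ℝ 3 u x₀ := (hu.contDiffAt hΩ).of_le (WithTop.coe_le_coe.2 (le_top : (3 : ℕ∞) ≤ ⊤))
  have hf : ContDiffOn ℝ 1 (fun x => β * u x) Ω :=
    contDiffOn_const.mul (hu.of_le (mod_cast (le_top : (1 : ℕ∞) ≤ ⊤)))
  obtain ⟨ε, hε, hball⟩ := Metric.mem_nhds_iff.1 hΩ
  obtain ⟨K, δ, hK, hδ, htaylor⟩ := exists_taylor hu3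
  obtain ⟨b, hb⟩ := exists_orthonormalBasis_fst hw
  obtain ⟨Φ, hΦ, hΦv⟩ := exists_measurePreserving_coordinates b x₀
  set w := gradient u x₀ with hwdef
  set H := fderiv ℝ (gradient u) x₀ with hH
  set a := ‖w‖ with hadef
  have ha : 0 < a := norm_pos_iff.2 hw
  set q₁₁ := inner ℝ (b 0) (H (b 0))
  set q₁₂ := (inner ℝ (b 0) (H (b 1)) + inner ℝ (b 1) (H (b 0))) / 2
  set q₂₂ := inner ℝ (b 1) (H (b 1))
  set S := selfSnakes (edgeStop ν β) u x₀ with hS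
  have hSval : S = edgeStop ν β a * q₂₂ +
      a * (-(3 / 2) * β * amoebaJ3 ν (β * a)) * q₁₁ :=
    (selfSnakes_eq hu3 hw (h.hasDerivAt_edgeStop hβ ha) b hb).2
  have hwv : ∀ v : ℝ × ℝ, inner ℝ w (v.1 • b 0 + v.2 • b 1) = a * v.1 := by
    intro v
    rw [hb, real_inner_smul_left, inner_add_right, real_inner_smul_right, real_inner_smul_right,
      real_inner_self_eq_norm_sq, b.orthonormal.2 (by simp)]
    simp
  -- On segments of length at most `2ρ` the slope of `β u` varies by at most `β K · 2ρ`; the summand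
  -- `1` only ensures positivity.
  set Λ := 2 * β * K + 1 with hΛ
  have hΛ0 : 0 < Λ := by positivity
  obtain ⟨C, hC⟩ := h.exists_volume_lt (q₁₁ := q₁₁) (q₁₂ := q₁₂) (q₂₂ := q₂₂) ha hβ hK hΛ0.le
    (M := |S / 6| + 1) (by positivity)
  have hs0 : β * a ≠ 0 := (mul_pos hβ ha).ne'
  have hρt : Tendsto (fun ρ : ℝ => ρ) (𝓝[>] 0) (𝓝 0) := nhdsWithin_le_nhds
  have hηt : Tendsto (fun ρ => a / 4 * (|C| + 1) *
      (ρ + secondDiffIntegral ν (β * a) (Λ * ρ) / ρ)) (𝓝[>] 0) (𝓝 0) := by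
    simpa using (hρt.add (h.secondDiffIntegral_scaled_tendsto hs0 hΛ0)).const_mul
      (a / 4 * (|C| + 1))
  refine ⟨a / 4 * (|C| + 1), Λ, hΛ0, ?_⟩
  filter_upwards [self_mem_nhdsWithin, hηt.eventually (gt_mem_nhds one_pos),
    hρt.eventually (gt_mem_nhds (half_pos hε)), hρt.eventually (gt_mem_nhds (half_pos hδ)), hC]
    with ρ (hρ : 0 < ρ) hη hρε hρδ hC μ hμ
  set A := amoeba ν Ω (fun x => β * u x) ρ x₀ with hA
  set I := secondDiffIntegral ν (β * a) (Λ * ρ) with hI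
  have hI0 : 0 ≤ I := h.secondDiffIntegral_nonneg _ _
  -- The level `S/6` balances the areas exactly; raising it by `η` adds `4ρ³η/a = (|C| + 1)(ρ⁴ + ρ²
  -- I)`, just above the error allowed in `exists_volume_lt`.
  set η := a / 4 * (|C| + 1) * (ρ + I / ρ) with hηdef
  have hη0 : 0 ≤ η := by positivity
  have hAf : volume A ≠ ⊤ := by
    have hsub : A ⊆ Metric.closedBall x₀ ρ := fun x hx =>
      mem_closedBall_iff_norm.2 (h.norm_sub_le_of_mem_amoeba hf hρ.le hx)
    exact measure_ne_top_of_subset hsub (isCompact_closedBall x₀ ρ).measure_lt_top.ne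
  have hlocal : LocalAmoeba ν p a β q₁₁ q₁₂ q₂₂ K Λ ρ (Φ ⁻¹' A) (fun v => u (Φ v) - u x₀) := by
    refine ⟨fun v hv x => ?_, fun v hv0 hvr x hx hle => ?_, fun v hvr => ?_⟩
    · have := h.amoeba_le hf hρ.le hv x
      rw [hΦv, add_sub_cancel_left, norm_coordinates, ← mul_sub, ← hΦv] at this
      exact this
    · change Φ v ∈ A
      rw [hΦv] at hle ⊢
      set z : Plane := v.1 • b 0 + v.2 • b 1 with hz
      have hzr : ‖z‖ = radius v := norm_coordinates b v
      have hz0 : z ≠ 0 := by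
        intro h0
        apply hv0
        rw [h0, norm_zero] at hzr
        have h1 := abs_fst_le_radius v
        have h2 := abs_snd_le_radius v
        rw [← hzr] at h1 h2
        exact Prod.ext (abs_nonpos_iff.1 h1) (abs_nonpos_iff.1 h2)
      have hzpos : 0 < ‖z‖ := norm_pos_iff.2 hz0
      refine h.mem_amoeba hf (δ := Λ * ρ) (x := x) hz0 (fun t ht => hball ?_) (fun t ht => ?_) ?_
      · rw [mem_ball_iff_norm, add_sub_cancel_left, norm_smul, Real.norm_eq_abs,
          abs_of_nonneg ht.1, hzr]
        have := mul_le_of_le_one_left (radius_nonneg v) ht.2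
        linarith
      · have h1 := (htaylor z (by rw [hzr]; linarith)).1 t ⟨ht.1.le, ht.2.le⟩
        rw [deriv_const_mul_field, abs_le]
        have hx' : x * ‖z‖ = β * inner ℝ w z := by rw [hzr, hx, hwv]; ring
        have e : β * deriv (fun t : ℝ => u (x₀ + t • z)) t / ‖z‖ - x =
            β * (deriv (fun t : ℝ => u (x₀ + t • z)) t - inner ℝ w z) / ‖z‖ := by
          rw [mul_sub, ← hx']
          field_simp
        rw [e, ← abs_le, abs_div, abs_mul, abs_of_pos hβ, abs_norm, div_le_iff₀ hzpos]
        calc β * |deriv (fun t : ℝ => u (x₀ + t • z)) t - inner ℝ w z| ≤ β * (K * ‖z‖ ^ 2) := by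
              gcongr
          _ = β * K * ‖z‖ * ‖z‖ := by ring
          _ ≤ Λ * ρ * ‖z‖ := by
            refine mul_le_mul_of_nonneg_right ?_ hzpos.le
            rw [hzr]
            have : β * K * radius v ≤ β * K * (2 * ρ) := by gcongr
            rw [hΛ]
            linarith
      · rw [hzr, ← mul_sub]
        exact hle
    · have h1 := (htaylor (v.1 • b 0 + v.2 • b 1) (by rw [norm_coordinates]; linarith)).2
      rw [norm_coordinates, inner_coordinates, hwv, ← hΦv] at h1
      exact h1
  have hm : |S / 6 + η| ≤ |S / 6| + 1 := by
    refine (abs_add_le _ _).trans ?_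
    rw [abs_of_nonneg hη0]
    linarith
  have hvol := hC _ _ hlocal (S / 6 + η) hm (by
    have e : ρ ^ 3 * (2 * ((2 * (S / 6 + η) - q₂₂ / 3) / a) +
        β * (q₁₁ * amoebaJ3 ν (β * a) + q₂₂ * amoebaJ1 ν (β * a))) =
        (|C| + 1) * (ρ ^ 4 + ρ ^ 2 * I) := by
      rw [hSval, hηdef, edgeStop]
      field_simp
      ring
    rw [e]
    have h1 : C < |C| + 1 := by linarith [le_abs_self C]
    gcongr)
  have e1 : Φ ⁻¹' A ∩ {v | ρ ^ 2 * (S / 6 + η) < u (Φ v) - u x₀} =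
      Φ ⁻¹' {x | x ∈ A ∧ u x₀ + ρ ^ 2 * (S / 6 + η) < u x} := by
    ext v
    exact and_congr_right fun _ => (lt_sub_iff_add_lt' : ρ ^ 2 * (S / 6 + η) < u (Φ v) - u x₀ ↔ _)
  have e2 : Φ ⁻¹' A ∩ {v | u (Φ v) - u x₀ ≤ ρ ^ 2 * (S / 6 + η)} =
      Φ ⁻¹' {x | x ∈ A ∧ u x ≤ u x₀ + ρ ^ 2 * (S / 6 + η)} := by
    ext v
    exact and_congr_right fun _ => (sub_le_iff_le_add' : u (Φ v) - u x₀ ≤ _ ↔ _)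
  rw [e1, e2, hΦ.measure_preimage_equiv, hΦ.measure_preimage_equiv] at hvol
  have := hμ.le_of_volume_lt hAf hvol
  linarith

theorem eventually_amoebaMedian_sub_le (h : ProfileSubgradient ν p c) {β : ℝ} (hβ : 0 < β)
    {Ω : Set Plane} {u : Plane → ℝ} (hu : ContDiffOn ℝ ∞ u Ω) {x₀ : Plane}
    (hx₀ : x₀ ∈ interior Ω) (hw : gradient u x₀ ≠ 0) :
    (∀ ε > 0, ∀ᶠ ρ in 𝓝[>] (0 : ℝ), ∀ μ, IsAmoebaMedian ν Ω (fun x => β * u x) u ρ x₀ μ →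
      μ - (u x₀ + ρ ^ 2 / 6 * selfSnakes (edgeStop ν β) u x₀) ≤ ε * ρ ^ 2) ∧
    (ContDiffOn ℝ 2 ν (Ici 0) → ∃ C : ℝ, ∀ᶠ ρ in 𝓝[>] (0 : ℝ), ∀ μ,
      IsAmoebaMedian ν Ω (fun x => β * u x) u ρ x₀ μ →
      μ - (u x₀ + ρ ^ 2 / 6 * selfSnakes (edgeStop ν β) u x₀) ≤ C * ρ ^ 3) := by
  obtain ⟨C, Λ, hΛ, hC⟩ := h.exists_amoebaMedian_le hβ hu hx₀ hw
  have hs : 0 < β * ‖gradient u x₀‖ := mul_pos hβ (norm_pos_iff.2 hw)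
  have hρt : Tendsto (fun ρ : ℝ => ρ) (𝓝[>] 0) (𝓝 0) := nhdsWithin_le_nhds
  constructor
  · intro ε hε
    have ht := (hρt.add (h.secondDiffIntegral_scaled_tendsto hs.ne' hΛ)).const_mul C
    rw [add_zero, mul_zero] at ht
    filter_upwards [hC, ht.eventually (gt_mem_nhds hε)] with ρ hρ hlt μ hμ
    exact (hρ μ hμ).trans (mul_le_mul_of_nonneg_right hlt.le (sq_nonneg ρ))
  · intro hν
    obtain ⟨B, hB⟩ := h.exists_secondDiffIntegral_le hν hs
    refine ⟨|C| * (1 + B * Λ ^ 2), ?_⟩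
    filter_upwards [hC, self_mem_nhdsWithin, eventually_mul_le Λ hs] with ρ hρC (hρ : 0 < ρ) hΛρ μ hμ
    refine (hρC μ hμ).trans ?_
    have h1 := hB (Λ * ρ) (by positivity) hΛρ
    have h0 := h.secondDiffIntegral_nonneg (β * ‖gradient u x₀‖) (Λ * ρ)
    set I := secondDiffIntegral ν (β * ‖gradient u x₀‖) (Λ * ρ)
    have h2 : I / ρ ≤ B * Λ ^ 2 * ρ := by
      rw [div_le_iff₀ hρ]
      linarith
    calc C * (ρ + I / ρ) * ρ ^ 2 ≤ |C| * (ρ + B * Λ ^ 2 * ρ) * ρ ^ 2 := by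
          gcongr
          exact le_abs_self C
      _ = _ := by ring

end ProfileSubgradient

theorem IsAmoebaMedian.abs_sub_le {ν : ℝ → ℝ} (hν : ∀ x, ν (-x) = ν x) {Ω : Set Plane}
    {u : Plane → ℝ} {β ρ μ y S E : ℝ} {x : Plane}
    (hμ : IsAmoebaMedian ν Ω (fun x => β * u x) u ρ x μ)
    (h₁ : ∀ μ, IsAmoebaMedian ν Ω (fun x => β * u x) u ρ x μ → μ - (y + ρ ^ 2 / 6 * S) ≤ E)
    (h₂ : ∀ μ, IsAmoebaMedian ν Ω (fun x => β * -u x) (fun x => -u x) ρ x μ →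
      μ - (-y + ρ ^ 2 / 6 * -S) ≤ E) : |μ - (y + ρ ^ 2 / 6 * S)| ≤ E := by
  have a1 := h₁ μ hμ
  have a2 := h₂ (-μ) (hμ.neg hν)
  rw [abs_le]
  constructor <;> linarith

/-! ### The theorem -/

theorem corollary3 (ν : ℝ → ℝ) (hν : IsAmoebaProfile ν) (hν0 : ν 0 = 1) (β : ℝ) (hβ : 0 < β) :
    -- the identity `s g'(s) = h(s)`, with differentiability of `g`
    (∀ s : ℝ, 0 < s → DifferentiableAt ℝ (edgeStop ν β) s ∧
      s * deriv (edgeStop ν β) s = -(3 / 2) * β * s * amoebaJ3 ν (β * s)) ∧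
    -- one filtering step is a time step of size `ρ²/6` for the self-snakes equation
    (∀ (Ω : Set Plane) (u : Plane → ℝ), ContDiffOn ℝ ∞ u Ω →
      ∀ x₀ ∈ interior Ω, gradient u x₀ ≠ 0 →
        DifferentiableAt ℝ (snakeFlux (edgeStop ν β) u) x₀ ∧
        (∀ᶠ ρ in 𝓝[>] (0 : ℝ), ∃ μ, IsAmoebaMedian ν Ω (fun x => β * u x) u ρ x₀ μ) ∧
        (∀ ε > 0, ∀ᶠ ρ in 𝓝[>] (0 : ℝ), ∀ μ, IsAmoebaMedian ν Ω (fun x => β * u x) u ρ x₀ μ →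
          |μ - (u x₀ + ρ ^ 2 / 6 * selfSnakes (edgeStop ν β) u x₀)| ≤ ε * ρ ^ 2) ∧
        (ContDiffOn ℝ 2 ν (Set.Ici 0) → ∃ C : ℝ, ∀ᶠ ρ in 𝓝[>] (0 : ℝ), ∀ μ,
          IsAmoebaMedian ν Ω (fun x => β * u x) u ρ x₀ μ →
            |μ - (u x₀ + ρ ^ 2 / 6 * selfSnakes (edgeStop ν β) u x₀)| ≤ C * ρ ^ 3)) ∧
    -- the second integral representation of `g`
    (∀ s : ℝ, 0 < s → edgeStop ν β s =
      3 * amoebaI1 ν (β * s) / (β ^ 2 * s ^ 2 * amoebaPsi ν (1 / (β * s)) ^ 3)) := by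
  obtain ⟨p, c, h⟩ := hν.exists_subgradient hν0
  refine ⟨fun s hs => ?_, fun Ω u hu x₀ hx₀ hw => ?_, fun s hs => h.edgeStop_eq_amoebaI1 hβ hs⟩
  · have hd := h.hasDerivAt_edgeStop hβ hs
    exact ⟨hd.differentiableAt, by rw [hd.deriv]; ring⟩
  have hΩ : Ω ∈ 𝓝 x₀ := mem_interior_iff_mem_nhds.1 hx₀
  have hf : ContDiffOn ℝ 1 (fun x => β * u x) Ω :=
    contDiffOn_const.mul (hu.of_le (mod_cast (le_top : (1 : ℕ∞) ≤ ⊤)))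
  have hw' : gradient (fun x => -u x) x₀ ≠ 0 := by rwa [gradient_neg, neg_ne_zero]
  obtain ⟨ho, hO⟩ := h.eventually_amoebaMedian_sub_le hβ hu hx₀ hw
  obtain ⟨ho', hO'⟩ := h.eventually_amoebaMedian_sub_le hβ hu.neg hx₀ hw'
  rw [selfSnakes_neg] at ho' hO'
  refine ⟨?_, ?_, fun ε hε => ?_, fun hC => ?_⟩
  · obtain ⟨b, hb⟩ := exists_orthonormalBasis_fst hw
    exact (selfSnakes_eq ((hu.contDiffAt hΩ).of_le (WithTop.coe_le_coe.2 (le_top : (3 : ℕ∞) ≤ ⊤))) hw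
      (h.hasDerivAt_edgeStop hβ (norm_pos_iff.2 hw)) b hb).1
  · obtain ⟨r, hr, hball⟩ := Metric.nhds_basis_closedBall.mem_iff.1 hΩ
    filter_upwards [Ioo_mem_nhdsGT hr] with ρ hρ
    have hsub : Metric.closedBall x₀ ρ ⊆ Ω := (Metric.closedBall_subset_closedBall hρ.2.le).trans hball
    -- Amoeba length dominates Euclidean length because `ν ≥ 1`, so the amoeba lies in a closed ball
    -- inside `Ω`.
    exact exists_isMedianOn (isCompact_closedBall x₀ ρ) (hu.continuousOn.mono hsub) fun x hx =>
      mem_closedBall_iff_norm.2 (h.norm_sub_le_of_mem_amoeba hf hρ.1.le hx)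
  · filter_upwards [ho ε hε, ho' ε hε] with ρ h₁ h₂ μ hμ
    exact hμ.abs_sub_le h.even h₁ h₂
  · obtain ⟨C₁, h₁⟩ := hO hC
    obtain ⟨C₂, h₂⟩ := hO' hC
    refine ⟨max C₁ C₂, ?_⟩
    filter_upwards [h₁, h₂, self_mem_nhdsWithin] with ρ h₁ h₂ (hρ : 0 < ρ) μ hμ
    have m₁ : C₁ * ρ ^ 3 ≤ max C₁ C₂ * ρ ^ 3 := by gcongr; exact le_max_left _ _
    have m₂ : C₂ * ρ ^ 3 ≤ max C₁ C₂ * ρ ^ 3 := by gcongr; exact le_max_right _ _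
    exact hμ.abs_sub_le h.even (fun μ h => (h₁ μ h).trans m₁) fun μ h => (h₂ μ h).trans m₂
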